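/- Setting. For a distribution $G$ on $\mathbb R$ let $\mathrm{Med}(G)$ be the median (the midpoint of the median interval) and $\mathrm{MAD}(G)=\mathrm{Med}(|Y-\mathrm{Med}(G)|)$, $Y\sim G$. For a distribution $F$ of $X$ on $\mathbb R^d$ ($d\ge 1$), with $F_u$ the law of $u'X$, let $$O(x,F)=\sup_{\|u\|=1}\frac{|u'x-\mathrm{Med}(F_u)|}{\mathrm{MAD}(F_u)}\quad (0/0=0),\qquad PD(x,F)=\frac1{1+O(x,F)},\qquad PD^\alpha(F)=\{x: PD(x,F)\ge\alpha\},$$ $$R^\alpha(u,F)=\sup\{r\ge 0: ru\in PD^\alpha(F)\},\qquad PTM^\alpha(F)=\frac{\int_{PD^\alpha(F)}w(PD(x,F))\,x\,dF(x)}{\int_{PD^\alpha(F)}w(PD(x,F))\,dF(x)} .$$ The influence function of a functional $T$ is $IF(x;T,F)=\lim_{\varepsilon\to0^+}\big(T((1-\varepsilon)F+\varepsilon\delta_x)-T(F)\big)/\varepsilon$. Hypotheses. Let $F$ be spherically symmetric about $0$: $u'X$ has the same law as $Z$ for every unit vector $u$, where $Z$ and $-Z$ have the same law. Let $m_0=\mathrm{MAD}(Z)$,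 and let $Z$ have a density $h_z$ that is continuous and positive in neighborhoods of $0$ and of $m_0$. Let $0<\alpha<1$, $\beta=(1-\alpha)/\alpha$, $c=\beta m_0$, and let $F$ have a density $f$ that is continuous in a neighborhood of the sphere $\|y\|=c$. Let $w$ be continuously differentiable on $[0,1]$ with $\int_{PD^\alpha(F)}w(PD(y,F))\,dF(y)\neq0$. Let $F_0$ be the law of $X/m_0$ and $$c_0=\int_{\|y\|\le\beta}w\Big(\frac1{1+\|y\|}\Big)dF_0(y),\qquad c_1=\int_{\|y\|\le\beta}\frac{|y_1|\,w'\big(1/(1+\|y\|)\big)}{2h_z(0)(1+\|y\|)^2}\,dF_0(y).$$ Conclusion. (i) For all $x\in\mathbb R^d$ and unit vectors $u$ with $x=0$, or with $u'x\ne0$ and $|u'x|\ne m_0$, $$IF(x;R^\alpha(u,\cdot),F)=\frac{\beta\,\mathrm{sign}(|u'x|-m_0)}{4h_z(m_0)}+\frac{\mathrm{sign}(u'x)}{2h_z(0)} .$$ For every $x$, $IF(x;R^\alpha(u,\cdot),F)$ exists for almost every $u\in S^{d-1}$, and the sphere integral in (ii) converges absolutely. (ii) For every $x\in\mathbb R^d$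 such that $\|x\|\neq c$, or $\alpha\le\frac12$, or $\beta h_z(0)<2h_z(m_0)$, the influence function of $PTM^\alpha$ exists and $$IF(x;PTM^\alpha,F)=\frac1{c_0}\Big(\int_{S^{d-1}}c\,w(\alpha)f(cu)\,c^{d-1}\,IF(x;R^\alpha(u,\cdot),F)\,u\,du+\frac{c_1}{\|x\|}x+w\Big(\frac1{1+\|x\|/m_0}\Big)x\,I(\|x\|\le c)\Big),$$ where $du$ is surface measure (counting measure if $d=1$) and $x/\|x\|$ is read as $0$ at $x=0$. (iii) The influence function of $PTM^\alpha$ at $F$ is bounded: there is $C$ such that $\|IF(x;PTM^\alpha,F)\|\le C$ for every $x\in\mathbb R^d$ at which it exists. -/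

import Mathlib

open MeasureTheory Filter Topology Set

noncomputable section

namespace ProjDepth

/-- The median of a distribution on the line: the midpoint of the interval of all medians. -/
def med (G : Measure ℝ) : ℝ :=
  (sInf {t : ℝ | 1 / 2 ≤ G.real (Iic t)} + sSup {t : ℝ | 1 / 2 ≤ G.real (Ici t)}) / 2

/-- The median absolute deviation: the median of `|Y - Med Y|` for `Y` with law `G`. -/
def mad (G : Measure ℝ) : ℝ :=
  med (G.map fun y => |y - med G|)

/-- The law of the projection `u'X`, for `X` with law `F`. -/
def proj {d : ℕ} (F : Measure (EuclideanSpace ℝ (Fin d))) (u : EuclideanSpace ℝ (Fin d)) :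
    Measure ℝ :=
  F.map fun y => inner ℝ u y

/-- The outlyingness `sup_u |u'x - μ(F_u)| / σ(F_u)` over unit vectors `u`. The division is that
of extended nonnegative reals, so that `0 / 0 = 0` and `a / 0 = ∞` for `a > 0`. -/
def outlyingness {d : ℕ} (μ σ : Measure ℝ → ℝ) (F : Measure (EuclideanSpace ℝ (Fin d)))
    (x : EuclideanSpace ℝ (Fin d)) : ENNReal :=
  ⨆ u : Metric.sphere (0 : EuclideanSpace ℝ (Fin d)) 1,
    ENNReal.ofReal |inner ℝ (u : EuclideanSpace ℝ (Fin d)) x - μ (proj F u)|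
      / ENNReal.ofReal (σ (proj F u))

/-- The projection depth `1 / (1 + O(x, F))`. -/
def depth {d : ℕ} (μ σ : Measure ℝ → ℝ) (F : Measure (EuclideanSpace ℝ (Fin d)))
    (x : EuclideanSpace ℝ (Fin d)) : ℝ :=
  ((1 + outlyingness μ σ F x)⁻¹).toReal

/-- The projection depth region of level `α`. -/
def region {d : ℕ} (μ σ : Measure ℝ → ℝ) (α : ℝ) (F : Measure (EuclideanSpace ℝ (Fin d))) :
    Set (EuclideanSpace ℝ (Fin d)) :=
  {x | α ≤ depth μ σ F x}

/-- The directional radius `sup {r ≥ 0 : r u ∈ PD^α(F)}` of the depth region. -/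
def radius {d : ℕ} (μ σ : Measure ℝ → ℝ) (α : ℝ) (u : EuclideanSpace ℝ (Fin d))
    (F : Measure (EuclideanSpace ℝ (Fin d))) : ℝ :=
  sSup {r : ℝ | 0 ≤ r ∧ r • u ∈ region μ σ α F}

/-- The projection depth trimmed mean with weight function `w`. -/
def trimmedMean {d : ℕ} (μ σ : Measure ℝ → ℝ) (w : ℝ → ℝ) (α : ℝ)
    (F : Measure (EuclideanSpace ℝ (Fin d))) : EuclideanSpace ℝ (Fin d) :=
  (∫ y in region μ σ α F, w (depth μ σ F y) ∂F)⁻¹ •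
    ∫ y in region μ σ α F, w (depth μ σ F y) • y ∂F

/-- The point-mass contaminated distribution `(1 - ε) F + ε δ_x`. -/
def contaminate {d : ℕ} (F : Measure (EuclideanSpace ℝ (Fin d))) (ε : ℝ)
    (x : EuclideanSpace ℝ (Fin d)) : Measure (EuclideanSpace ℝ (Fin d)) :=
  ENNReal.ofReal (1 - ε) • F + ENNReal.ofReal ε • Measure.dirac x

/-- The influence function of the functional `T` at `F` exists at the point `x` and equals `L`. -/
def HasInfluence {d : ℕ} {V : Type*} [NormedAddCommGroup V] [NormedSpace ℝ V]
    (T : Measure (EuclideanSpace ℝ (Fin d)) → V) (F : Measure (EuclideanSpace ℝ (Fin d)))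
    (x : EuclideanSpace ℝ (Fin d)) (L : V) : Prop :=
  Tendsto (fun ε : ℝ => ε⁻¹ • (T (contaminate F ε x) - T F)) (𝓝[>] 0) (𝓝 L)

/-- The influence function `IF(x; T, F)` (meaningful where the limit exists). -/
def influence {d : ℕ} {V : Type*} [NormedAddCommGroup V] [NormedSpace ℝ V]
    (T : Measure (EuclideanSpace ℝ (Fin d)) → V) (F : Measure (EuclideanSpace ℝ (Fin d)))
    (x : EuclideanSpace ℝ (Fin d)) : V :=
  limUnder (𝓝[>] 0) (fun ε : ℝ => ε⁻¹ • (T (contaminate F ε x) - T F))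

/-- `X` with law `F` is spherically symmetric about the origin: `u'X` has the same law `ν` for
every unit vector `u`, and `ν` is symmetric. -/
def IsSphericallySymmetric {d : ℕ} (F : Measure (EuclideanSpace ℝ (Fin d))) (ν : Measure ℝ) :
    Prop :=
  ν.map (fun z => -z) = ν ∧
    ∀ u : EuclideanSpace ℝ (Fin d), ‖u‖ = 1 → proj F u = ν

end ProjDepth

end

noncomputable section

namespace ProjDepth

/-! ### Medians on the line -/

/-! Contamination at `x` turns the law of the projection on a unit vector `u` into `(1 - ε) ν + ε
δ_s` with `s = u'x`, so the problem starts on the line. The median of such a mixture is exactly `s`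
clamped between the quantiles of `ν` at levels `1/2 ± ε/(2(1 - ε))`. The MAD is `|s - median|`
clamped between the quantiles, at the same two levels, of `ν` folded at the contaminated median
(`exists_med_mix_eq`, `IsRegular.exists_clamp`). Differentiability of the distribution function at
`0` and `±m₀` then gives the median to first order as `ε sign(s)/(2 h(0))` and the MAD as `m₀ + ε
sign(|s| - m₀)/(4 h(m₀))`; the displacement of the centre drops out of the MAD because the slopes at
`±m₀` agree. Both deviations are `O(ε)` uniformly in `s`, and for small `ε` both functionals are
locally constant in `s` away from `s = 0` and `|s| = m₀` (`IsRegular.expansion`).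

Local constancy makes depth explicit. On the ray `r u`, directions `v` near `u` share the location
`M` and scale `S` of `u`, and `v'u` is largest at `v = u`; directions near `-u` follow by
reflection; all others lose a fixed amount that an `O(ε)` perturbation cannot restore
(`NearlySpherical.ray_bound`). So for small `ε` the outlyingness of `r u` is `(r - M)/S` and the
radius of the region is `β S + M`. The bad directions form a cone of measure zero, except for `x =
0` or `d = 1`, where no direction is bad.

The trimmed mean vanishes at `F`, so only the numerator needs a derivative; the denominator merely
converges to `c₀`. The numerator has three contributions. The moving boundary gives the sphere
integral, by polar coordinates and an integral over a shrinking radial interval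
(`TrimmedSetting.tendsto_integral_regionChange`). The change of weights inside the ball gives, by
dominated convergence, an integral whose MAD part is odd and vanishes and whose median part is a
multiple of `x/‖x‖` by reflection symmetry (`TrimmedSetting.integral_weightInfluence`). The point
mass contributes `w x` if `x` lies in its own contaminated region. That is clear off the sphere `‖x‖
= c`; on it, `β ≥ 1` or `β h(0) < 2 h(m₀)` keeps `x` inside. Boundedness does not need this
decision, since the point-mass term is bounded in either case. -/

theorem med_eq_of_forall {G : Measure ℝ} [IsProbabilityMeasure G] {m : ℝ}
    (h1 : ∀ t < m, G.real (Iic t) < 1 / 2) (h2 : ∀ t > m, G.real (Ici t) < 1 / 2) :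
    med G = m := by
  have hcomp : ∀ t, G.real (Ici t) = 1 - G.real (Iio t) := fun t => by
    rw [← compl_Iio, measureReal_compl measurableSet_Iio, probReal_univ]
  have hm1 : 1 / 2 ≤ G.real (Iic m) := by
    have ht : Tendsto (fun t => G.real (Iic t)) (𝓝[>] m) (𝓝 (G.real (Iic m))) := by
      have := (ProbabilityTheory.cdf G).right_continuous m
      have h := this.tendsto.mono_left (nhdsWithin_mono _ Ioi_subset_Ici_self)
      rw [ProbabilityTheory.cdf_eq_real] at h
      exact h.congr fun t => ProbabilityTheory.cdf_eq_real G t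
    refine ge_of_tendsto ht ?_
    filter_upwards [self_mem_nhdsWithin] with t ht
    have h3 := h2 t ht
    rw [hcomp] at h3
    have : G.real (Iio t) ≤ G.real (Iic t) := measureReal_mono Iio_subset_Iic_self
    linarith
  -- Half-lines `Iic` are right continuous but not left continuous, so the mass strictly below `m`
  -- is reached along an increasing union.
  have hm2 : 1 / 2 ≤ G.real (Ici m) := by
    have : Tendsto (fun n : ℕ => G.real (Iic (m - 1 / ((n : ℝ) + 1)))) atTop (𝓝 (G.real (Iio m))) := by
      have hU : Iio m = ⋃ n : ℕ, Iic (m - 1 / ((n : ℝ) + 1)) := by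
        ext t
        simp only [mem_Iio, mem_iUnion, mem_Iic]
        constructor
        · intro h
          obtain ⟨n, hn⟩ := exists_nat_one_div_lt (sub_pos.2 h)
          exact ⟨n, by linarith⟩
        · rintro ⟨n, hn⟩
          have : 0 < 1 / ((n : ℝ) + 1) := by positivity
          linarith
      rw [hU]
      have hmono : Monotone fun n : ℕ => Iic (m - 1 / ((n : ℝ) + 1)) := by
        intro a b hab
        apply Iic_subset_Iic.2
        have : 1 / ((b : ℝ) + 1) ≤ 1 / ((a : ℝ) + 1) := by gcongr
        linarith
      have := tendsto_measure_iUnion_atTop (μ := G) hmono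
      exact (ENNReal.tendsto_toReal (measure_ne_top _ _)).comp this
    have hle : G.real (Iio m) ≤ 1 / 2 := by
      refine le_of_tendsto this (Eventually.of_forall fun n => (h1 _ ?_).le)
      have : 0 < 1 / ((n : ℝ) + 1) := by positivity
      linarith
    rw [hcomp]; linarith
  have e1 : {t : ℝ | 1 / 2 ≤ G.real (Iic t)} = Ici m := by
    ext t
    simp only [mem_ofPred_eq, mem_Ici]
    refine ⟨fun h => not_lt.1 fun ht => (h1 t ht).not_ge h, fun h => hm1.trans ?_⟩
    exact measureReal_mono (Iic_subset_Iic.2 h)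
  have e2 : {t : ℝ | 1 / 2 ≤ G.real (Ici t)} = Iic m := by
    ext t
    simp only [mem_ofPred_eq, mem_Iic]
    refine ⟨fun h => not_lt.1 fun ht => (h2 t ht).not_ge h, fun h => hm2.trans ?_⟩
    exact measureReal_mono (Ici_subset_Ici.2 h)
  rw [med, e1, e2, csInf_Ici, csSup_Iic]
  ring

/-- The mixture `(1 - ε) G + ε δ_s` on the line. -/
def mix (G : Measure ℝ) (ε s : ℝ) : Measure ℝ :=
  ENNReal.ofReal (1 - ε) • G + ENNReal.ofReal ε • Measure.dirac s

theorem isProbabilityMeasure_mix {G : Measure ℝ} [IsProbabilityMeasure G] {ε s : ℝ}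
    (h0 : 0 ≤ ε) (h1 : ε ≤ 1) : IsProbabilityMeasure (mix G ε s) := by
  constructor
  simp only [mix, Measure.add_apply, Measure.smul_apply, measure_univ, smul_eq_mul, mul_one]
  rw [← ENNReal.ofReal_add (by linarith) h0]
  simp

theorem mix_real {G : Measure ℝ} [IsProbabilityMeasure G] {ε s : ℝ}
    (h0 : 0 ≤ ε) (h1 : ε ≤ 1) {A : Set ℝ} (hA : MeasurableSet A) :
    (mix G ε s).real A = (1 - ε) * G.real A + ε * A.indicator 1 s := by
  rw [mix, measureReal_add_apply (ENNReal.mul_ne_top ENNReal.ofReal_ne_top (measure_ne_top _ _))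
    (ENNReal.mul_ne_top ENNReal.ofReal_ne_top (measure_ne_top _ _)),
    measureReal_ennreal_smul_apply, measureReal_ennreal_smul_apply,
    ENNReal.toReal_ofReal (by linarith), ENNReal.toReal_ofReal h0]
  congr 2
  simp only [Measure.real, Measure.dirac_apply' s hA]
  by_cases hs : s ∈ A <;> simp [hs]

theorem map_mix {G : Measure ℝ} {ε s : ℝ} {g : ℝ → ℝ} (hg : Measurable g) :
    (mix G ε s).map g = mix (G.map g) ε (g s) := by
  rw [mix, mix, Measure.map_add _ _ hg, Measure.map_smul, Measure.map_smul, Measure.map_dirac' hg]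

/-- The atom adds `ε` to exactly those half-lines that contain `s`. The point `hi` is where the
lower mass reaches `1/2` without help from the atom, and `lo` where it does so with its help;
between them the atom itself is the median. -/
theorem med_mix_eq {G : Measure ℝ} [IsProbabilityMeasure G] {ε s lo hi : ℝ}
    (h0 : 0 ≤ ε) (h1 : ε ≤ 1)
    (hhi : ∀ t < hi, (1 - ε) * G.real (Iic t) < 1 / 2)
    (hhi' : ∀ t > hi, (1 - ε) * G.real (Ici t) + ε < 1 / 2)
    (hlo : ∀ t < lo, (1 - ε) * G.real (Iic t) + ε < 1 / 2)
    (hlo' : ∀ t > lo, (1 - ε) * G.real (Ici t) < 1 / 2) :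
    med (mix G ε s) = max lo (min hi s) := by
  have := isProbabilityMeasure_mix (G := G) (s := s) h0 h1
  apply med_eq_of_forall
  · intro t ht
    rw [mix_real h0 h1 measurableSet_Iic]
    have hb : ε * (Iic t).indicator (1 : ℝ → ℝ) s ≤ ε := by
      by_cases hs : s ∈ Iic t <;> simp [hs, h0]
    rcases lt_or_ge t lo with h | h
    · linarith [hlo t h]
    · have h' : t < min hi s := by
        rcases lt_max_iff.1 ht with h'' | h''
        · linarith
        · exact h''
      rw [lt_min_iff] at h'
      have hs : s ∉ Iic t := by simpa using h'.2
      simpa [hs] using hhi t h'.1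
  · intro t ht
    rw [mix_real h0 h1 measurableSet_Ici]
    have hb : ε * (Ici t).indicator (1 : ℝ → ℝ) s ≤ ε := by
      by_cases hs : s ∈ Ici t <;> simp [hs, h0]
    obtain ⟨ht1, ht2⟩ := max_lt_iff.1 ht
    rcases lt_or_ge hi t with h | h
    · linarith [hhi' t h]
    · have h' : s < t := by
        rcases min_lt_iff.1 ht2 with h'' | h''
        · linarith
        · exact h''
      have hs : s ∉ Ici t := by simpa using h'
      simpa [hs] using hlo' t ht1

theorem med_map_neg (G : Measure ℝ) : med (G.map fun y => -y) = -med G := by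
  have e1 : {t : ℝ | 1 / 2 ≤ (G.map fun y => -y).real (Iic t)}
      = -{t : ℝ | 1 / 2 ≤ G.real (Ici t)} := by
    ext t
    rw [Set.mem_neg, mem_ofPred_eq, mem_ofPred_eq, map_measureReal_apply measurable_neg measurableSet_Iic]
    congr! 2
    ext; simp
  have e2 : {t : ℝ | 1 / 2 ≤ (G.map fun y => -y).real (Ici t)}
      = -{t : ℝ | 1 / 2 ≤ G.real (Iic t)} := by
    ext t
    rw [Set.mem_neg, mem_ofPred_eq, mem_ofPred_eq, map_measureReal_apply measurable_neg measurableSet_Ici]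
    congr! 2
    ext; simp
  -- On the reals `sInf` is by definition the negative of `sSup` of the negated set, so no
  -- boundedness or nonemptiness is needed.
  rw [med, med, e1, e2, Real.sInf_def, neg_neg]
  have : sSup (-{t : ℝ | 1 / 2 ≤ G.real (Iic t)}) = - sInf {t : ℝ | 1 / 2 ≤ G.real (Iic t)} := by
    rw [Real.sInf_def, neg_neg]
  rw [this]; ring

theorem mad_map_neg (G : Measure ℝ) : mad (G.map fun y => -y) = mad G := by
  rw [mad, mad, med_map_neg, Measure.map_map (by fun_prop) (by fun_prop)]
  congr 2
  ext y
  simp only [Function.comp]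
  rw [← abs_neg]; congr 1; ring

theorem continuous_real_Iic (G : Measure ℝ) [IsProbabilityMeasure G] [NullSingletonClass G] :
    Continuous fun t => G.real (Iic t) := by
  have hm : Monotone fun t => G.real (Iic t) := fun a b hab => measureReal_mono (Iic_subset_Iic.2 hab)
  rw [continuous_iff_continuousAt]
  intro t
  have h := (ProbabilityTheory.cdf G).measure_singleton t
  rw [ProbabilityTheory.measure_cdf, measure_singleton] at h
  have hr := (ProbabilityTheory.cdf G).right_continuous t
  have hle := (ProbabilityTheory.cdf G).mono.leftLim_le (le_refl t)
  have heq : Function.leftLim (ProbabilityTheory.cdf G) t = ProbabilityTheory.cdf G t := by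
    have := ENNReal.ofReal_eq_zero.1 h.symm
    linarith
  have hl : ContinuousWithinAt (ProbabilityTheory.cdf G) (Iio t) t :=
    (ProbabilityTheory.cdf G).mono.continuousWithinAt_Iio_iff_leftLim_eq.2 heq
  have hc : ContinuousAt (ProbabilityTheory.cdf G) t := by
    rw [continuousAt_iff_continuous_left'_right']
    exact ⟨hl, hr.mono Ioi_subset_Ici_self⟩
  have : (fun t => G.real (Iic t)) = ProbabilityTheory.cdf G := by
    ext t; rw [ProbabilityTheory.cdf_eq_real]
  rw [this]; exact hc

theorem real_Ici_eq (G : Measure ℝ) [IsProbabilityMeasure G] [NullSingletonClass G] (t : ℝ) :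
    G.real (Ici t) = 1 - G.real (Iic t) := by
  rw [← compl_Iio, measureReal_compl measurableSet_Iio, probReal_univ,
    measureReal_congr Iio_ae_eq_Iic]

/-- A distribution without atoms gives mass `1 / 2` to the half-line below its median. -/
theorem real_Iic_med (G : Measure ℝ) [IsProbabilityMeasure G] [NullSingletonClass G] :
    G.real (Iic (med G)) = 1 / 2 := by
  have hc := continuous_real_Iic G
  have hm : Monotone fun t => G.real (Iic t) := fun a b hab => measureReal_mono (Iic_subset_Iic.2 hab)
  have htop : Tendsto (fun t => G.real (Iic t)) atTop (𝓝 1) :=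
    (ProbabilityTheory.tendsto_cdf_atTop G).congr (ProbabilityTheory.cdf_eq_real G)
  have hbot : Tendsto (fun t => G.real (Iic t)) atBot (𝓝 0) :=
    (ProbabilityTheory.tendsto_cdf_atBot G).congr (ProbabilityTheory.cdf_eq_real G)
  obtain ⟨T, hT⟩ := (htop.eventually (lt_mem_nhds (show (1 : ℝ) / 2 < 1 by norm_num))).exists
  obtain ⟨B, hB⟩ := (hbot.eventually (gt_mem_nhds (show (0 : ℝ) < 1 / 2 by norm_num))).exists
  obtain ⟨p, hp⟩ : ∃ p, G.real (Iic p) = 1 / 2 :=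
    mem_range_of_exists_le_of_exists_ge hc ⟨B, hB.le⟩ ⟨T, hT.le⟩
  set A := {t : ℝ | 1 / 2 ≤ G.real (Iic t)} with hA
  set A' := {t : ℝ | 1 / 2 ≤ G.real (Ici t)} with hA'
  have hA'e : A' = {t : ℝ | G.real (Iic t) ≤ 1 / 2} := by
    ext t; simp only [hA', mem_ofPred_eq, real_Ici_eq]
    constructor <;> intro h <;> linarith
  have hbb : BddBelow A := ⟨B, fun t ht => by
    by_contra! h
    have := hm h.le
    simp only [hA, mem_ofPred_eq] at ht
    simp only at this
    linarith⟩
  have hba : BddAbove A' := ⟨T, fun t ht => by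
    by_contra! h
    have := hm h.le
    simp only [hA'e, mem_ofPred_eq] at ht
    simp only at this
    linarith⟩
  have hpA : p ∈ A := by simp [hA, hp]
  have hpA' : p ∈ A' := by simp [hA'e, hp]
  -- Continuity makes both sets closed, so their end points belong to them; the midpoint lies
  -- between these, and monotonicity traps its mass at `1/2`.
  have i1 : sInf A ∈ A := (isClosed_le continuous_const hc).csInf_mem ⟨p, hpA⟩ hbb
  have i2 : sSup A' ∈ A' := by
    rw [hA'e] at hba hpA' ⊢
    exact (isClosed_le hc continuous_const).csSup_mem ⟨p, hpA'⟩ hba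
  have l1 : sInf A ≤ p := csInf_le hbb hpA
  have l2 : p ≤ sSup A' := le_csSup hba hpA'
  have hmed : med G = (sInf A + sSup A') / 2 := rfl
  have m1 : sInf A ≤ med G := by rw [hmed]; linarith
  have m2 : med G ≤ sSup A' := by rw [hmed]; linarith
  apply le_antisymm
  · rw [hA'e] at i2
    exact (hm m2).trans (by rw [hA'e]; exact i2)
  · exact le_trans i1 (hm m1)

/-- The median of a contaminated distribution is the contamination, clamped between two
quantiles. -/
theorem exists_med_mix_eq {G : Measure ℝ} [IsProbabilityMeasure G] [NullSingletonClass G] {m δ k ε : ℝ}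
    (hδ : 0 < δ) (hk : 0 < k)
    (hinc : ∀ a b, m - δ ≤ a → a ≤ b → b ≤ m + δ → k * (b - a) ≤ G.real (Iic b) - G.real (Iic a))
    (h0 : 0 < ε) (h1 : ε < 1)
    (hsmall : |G.real (Iic m) - 1 / 2| + ε / (2 * (1 - ε)) < k * δ) :
    ∃ lo hi, |lo - m| ≤ δ ∧ |hi - m| ≤ δ ∧
      G.real (Iic lo) = 1 / 2 - ε / (2 * (1 - ε)) ∧
      G.real (Iic hi) = 1 / 2 + ε / (2 * (1 - ε)) ∧
      ∀ s, med (mix G ε s) = max lo (min hi s) := by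
  have hc := continuous_real_Iic G
  have hm : Monotone fun t => G.real (Iic t) := fun a b hab => measureReal_mono (Iic_subset_Iic.2 hab)
  have h1' : 0 < 1 - ε := by linarith
  have hpos : 0 < ε / (2 * (1 - ε)) := by positivity
  have habs := abs_le.1 (le_refl |G.real (Iic m) - 1 / 2|)
  have u1 := hinc m (m + δ) (by linarith) (by linarith) le_rfl
  have u2 := hinc (m - δ) m le_rfl (by linarith) (by linarith)
  -- The slope `k` moves the distribution function by at least `k δ` on each side of `m`, and by
  -- `hsmall` this exceeds the distance from its value at `m` to either quantile level.
  have hex : ∀ p, |p - 1 / 2| ≤ ε / (2 * (1 - ε)) → ∃ t ∈ Icc (m - δ) (m + δ), G.real (Iic t) = p := by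
    intro p hp
    have hp := abs_le.1 hp
    have := intermediate_value_Icc (show m - δ ≤ m + δ by linarith) hc.continuousOn
    exact this ⟨by nlinarith, by nlinarith⟩
  have hstrict : ∀ a b, a ∈ Icc (m - δ) (m + δ) → b ∈ Icc (m - δ) (m + δ) → a < b →
      G.real (Iic a) < G.real (Iic b) := by
    intro a b ha hb hab
    have := hinc a b ha.1 hab.le hb.2
    have : 0 < k * (b - a) := mul_pos hk (by linarith)
    linarith
  obtain ⟨hi, hhi, ehi⟩ := hex (1 / 2 + ε / (2 * (1 - ε))) (by rw [add_sub_cancel_left, abs_of_pos hpos])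
  obtain ⟨lo, hlo, elo⟩ := hex (1 / 2 - ε / (2 * (1 - ε))) (by
    rw [sub_sub_cancel_left, abs_neg, abs_of_pos hpos])
  have hlohi : lo < hi := by
    by_contra! h
    have := hm h
    simp only at this
    linarith
  -- Strict growth is known only near `m`; truncating `t` to the neighbourhood and using global
  -- monotonicity extends the comparison to every `t`.
  have L : ∀ t p, p ∈ Icc (m - δ) (m + δ) → m - δ < p → t < p → G.real (Iic t) < G.real (Iic p) := by
    intro t p hp hp' htp
    refine lt_of_le_of_lt (hm (le_max_left t (m - δ))) (hstrict _ p ?_ hp (max_lt htp hp'))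
    exact ⟨le_max_right _ _, (max_lt htp hp').le.trans hp.2⟩
  have Rr : ∀ t p, p ∈ Icc (m - δ) (m + δ) → p < m + δ → p < t → G.real (Iic p) < G.real (Iic t) := by
    intro t p hp hp' htp
    refine lt_of_lt_of_le (hstrict p _ hp ?_ (lt_min htp hp')) (hm (min_le_left t (m + δ)))
    exact ⟨hp.1.trans (lt_min htp hp').le, min_le_right _ _⟩
  have id1 : (1 - ε) * (ε / (2 * (1 - ε))) = ε / 2 := by field_simp
  refine ⟨lo, hi, by rw [abs_le]; constructor <;> linarith [hlo.1, hlo.2],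
    by rw [abs_le]; constructor <;> linarith [hhi.1, hhi.2], elo, ehi, fun s => ?_⟩
  apply med_mix_eq h0.le h1.le
  · intro t ht
    have := L t hi hhi (lt_of_le_of_lt hlo.1 hlohi) ht
    nlinarith
  · intro t ht
    rw [real_Ici_eq]
    have : G.real (Iic hi) < G.real (Iic t) := by
      refine Rr t hi hhi (lt_of_le_of_ne hhi.2 fun h => ?_) ht
      rw [h] at ehi
      nlinarith
    nlinarith
  · intro t ht
    have : G.real (Iic t) < G.real (Iic lo) := by
      refine L t lo hlo (lt_of_le_of_ne hlo.1 fun h => ?_) ht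
      rw [← h] at elo
      nlinarith
    nlinarith
  · intro t ht
    rw [real_Ici_eq]
    have := Rr t lo hlo (lt_of_lt_of_le hlohi hhi.2) ht
    nlinarith

end ProjDepth

end

noncomputable section

namespace ProjDepth

/-! ### Asymptotics of median and MAD under point-mass contamination -/

/-- A symmetric law without atoms whose distribution function is strictly differentiable, with
positive derivatives, at its median `0` and at its MAD `m₀`. -/
structure IsRegular (ν : Measure ℝ) (h0 hm m₀ : ℝ) : Prop where
  prob : IsProbabilityMeasure ν
  atomless : NullSingletonClass ν
  symm : ν.map (fun z => -z) = ν
  h0_pos : 0 < h0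
  hm_pos : 0 < hm
  m₀_pos : 0 < m₀
  strict_zero : HasStrictDerivAt (fun t => ν.real (Iic t)) h0 0
  strict_mad : HasStrictDerivAt (fun t => ν.real (Iic t)) hm m₀
  cdf_mad : ν.real (Iic m₀) = 3 / 4

theorem real_Iic_neg {ν : Measure ℝ} [IsProbabilityMeasure ν] [NullSingletonClass ν]
    (hs : ν.map (fun z => -z) = ν) (t : ℝ) : ν.real (Iic (-t)) = 1 - ν.real (Iic t) := by
  rw [← real_Ici_eq]
  nth_rw 1 [← hs]
  rw [map_measureReal_apply measurable_neg measurableSet_Iic]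
  congr 1
  ext; simp

theorem med_eq_zero_of_symm {ν : Measure ℝ} (hs : ν.map (fun z => -z) = ν) : med ν = 0 := by
  have := med_map_neg ν
  rw [hs] at this
  linarith

theorem nullSingletonClass_map_abs {ν : Measure ℝ} [NullSingletonClass ν] (μ : ℝ) :
    NullSingletonClass (ν.map fun y => |y - μ|) := by
  constructor
  intro t
  rw [Measure.map_apply (by fun_prop) (measurableSet_singleton t)]
  refine measure_mono_null (t := {μ + t, μ - t}) ?_ ((Set.toFinite _).measure_zero ν)
  intro y hy
  simp only [mem_preimage, mem_singleton_iff] at hy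
  rcases abs_cases (y - μ) with h | h
  · left; linarith
  · right; simp only [mem_singleton_iff]; linarith

theorem isProbabilityMeasure_map_abs {ν : Measure ℝ} [IsProbabilityMeasure ν] (μ : ℝ) :
    IsProbabilityMeasure (ν.map fun y => |y - μ|) :=
  Measure.isProbabilityMeasure_map (by fun_prop)

theorem real_map_abs_Iic {ν : Measure ℝ} [IsProbabilityMeasure ν] [NullSingletonClass ν]
    (μ : ℝ) {t : ℝ} (ht : 0 ≤ t) :
    (ν.map fun y => |y - μ|).real (Iic t) = ν.real (Iic (μ + t)) - ν.real (Iic (μ - t)) := by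
  rw [map_measureReal_apply (by fun_prop) measurableSet_Iic]
  have e : (fun y => |y - μ|) ⁻¹' Iic t = Icc (μ - t) (μ + t) := by
    ext y
    simp only [mem_preimage, mem_Iic, abs_le, mem_Icc]
    constructor <;> rintro ⟨h, h'⟩ <;> constructor <;> linarith
  rw [e, measureReal_congr Ioc_ae_eq_Icc.symm, ← Iic_sdiff_Iic,
    measureReal_sdiff (Iic_subset_Iic.2 (by linarith)) measurableSet_Iic]

/-- Two-sided increment bounds near a point of strict differentiability. -/
theorem HasStrictDerivAt.exists_increment_bounds {H : ℝ → ℝ} {k p : ℝ} (hk : 0 < k)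
    (hH : HasStrictDerivAt H k p) :
    ∃ δ > 0, ∀ a b, |a - p| < δ → |b - p| < δ → a ≤ b →
      k / 2 * (b - a) ≤ H b - H a ∧ H b - H a ≤ 2 * k * (b - a) := by
  have h := hH.isLittleO.def (show 0 < k / 2 by positivity)
  rw [Metric.eventually_nhds_iff] at h
  obtain ⟨δ, hδ, h⟩ := h
  refine ⟨δ, hδ, fun a b ha hb hab => ?_⟩
  have := @h (b, a) (by rw [Prod.dist_eq]; simpa [Real.dist_eq] using ⟨hb, ha⟩)
  simp only [smul_eq_mul, Real.norm_eq_abs, ContinuousLinearMap.toSpanSingleton_apply,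
    abs_of_nonneg (sub_nonneg.2 hab)] at this
  have := abs_le.1 this
  constructor <;> nlinarith

theorem IsRegular.strict_neg_mad {ν : Measure ℝ} {h0 hm m₀ : ℝ} (R : IsRegular ν h0 hm m₀) :
    HasStrictDerivAt (fun t => ν.real (Iic t)) hm (-m₀) := by
  have := R.prob
  have := R.atomless
  have e : (fun t => ν.real (Iic t)) = fun t => 1 - ν.real (Iic (-t)) := by
    ext t; rw [real_Iic_neg R.symm]; ring
  rw [e]
  have h1 : HasStrictDerivAt (fun t => ν.real (Iic t)) hm (- -m₀) := by
    rw [neg_neg]; exact R.strict_mad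
  have := (h1.comp (-m₀) (hasStrictDerivAt_neg (-m₀))).const_sub 1
  simpa using this

theorem IsRegular.cdf_zero {ν : Measure ℝ} {h0 hm m₀ : ℝ} (R : IsRegular ν h0 hm m₀) :
    ν.real (Iic 0) = 1 / 2 := by
  have := R.prob
  have := R.atomless
  have := real_Iic_neg R.symm 0
  rw [neg_zero] at this
  linarith

theorem IsRegular.cdf_neg_mad {ν : Measure ℝ} {h0 hm m₀ : ℝ} (R : IsRegular ν h0 hm m₀) :
    ν.real (Iic (-m₀)) = 1 / 4 := by
  have := R.prob
  have := R.atomless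
  have := real_Iic_neg R.symm m₀
  rw [R.cdf_mad] at this
  linarith

/-- Folding commutes with mixing, so the clamp formula for medians applies a second time. The centre
of folding is the contaminated median, which is why the clamp for the MAD is needed for all small
centres. -/
theorem mad_mix_eq {ν : Measure ℝ} {ε s : ℝ} :
    mad (mix ν ε s)
      = med (mix (ν.map fun y => |y - med (mix ν ε s)|) ε |s - med (mix ν ε s)|) := by
  rw [mad, map_mix (by fun_prop)]

theorem med_mix_neg {ν : Measure ℝ} (hs : ν.map (fun z => -z) = ν) (ε s : ℝ) :
    med (mix ν ε (-s)) = -med (mix ν ε s) := by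
  rw [← med_map_neg, map_mix measurable_neg, hs]

theorem mad_mix_neg {ν : Measure ℝ} (hs : ν.map (fun z => -z) = ν) (ε s : ℝ) :
    mad (mix ν ε (-s)) = mad (mix ν ε s) := by
  rw [← mad_map_neg (mix ν ε s), map_mix measurable_neg, hs]

/-- Two uses of `exists_med_mix_eq`: for `ν` near `0`, and for `ν` folded at any centre `|μ| ≤ q ε`
near `m₀`. The constant `K` depends neither on `s` nor on `μ`, which supplies all later uniformity
in the direction and in `x`. -/
theorem IsRegular.exists_clamp {ν : Measure ℝ} {h0 hm m₀ : ℝ} (R : IsRegular ν h0 hm m₀) :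
    ∃ K > 0, ∃ q : ℝ → ℝ, ∃ lo hi : ℝ → ℝ → ℝ, ∀ᶠ ε in 𝓝[>] (0 : ℝ),
      0 < ε ∧ 0 < q ε ∧ q ε ≤ K * ε ∧ ν.real (Iic (q ε)) = 1 / 2 + ε / (2 * (1 - ε)) ∧
      (∀ s, med (mix ν ε s) = max (-q ε) (min (q ε) s)) ∧
      ∀ μ, |μ| ≤ q ε →
        (|lo ε μ - m₀| ≤ K * ε ∧ |hi ε μ - m₀| ≤ K * ε ∧
        ν.real (Iic (μ + lo ε μ)) - ν.real (Iic (μ - lo ε μ)) = 1 / 2 - ε / (2 * (1 - ε)) ∧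
        ν.real (Iic (μ + hi ε μ)) - ν.real (Iic (μ - hi ε μ)) = 1 / 2 + ε / (2 * (1 - ε)) ∧
        ∀ t, med (mix (ν.map fun y => |y - μ|) ε t) = max (lo ε μ) (min (hi ε μ) t)) := by
  have := R.prob
  have := R.atomless
  have h0p := R.h0_pos
  have hmp := R.hm_pos
  have mp := R.m₀_pos
  obtain ⟨δ0, hδ0, B0⟩ := HasStrictDerivAt.exists_increment_bounds R.h0_pos R.strict_zero
  obtain ⟨δ1, hδ1, B1⟩ := HasStrictDerivAt.exists_increment_bounds R.hm_pos R.strict_mad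
  obtain ⟨δ2, hδ2, B2⟩ := HasStrictDerivAt.exists_increment_bounds R.hm_pos R.strict_neg_mad
  -- With slope at least `h0 / 2`, a window of size `K0 * ε` gains mass `2 * ε`, more than the
  -- quantile offset, which is at most `ε`. Likewise `K1` makes the gain `hm * K1 * ε` exceed the
  -- recentring error `4 * hm * K0 * ε` plus the offset.
  set K0 := 4 / h0 with hK0
  have K0p : 0 < K0 := by positivity
  set K1 := (4 * hm * K0 + 2) / hm with hK1
  have K1p : 0 < K1 := by positivity
  have K0h : h0 / 2 * K0 = 2 := by rw [hK0]; field_simp; norm_num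
  have K1h : hm * K1 = 4 * hm * K0 + 2 := by rw [hK1]; field_simp
  have small : ∀ r > 0, ∀ᶠ ε in 𝓝[>] (0 : ℝ), (K0 + K1) * ε < r := fun r hr => by
    have : Tendsto (fun ε => (K0 + K1) * ε) (𝓝[>] 0) (𝓝 0) := by
      have : Tendsto (fun ε : ℝ => (K0 + K1) * ε) (𝓝 0) (𝓝 ((K0 + K1) * 0)) := by
        exact (continuous_const.mul continuous_id).tendsto 0
      rw [mul_zero] at this
      exact this.mono_left nhdsWithin_le_nhds
    exact this.eventually (gt_mem_nhds hr)
  have key : ∀ᶠ ε in 𝓝[>] (0 : ℝ), ∃ (q : ℝ) (lo hi : ℝ → ℝ),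
      0 < ε ∧ 0 < q ∧ q ≤ (K0 + K1) * ε ∧ ν.real (Iic q) = 1 / 2 + ε / (2 * (1 - ε)) ∧
      (∀ s, med (mix ν ε s) = max (-q) (min q s)) ∧
      ∀ μ, |μ| ≤ q →
        (|lo μ - m₀| ≤ (K0 + K1) * ε ∧ |hi μ - m₀| ≤ (K0 + K1) * ε ∧
        ν.real (Iic (μ + lo μ)) - ν.real (Iic (μ - lo μ)) = 1 / 2 - ε / (2 * (1 - ε)) ∧
        ν.real (Iic (μ + hi μ)) - ν.real (Iic (μ - hi μ)) = 1 / 2 + ε / (2 * (1 - ε)) ∧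
        ∀ t, med (mix (ν.map fun y => |y - μ|) ε t) = max (lo μ) (min (hi μ) t)) := by
    filter_upwards [small δ0 hδ0, small δ1 hδ1, small δ2 hδ2, small m₀ mp,
      self_mem_nhdsWithin, small ((K0 + K1) / 2) (by positivity)] with ε e0 e1 e2 em ep eh
    have ep : 0 < ε := ep
    have ehalf : ε < 1 / 2 := by
      by_contra! h
      nlinarith
    have e1' : 0 < 1 - ε := by linarith
    have efr : ε / (2 * (1 - ε)) ≤ ε := by
      rw [div_le_iff₀ (by positivity)]; nlinarith
    have efp : 0 < ε / (2 * (1 - ε)) := by positivity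
    have sK0 : K0 * ε < (K0 + K1) * ε := by nlinarith
    have sK1 : K1 * ε < (K0 + K1) * ε := by nlinarith
    obtain ⟨lo, q, hlo, hq, elo, eq, hmed⟩ := exists_med_mix_eq (G := ν) (m := 0) (δ := K0 * ε)
      (k := h0 / 2) (ε := ε) (by positivity) (by positivity)
      (fun a b ha hab hb => (B0 a b (by rw [abs_lt]; constructor <;> linarith)
        (by rw [abs_lt]; constructor <;> linarith) hab).1) ep (by linarith)
      (by rw [R.cdf_zero, sub_self, abs_zero, zero_add, ← mul_assoc, K0h]; linarith)
    rw [sub_zero] at hlo hq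
    have hlo' := abs_le.1 hlo
    have hq' := abs_le.1 hq
    have qpos : 0 < q := by
      by_contra! h
      have : ν.real (Iic q) ≤ ν.real (Iic 0) := measureReal_mono (Iic_subset_Iic.2 h)
      rw [R.cdf_zero, eq] at this
      linarith
    -- Symmetry gives `lo` and `-q` the same distribution function value, and the slope near `0`
    -- makes that function injective there.
    have hloq : lo = -q := by
      have h1 : ν.real (Iic lo) = ν.real (Iic (-q)) := by
        rw [real_Iic_neg R.symm, elo, eq]; ring
      rcases le_total lo (-q) with h | h
      · have := (B0 lo (-q) (by rw [abs_lt]; constructor <;> linarith)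
          (by rw [abs_lt]; constructor <;> linarith) h).1
        have : h0 / 2 * (-q - lo) ≤ 0 := by linarith
        have : -q - lo ≤ 0 := by
          by_contra! h'
          have : 0 < h0 / 2 * (-q - lo) := by positivity
          linarith
        linarith
      · have := (B0 (-q) lo (by rw [abs_lt]; constructor <;> linarith)
          (by rw [abs_lt]; constructor <;> linarith) h).1
        have : h0 / 2 * (lo - -q) ≤ 0 := by linarith
        have : lo - -q ≤ 0 := by
          by_contra! h'
          have : 0 < h0 / 2 * (lo - -q) := by positivity
          linarith
        linarith
    rw [hloq] at hmed
    have hex : ∀ μ, |μ| ≤ q → ∃ lo hi, |lo - m₀| ≤ K1 * ε ∧ |hi - m₀| ≤ K1 * ε ∧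
        ν.real (Iic (μ + lo)) - ν.real (Iic (μ - lo)) = 1 / 2 - ε / (2 * (1 - ε)) ∧
        ν.real (Iic (μ + hi)) - ν.real (Iic (μ - hi)) = 1 / 2 + ε / (2 * (1 - ε)) ∧
        ∀ t, med (mix (ν.map fun y => |y - μ|) ε t) = max lo (min hi t) := by
      intro μ hμ
      have hμ' := abs_le.1 hμ
      have := isProbabilityMeasure_map_abs (ν := ν) μ
      have := nullSingletonClass_map_abs (ν := ν) μ
      have hsum : K0 * ε + K1 * ε = (K0 + K1) * ε := by ring
      -- Shifting the centre by `μ` moves the distribution function near each of `±m₀` by at most `2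
      -- * hm * |μ|`.
      have hbase : |ν.real (Iic (μ + m₀)) - ν.real (Iic (μ - m₀)) - 1 / 2| ≤ 4 * hm * (K0 * ε) := by
        rcases le_total 0 μ with h | h
        · have b1 := B1 m₀ (μ + m₀) (by simpa using hδ1)
            (by rw [abs_lt]; constructor <;> linarith) (by linarith)
          have b2 := B2 (-m₀) (μ - m₀) (by simpa using hδ2)
            (by rw [abs_lt]; constructor <;> linarith) (by linarith)
          rw [R.cdf_mad] at b1
          rw [R.cdf_neg_mad] at b2
          rw [abs_le]
          have : hm * μ ≤ hm * (K0 * ε) := by gcongr; linarith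
          have : 0 ≤ hm * μ := by positivity
          constructor <;> linarith [b1.1, b1.2, b2.1, b2.2]
        · have b1 := B1 (μ + m₀) m₀ 
            (by rw [abs_lt]; constructor <;> linarith) (by simpa using hδ1) (by linarith)
          have b2 := B2 (μ - m₀) (-m₀) 
            (by rw [abs_lt]; constructor <;> linarith) (by simpa using hδ2) (by linarith)
          rw [R.cdf_mad] at b1
          rw [R.cdf_neg_mad] at b2
          rw [abs_le]
          have : hm * (-μ) ≤ hm * (K0 * ε) := by gcongr; linarith
          have : 0 ≤ hm * (-μ) := mul_nonneg hmp.le (by linarith)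
          constructor <;> linarith [b1.1, b1.2, b2.1, b2.2]
      -- The folded law grows at both ends of its interval, so two slopes `hm / 2` add up to the
      -- slope `hm`.
      obtain ⟨lo, hi, l1, l2, l3, l4, l5⟩ := exists_med_mix_eq (G := ν.map fun y => |y - μ|)
        (m := m₀) (δ := K1 * ε) (k := hm) (ε := ε) (by positivity) hmp
        (fun a b ha hab hb => by
          rw [real_map_abs_Iic _ (by linarith), real_map_abs_Iic _ (by linarith)]
          have b1 := B1 (μ + a) (μ + b) (by rw [abs_lt]; constructor <;> linarith)
            (by rw [abs_lt]; constructor <;> linarith) (by linarith)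
          have b2 := B2 (μ - b) (μ - a) (by rw [abs_lt]; constructor <;> linarith)
            (by rw [abs_lt]; constructor <;> linarith) (by linarith)
          linarith [b1.1, b2.1]) ep (by linarith)
        (by
          rw [real_map_abs_Iic _ mp.le, ← mul_assoc, K1h]
          linarith)
      have l1' := abs_le.1 l1
      have l2' := abs_le.1 l2
      rw [real_map_abs_Iic _ (by linarith)] at l3 l4
      exact ⟨lo, hi, l1, l2, l3, l4, l5⟩
    choose! lo' hi' H using hex
    refine ⟨q, lo', hi', ep, qpos, by linarith, eq, hmed, fun μ hμ => ?_⟩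
    obtain ⟨a1, a2, a3⟩ := H μ hμ
    exact ⟨by linarith, by linarith, a3⟩
  -- The witnesses found separately for each `ε` are turned into functions of `ε`.
  obtain ⟨q, hq⟩ := key.choice
  obtain ⟨lo, hlo⟩ := hq.choice
  obtain ⟨hi, hhi⟩ := hlo.choice
  exact ⟨K0 + K1, by positivity, q, lo, hi, hhi⟩

end ProjDepth

end

/-! ### First-order expansions of the clamping quantiles, and of median and MAD -/

noncomputable section

namespace ProjDepth

theorem tendsto_half_odds : Tendsto (fun ε : ℝ => ε⁻¹ * (ε / (2 * (1 - ε)))) (𝓝[>] 0) (𝓝 (1 / 2)) := by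
  have h : Tendsto (fun ε : ℝ => 1 / (2 * (1 - ε))) (𝓝[>] 0) (𝓝 (1 / 2)) := by
    have : ContinuousAt (fun ε : ℝ => 1 / (2 * (1 - ε))) 0 := by
      apply ContinuousAt.div <;> [fun_prop; fun_prop; norm_num]
    have h2 := this.tendsto
    norm_num at h2
    norm_num
    exact h2.mono_left nhdsWithin_le_nhds
  refine h.congr' ?_
  filter_upwards [self_mem_nhdsWithin] with ε hε
  have : ε ≠ 0 := ne_of_gt hε
  field_simp

theorem tendsto_const_mul_zero (K : ℝ) : Tendsto (fun ε : ℝ => K * ε) (𝓝[>] 0) (𝓝 0) := by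
  have : Tendsto (fun ε : ℝ => K * ε) (𝓝 0) (𝓝 (K * 0)) :=
    (continuous_const.mul continuous_id).tendsto 0
  rw [mul_zero] at this
  exact this.mono_left nhdsWithin_le_nhds

theorem tendsto_of_abs_sub_le {b : ℝ → ℝ} {p K : ℝ}
    (hb : ∀ᶠ ε in 𝓝[>] (0 : ℝ), |b ε - p| ≤ K * ε) : Tendsto b (𝓝[>] 0) (𝓝 p) := by
  rw [tendsto_iff_norm_sub_tendsto_zero]
  exact squeeze_zero' (Eventually.of_forall fun _ => norm_nonneg _) hb (tendsto_const_mul_zero K)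

/-- First order expansion along a curve that stays within `O(ε)` of the base point. -/
theorem HasDerivAt.tendsto_slope_curve {H b : ℝ → ℝ} {k p K : ℝ} (hH : HasDerivAt H k p)
    (hb : ∀ᶠ ε in 𝓝[>] (0 : ℝ), |b ε - p| ≤ K * ε) :
    Tendsto (fun ε => ε⁻¹ * (H (b ε) - H p - k * (b ε - p))) (𝓝[>] 0) (𝓝 0) := by
  have hbt := tendsto_of_abs_sub_le hb
  have h1 := (hasDerivAt_iff_isLittleO.1 hH).comp_tendsto hbt
  have h2 : (fun ε => b ε - p) =O[𝓝[>] (0 : ℝ)] fun ε => ε := by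
    refine Asymptotics.IsBigO.of_bound K ?_
    filter_upwards [hb, self_mem_nhdsWithin] with ε h hε
    rwa [Real.norm_eq_abs, Real.norm_eq_abs, abs_of_pos (show 0 < ε from hε)]
  have h3 := (h1.trans_isBigO h2).tendsto_div_nhds_zero
  refine h3.congr fun ε => ?_
  simp only [Function.comp, smul_eq_mul]
  rw [div_eq_inv_mul]; ring

/-- The quantile level exceeds `1/2` by `ε/2` to first order, and dividing by the slope `h0` gives
`1/(2 h0)`. -/
theorem IsRegular.tendsto_med_bound {ν : Measure ℝ} {h0 hm m₀ : ℝ} (R : IsRegular ν h0 hm m₀)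
    {K : ℝ} {q : ℝ → ℝ} (hq : ∀ᶠ ε in 𝓝[>] (0 : ℝ), |q ε| ≤ K * ε)
    (he : ∀ᶠ ε in 𝓝[>] (0 : ℝ), ν.real (Iic (q ε)) = 1 / 2 + ε / (2 * (1 - ε))) :
    Tendsto (fun ε => ε⁻¹ * q ε) (𝓝[>] 0) (𝓝 (1 / (2 * h0))) := by
  have h := HasDerivAt.tendsto_slope_curve (b := q) (K := K) R.strict_zero.hasDerivAt
    (by simpa using hq)
  have h0p := R.h0_pos
  have h2 := (tendsto_half_odds.sub h).const_mul h0⁻¹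
  have e : h0⁻¹ * (1 / 2 - 0) = 1 / (2 * h0) := by field_simp; norm_num
  rw [e] at h2
  refine h2.congr' ?_
  filter_upwards [he] with ε h
  rw [h, R.cdf_zero]
  field_simp
  ring

/-- The slopes at `m₀` and `-m₀` are equal, so `μ` cancels from the expansion of the mass of `[μ -
b, μ + b]`. What remains is `2 hm (b - m₀) = σ ε / 2` to first order. -/
theorem IsRegular.tendsto_mad_bound {ν : Measure ℝ} {h0 hm m₀ : ℝ} (R : IsRegular ν h0 hm m₀)
    {K σ : ℝ} {μ b : ℝ → ℝ} (hμ : ∀ᶠ ε in 𝓝[>] (0 : ℝ), |μ ε| ≤ K * ε)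
    (hb : ∀ᶠ ε in 𝓝[>] (0 : ℝ), |b ε - m₀| ≤ K * ε)
    (he : ∀ᶠ ε in 𝓝[>] (0 : ℝ), ν.real (Iic (μ ε + b ε)) - ν.real (Iic (μ ε - b ε))
      = 1 / 2 + σ * (ε / (2 * (1 - ε)))) :
    Tendsto (fun ε => ε⁻¹ * (b ε - m₀)) (𝓝[>] 0) (𝓝 (σ / (4 * hm))) := by
  have hp := R.hm_pos
  have h1 := HasDerivAt.tendsto_slope_curve (b := fun ε => μ ε + b ε) (K := K + K)
    R.strict_mad.hasDerivAt (by
      filter_upwards [hμ, hb] with ε h h'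
      have : |μ ε + b ε - m₀| ≤ |μ ε| + |b ε - m₀| := by rw [add_sub_assoc]; exact abs_add_le _ _
      linarith)
  have h2 := HasDerivAt.tendsto_slope_curve (b := fun ε => μ ε - b ε) (K := K + K)
    R.strict_neg_mad.hasDerivAt (by
      filter_upwards [hμ, hb] with ε h h'
      have : |μ ε - b ε - -m₀| ≤ |μ ε| + |b ε - m₀| := by
        rw [show μ ε - b ε - -m₀ = μ ε - (b ε - m₀) by ring]; exact abs_sub _ _
      linarith)
  have h3 := (((tendsto_half_odds.const_mul σ).sub h1).add h2).const_mul (2 * hm)⁻¹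
  have e : (2 * hm)⁻¹ * (σ * (1 / 2) - 0 + 0) = σ / (4 * hm) := by field_simp; ring
  rw [e] at h3
  refine h3.congr' ?_
  filter_upwards [he] with ε h
  rw [R.cdf_mad, R.cdf_neg_mad]
  have : ν.real (Iic (μ ε + b ε)) = ν.real (Iic (μ ε - b ε)) + (1 / 2 + σ * (ε / (2 * (1 - ε)))) := by
    linarith
  rw [this]
  field_simp
  ring

/-- The derivative of the MAD of the contaminated law in the direction of the contamination. -/
def madInfluence (h0 hm m₀ s : ℝ) : ℝ :=
  if |s| = m₀ then max (-1 / (4 * hm)) (min (1 / (4 * hm)) (-(1 / (2 * h0))))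
  else Real.sign (|s| - m₀) / (4 * hm)

theorem madInfluence_neg (h0 hm m₀ s : ℝ) :
    madInfluence h0 hm m₀ (-s) = madInfluence h0 hm m₀ s := by
  simp [madInfluence]

theorem abs_madInfluence_le {h0 hm : ℝ} (hmp : 0 < hm) (m₀ s : ℝ) :
    |madInfluence h0 hm m₀ s| ≤ 1 / (4 * hm) := by
  have hp : 0 < 1 / (4 * hm) := by positivity
  rw [madInfluence]
  split_ifs with h
  · rw [neg_div, abs_le]
    exact ⟨le_max_left _ _, max_le (by linarith) (min_le_left _ _)⟩
  · rcases Real.sign_apply_eq (|s| - m₀) with h | h | h <;> rw [h]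
    · rw [neg_div, abs_neg, abs_of_pos hp]
    · simpa using hmp.le
    · rw [abs_of_pos hp]

theorem measurable_sign : Measurable Real.sign :=
  Measurable.ite measurableSet_Iio measurable_const
    (Measurable.ite measurableSet_Ioi measurable_const measurable_const)

theorem measurable_madInfluence (h0 hm m₀ : ℝ) : Measurable (madInfluence h0 hm m₀) := by
  refine Measurable.ite ?_ measurable_const ?_
  · exact measurableSet_eq_fun measurable_norm measurable_const
  · exact (measurable_sign.comp (measurable_norm.sub_const _)).div_const _

/-- First-order behaviour of median and MAD under contamination: uniform bounds, pointwise
derivatives, local constancy in the contamination, and the bound that keeps contaminations at the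
boundary of the depth region inside it. -/
structure Expansion (M S : ℝ → ℝ → ℝ) (h0 hm m₀ : ℝ) : Prop where
  bound : ∃ K > 0, ∀ᶠ ε in 𝓝[>] (0 : ℝ), ∀ s, |M ε s| ≤ K * ε ∧ |S ε s - m₀| ≤ K * ε
  tendsto_med : ∀ s, Tendsto (fun ε => ε⁻¹ * M ε s) (𝓝[>] 0) (𝓝 (Real.sign s / (2 * h0)))
  tendsto_mad : ∀ s, Tendsto (fun ε => ε⁻¹ * (S ε s - m₀)) (𝓝[>] 0) (𝓝 (madInfluence h0 hm m₀ s))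
  locally_const : ∀ s, s ≠ 0 → |s| ≠ m₀ → ∃ ρ > 0, ∀ᶠ ε in 𝓝[>] (0 : ℝ), ∀ s', |s' - s| < ρ →
    M ε s' = M ε s ∧ S ε s' = S ε s
  boundary : ∀ β > 0, (1 ≤ β ∨ β * h0 < 2 * hm) → ∀ᶠ ε in 𝓝[>] (0 : ℝ), ∀ s, |s| ≤ β * m₀ →
    |s - M ε s| ≤ β * S ε s

/-- Everything is read off the clamp formulas. For fixed `s > 0` the median eventually sits at `q`;
the MAD sits at its lower clamp if `s < m₀` and at its upper clamp if `s > m₀`, which yields the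
derivatives and the local constancy. Negative `s` follows by reflection. -/
theorem IsRegular.expansion {ν : Measure ℝ} {h0 hm m₀ : ℝ} (R : IsRegular ν h0 hm m₀) :
    Expansion (fun ε s => med (mix ν ε s)) (fun ε s => mad (mix ν ε s)) h0 hm m₀ := by
  have h0p := R.h0_pos
  have hmp := R.hm_pos
  have mp := R.m₀_pos
  obtain ⟨K, hK, q, lo, hi, H⟩ := R.exists_clamp
  have hqt : Tendsto (fun ε => ε⁻¹ * q ε) (𝓝[>] 0) (𝓝 (1 / (2 * h0))) :=
    R.tendsto_med_bound (K := K)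
      (H.mono fun ε h => by rw [abs_of_pos h.2.1]; exact h.2.2.1) (H.mono fun ε h => h.2.2.2.1)
  have hlot : ∀ μ : ℝ → ℝ, (∀ᶠ ε in 𝓝[>] (0 : ℝ), |μ ε| ≤ q ε) →
      Tendsto (fun ε => ε⁻¹ * (lo ε (μ ε) - m₀)) (𝓝[>] 0) (𝓝 (-1 / (4 * hm))) := by
    intro μ hμ
    refine R.tendsto_mad_bound (K := K) (μ := μ) ?_ ?_ ?_
    · filter_upwards [H, hμ] with ε h h' using h'.trans h.2.2.1
    · filter_upwards [H, hμ] with ε h h' using (h.2.2.2.2.2 _ h').1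
    · filter_upwards [H, hμ] with ε h h'
      rw [(h.2.2.2.2.2 _ h').2.2.1]; ring
  have hhit : ∀ μ : ℝ → ℝ, (∀ᶠ ε in 𝓝[>] (0 : ℝ), |μ ε| ≤ q ε) →
      Tendsto (fun ε => ε⁻¹ * (hi ε (μ ε) - m₀)) (𝓝[>] 0) (𝓝 (1 / (4 * hm))) := by
    intro μ hμ
    refine R.tendsto_mad_bound (K := K) (μ := μ) ?_ ?_ ?_
    · filter_upwards [H, hμ] with ε h h' using h'.trans h.2.2.1
    · filter_upwards [H, hμ] with ε h h' using (h.2.2.2.2.2 _ h').2.1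
    · filter_upwards [H, hμ] with ε h h'
      rw [(h.2.2.2.2.2 _ h').2.2.2.1]; ring
  have hqq : ∀ᶠ ε in 𝓝[>] (0 : ℝ), |q ε| ≤ q ε := H.mono fun ε h => (abs_of_pos h.2.1).le
  have hq0 : ∀ᶠ ε in 𝓝[>] (0 : ℝ), |(0 : ℝ)| ≤ q ε := H.mono fun ε h => by simpa using h.2.1.le
  have small : ∀ r > 0, ∀ᶠ ε in 𝓝[>] (0 : ℝ), K * ε < r := fun r hr =>
    (tendsto_const_mul_zero K).eventually (gt_mem_nhds hr)
  have hhigt : ∀ᶠ ε in 𝓝[>] (0 : ℝ), m₀ < hi ε (q ε) := by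
    filter_upwards [(hhit q hqq).eventually (lt_mem_nhds (show 0 < 1 / (4 * hm) by positivity)), H]
      with ε h h'
    have := (mul_pos_iff_of_pos_left (inv_pos.2 h'.1)).1 h
    linarith
  have hlolt : ∀ᶠ ε in 𝓝[>] (0 : ℝ), lo ε (q ε) < m₀ := by
    filter_upwards [(hlot q hqq).eventually (gt_mem_nhds (show -1 / (4 * hm) < 0 by
      rw [neg_div]; simpa using hmp)), H] with ε h h'
    have := neg_of_mul_neg_right h (inv_pos.2 h'.1).le
    linarith
  -- formulas for median and MAD at contaminations beyond the clamp
  have Mpos : ∀ᶠ ε in 𝓝[>] (0 : ℝ), ∀ s, q ε ≤ s → med (mix ν ε s) = q ε ∧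
      mad (mix ν ε s) = max (lo ε (q ε)) (min (hi ε (q ε)) (s - q ε)) := by
    filter_upwards [H, hqq] with ε h h' s hs
    have e : med (mix ν ε s) = q ε := by
      rw [h.2.2.2.2.1, min_eq_left hs, max_eq_right (by linarith [h.2.1])]
    refine ⟨e, ?_⟩
    rw [mad_mix_eq, e, (h.2.2.2.2.2 _ h').2.2.2.2, abs_of_nonneg (by linarith)]
  have Mlt : ∀ s, 0 < s → s < m₀ → ∀ᶠ ε in 𝓝[>] (0 : ℝ), ∀ s', s / 2 < s' → s' < (s + m₀) / 2 →
      med (mix ν ε s') = q ε ∧ mad (mix ν ε s') = lo ε (q ε) := by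
    intro s hs hsm
    filter_upwards [Mpos, H, hqq, small (s / 2) (by linarith), small ((m₀ - s) / 2) (by linarith)]
      with ε h h' hq1 e1 e2 s' h1 h2
    have hqK := h'.2.2.1
    have hl := abs_le.1 (h'.2.2.2.2.2 _ hq1).1
    obtain ⟨a, b⟩ := h s' (by linarith)
    refine ⟨a, ?_⟩
    rw [b, max_eq_left]
    exact (min_le_right _ _).trans (by linarith [h'.2.1])
  have Mgt : ∀ s, m₀ < s → ∀ᶠ ε in 𝓝[>] (0 : ℝ), ∀ s', (s + m₀) / 2 < s' →
      med (mix ν ε s') = q ε ∧ mad (mix ν ε s') = hi ε (q ε) := by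
    intro s hsm
    filter_upwards [Mpos, H, hqq, small ((s - m₀) / 4) (by linarith), small (m₀ / 2) (by linarith),
      hhigt, hlolt] with ε h h' hq1 e1 e2 e3 e4 s' h1
    have hqK := h'.2.2.1
    have hl := abs_le.1 (h'.2.2.2.2.2 _ hq1).2.1
    obtain ⟨a, b⟩ := h s' (by linarith)
    refine ⟨a, ?_⟩
    rw [b, min_eq_left (by linarith), max_eq_right (by linarith)]
  refine ⟨?_, ?_, ?_, ?_, ?_⟩
  · refine ⟨K, hK, ?_⟩
    filter_upwards [H] with ε h s
    have hq : |med (mix ν ε s)| ≤ q ε := by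
      rw [h.2.2.2.2.1, abs_le]
      exact ⟨le_max_left _ _, max_le (by linarith [h.2.1]) (min_le_left _ _)⟩
    refine ⟨hq.trans h.2.2.1, ?_⟩
    obtain ⟨a1, a2, -, -, a5⟩ := h.2.2.2.2.2 _ hq
    rw [mad_mix_eq, a5]
    have a1 := abs_le.1 a1
    have a2 := abs_le.1 a2
    rw [abs_le]
    constructor
    · linarith [le_max_left (lo ε (med (mix ν ε s)))
        (min (hi ε (med (mix ν ε s))) |s - med (mix ν ε s)|)]
    · rw [sub_le_iff_le_add]
      exact max_le (by linarith) ((min_le_left _ _).trans (by linarith))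
  · have hpos : ∀ s > 0, Tendsto (fun ε => ε⁻¹ * med (mix ν ε s)) (𝓝[>] 0)
        (𝓝 (Real.sign s / (2 * h0))) := by
      intro s hs
      rw [Real.sign_of_pos hs]
      refine hqt.congr' ?_
      filter_upwards [Mpos, H, small s hs] with ε h h' h''
      rw [(h s (by linarith [h'.2.2.1])).1]
    intro s
    rcases lt_trichotomy s 0 with hs | hs | hs
    · have := (hpos (-s) (by linarith)).neg
      rw [Real.sign_neg, neg_div, neg_neg] at this
      refine this.congr fun ε => ?_
      rw [med_mix_neg R.symm]; ring
    · subst hs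
      have e : ∀ ε, med (mix ν ε 0) = 0 := fun ε => by
        have := med_mix_neg R.symm ε 0
        rw [neg_zero] at this; linarith
      simp [e]
    · exact hpos s hs
  · have hpos : ∀ s > 0, Tendsto (fun ε => ε⁻¹ * (mad (mix ν ε s) - m₀)) (𝓝[>] 0)
        (𝓝 (madInfluence h0 hm m₀ s)) := by
      intro s hs
      rw [madInfluence, abs_of_pos hs]
      split_ifs with hsm
      -- At `s = m₀` the clamped point `m₀ - q` lies within `O(ε)` of `m₀`, like both clamping
      -- values, so all three slopes enter the limit; this is the source of the exceptional value in
      -- `madInfluence`.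
      · have T := (hlot q hqq).max ((hhit q hqq).min hqt.neg)
        refine T.congr' ?_
        filter_upwards [Mpos, H, small s hs] with ε h h' h''
        rw [(h s (by linarith [h'.2.2.1])).2, hsm]
        have hp : 0 ≤ ε⁻¹ := (inv_pos.2 h'.1).le
        rw [← mul_neg, ← mul_min_of_nonneg _ _ hp, ← mul_max_of_nonneg _ _ hp,
          ← max_sub_sub_right, ← min_sub_sub_right, sub_sub_cancel_left]
      · rcases lt_or_gt_of_ne hsm with h | h
        · rw [Real.sign_of_neg (by linarith)]
          refine (hlot q hqq).congr' ?_
          filter_upwards [Mlt s hs h] with ε h'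
          rw [(h' s (by linarith) (by linarith)).2]
        · rw [Real.sign_of_pos (by linarith)]
          refine (hhit q hqq).congr' ?_
          filter_upwards [Mgt s h] with ε h'
          rw [(h' s (by linarith)).2]
    intro s
    rcases lt_trichotomy s 0 with hs | hs | hs
    · have := hpos (-s) (by linarith)
      rw [madInfluence_neg] at this
      simpa only [mad_mix_neg R.symm] using this
    · subst hs
      have e : ∀ ε, med (mix ν ε 0) = 0 := fun ε => by
        have := med_mix_neg R.symm ε 0
        rw [neg_zero] at this; linarith
      rw [madInfluence, abs_zero, if_neg mp.ne, zero_sub, Real.sign_of_neg (by linarith)]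
      refine (hlot (fun _ => 0) hq0).congr' ?_
      filter_upwards [H, hq0, small m₀ mp] with ε h h' hsm
      obtain ⟨a1, a2, -, -, a5⟩ := h.2.2.2.2.2 _ h'
      rw [mad_mix_eq, e, a5]
      have a1 := abs_le.1 a1
      rw [sub_zero, abs_zero, max_eq_left]
      exact (min_le_right _ _).trans (by linarith)
    · exact hpos s hs
  · have hpos : ∀ s > 0, s ≠ m₀ → ∃ ρ > 0, ∀ᶠ ε in 𝓝[>] (0 : ℝ), ∀ s', |s' - s| < ρ →
        med (mix ν ε s') = med (mix ν ε s) ∧ mad (mix ν ε s') = mad (mix ν ε s) := by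
      intro s hs hsm
      rcases lt_or_gt_of_ne hsm with h | h
      · refine ⟨min (s / 2) ((m₀ - s) / 2), lt_min (by linarith) (by linarith), ?_⟩
        filter_upwards [Mlt s hs h] with ε h' s' hs'
        have h1 := abs_lt.1 (hs'.trans_le (min_le_left _ _))
        have h2 := abs_lt.1 (hs'.trans_le (min_le_right _ _))
        obtain ⟨a, b⟩ := h' s (by linarith) (by linarith)
        obtain ⟨a', b'⟩ := h' s' (by linarith) (by linarith)
        rw [a, b, a', b']; exact ⟨rfl, rfl⟩
      · refine ⟨(s - m₀) / 2, by linarith, ?_⟩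
        filter_upwards [Mgt s h] with ε h' s' hs'
        have h1 := abs_lt.1 hs'
        obtain ⟨a, b⟩ := h' s (by linarith)
        obtain ⟨a', b'⟩ := h' s' (by linarith)
        rw [a, b, a', b']; exact ⟨rfl, rfl⟩
    intro s hs hsm
    rcases lt_or_gt_of_ne hs with h | h
    · obtain ⟨ρ, hρ, h'⟩ := hpos (-s) (by linarith) (by rwa [← abs_of_neg h])
      refine ⟨ρ, hρ, ?_⟩
      filter_upwards [h'] with ε h' s' hs'
      have := h' (-s') (by rw [neg_sub_neg, abs_sub_comm]; exact hs')
      rw [med_mix_neg R.symm, med_mix_neg R.symm, mad_mix_neg R.symm, mad_mix_neg R.symm,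
        neg_inj] at this
      exact this
    · exact hpos s h (by rwa [abs_of_pos h] at hsm)
  · intro β hβ hcond
    -- To first order the median gains `ε/(2 h0)` while `β` times the MAD loses at most `β ε/(4
    -- hm)`; the condition `β h0 < 2 hm` says that the gain is larger.
    have main : ∀ᶠ ε in 𝓝[>] (0 : ℝ), β * m₀ - q ε ≤ β * lo ε (q ε) ∨ 1 ≤ β := by
      rcases hcond with h | h
      · exact Eventually.of_forall fun _ => Or.inr h
      · have T := ((hlot q hqq).const_mul β).add hqt
        have hp : 0 < β * (-1 / (4 * hm)) + 1 / (2 * h0) := by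
          have : β * (-1 / (4 * hm)) + 1 / (2 * h0) = (2 * hm - β * h0) / (4 * hm * h0) := by
            field_simp; ring
          rw [this]
          apply div_pos (by linarith) (by positivity)
        filter_upwards [T.eventually (lt_mem_nhds hp), H] with ε h h'
        left
        have e : β * (ε⁻¹ * (lo ε (q ε) - m₀)) + ε⁻¹ * q ε
          = ε⁻¹ * (β * (lo ε (q ε) - m₀) + q ε) := by ring
        rw [e] at h
        have := (mul_pos_iff_of_pos_left (inv_pos.2 h'.1)).1 h
        linarith
    have hpos : ∀ᶠ ε in 𝓝[>] (0 : ℝ), ∀ s, 0 ≤ s → s ≤ β * m₀ →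
        |s - med (mix ν ε s)| ≤ β * mad (mix ν ε s) := by
      filter_upwards [main, H, Mpos, hqq, hhigt, small m₀ mp] with ε hmain h hM hq1 hh hsm s hs hsc
      have hl := abs_le.1 (h.2.2.2.2.2 _ hq1).1
      rcases le_total (q ε) s with hqs | hqs
      · obtain ⟨a, b⟩ := hM s hqs
        rw [a, b, abs_of_nonneg (by linarith)]
        rcases hmain with h1 | h1
        · calc s - q ε ≤ β * lo ε (q ε) := by linarith
            _ ≤ _ := by gcongr; exact le_max_left _ _
        -- For `β ≥ 1`, either the MAD is at its upper clamp, which exceeds `m₀`, or it is at least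
        -- the deviation `s - q` itself.
        · rcases le_total (hi ε (q ε)) (s - q ε) with h2 | h2
          · rw [min_eq_left h2]
            calc s - q ε ≤ β * m₀ := by linarith [h.2.1]
              _ ≤ β * hi ε (q ε) := by gcongr
              _ ≤ _ := by gcongr; exact le_max_right _ _
          · rw [min_eq_right h2]
            calc s - q ε ≤ 1 * (s - q ε) := by linarith
              _ ≤ β * (s - q ε) := mul_le_mul_of_nonneg_right h1 (by linarith)
              _ ≤ _ := by gcongr; exact le_max_right _ _
      -- Below the clamp the contamination is itself the median, so its deviation is `0`.
      · have e : med (mix ν ε s) = s := by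
          rw [h.2.2.2.2.1, min_eq_right hqs, max_eq_right (by linarith [h.2.1])]
        have hl' := abs_le.1 (h.2.2.2.2.2 s (by rwa [abs_of_nonneg hs])).1
        rw [mad_mix_eq, e, sub_self, abs_zero, (h.2.2.2.2.2 s (by rwa [abs_of_nonneg hs])).2.2.2.2]
        exact mul_nonneg hβ.le (le_trans (by linarith) (le_max_left _ _))
    filter_upwards [hpos] with ε h s hs
    rcases le_total 0 s with h0 | h0
    · exact h s h0 (by rwa [abs_of_nonneg h0] at hs)
    · have := h (-s) (by linarith) (by rwa [abs_of_nonpos h0] at hs)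
      rw [med_mix_neg R.symm, mad_mix_neg R.symm, neg_sub_neg, abs_sub_comm] at this
      exact this

end ProjDepth

end

/-! ### From densities to regular laws -/

noncomputable section

namespace ProjDepth

/-- The fundamental theorem of calculus at a continuity point of the integrand already yields strict
differentiability, which is needed because increments are taken between two moving points. -/
theorem hasStrictDerivAt_cdf {ν : Measure ℝ} [IsProbabilityMeasure ν] {h : ℝ → ℝ}
    (hh_meas : Measurable h) (hh_nonneg : ∀ z, 0 ≤ h z)
    (hνh : ν = volume.withDensity fun z => ENNReal.ofReal (h z)) {p : ℝ} (hp : ContinuousAt h p) :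
    HasStrictDerivAt (fun t => ν.real (Iic t)) (h p) p := by
  have hint : Integrable h := by
    refine ⟨hh_meas.aestronglyMeasurable, ?_⟩
    rw [hasFiniteIntegral_iff_ofReal (Eventually.of_forall hh_nonneg)]
    have : ν univ = 1 := measure_univ
    rw [hνh, withDensity_apply _ MeasurableSet.univ, Measure.restrict_univ] at this
    rw [this]; exact ENNReal.one_lt_top
  have hreal : ∀ t, ν.real (Iic t) = ∫ z in Iic t, h z := fun t => by
    rw [Measure.real, hνh, withDensity_apply _ measurableSet_Iic,
      integral_eq_lintegral_of_nonneg_ae (Eventually.of_forall hh_nonneg)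
        hh_meas.aestronglyMeasurable]
  have e : (fun t => ν.real (Iic t)) = fun t => (∫ z in (0)..t, h z) + ∫ z in Iic (0 : ℝ), h z := by
    ext t
    rw [hreal, ← intervalIntegral.integral_Iic_sub_Iic hint.integrableOn hint.integrableOn]
    ring
  rw [e]
  exact (intervalIntegral.integral_hasStrictDerivAt_right hint.intervalIntegrable
    (hh_meas.stronglyMeasurable.stronglyMeasurableAtFilter) hp).add_const _

/-- The folded law has no atoms and puts mass `1/2` on `Iic m₀`. Hence `m₀ > 0`, as otherwise this
mass would sit on `{0}`, and symmetry puts the distribution function at `3/4` in `m₀`. -/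
theorem isRegular_of_density {ν : Measure ℝ} [IsProbabilityMeasure ν]
    (hs : ν.map (fun z => -z) = ν) {h : ℝ → ℝ}
    (hh_meas : Measurable h) (hh_nonneg : ∀ z, 0 ≤ h z)
    (hνh : ν = volume.withDensity fun z => ENNReal.ofReal (h z))
    {m₀ : ℝ} (hm₀ : m₀ = mad ν)
    (h_zero : ContinuousAt h 0 ∧ 0 < h 0) (h_m₀ : ContinuousAt h m₀ ∧ 0 < h m₀) :
    IsRegular ν (h 0) (h m₀) m₀ := by
  have hna : NullSingletonClass ν := by rw [hνh]; infer_instance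
  have e : m₀ = med (ν.map fun y => |y - 0|) := by rw [hm₀, mad, med_eq_zero_of_symm hs]
  have := isProbabilityMeasure_map_abs (ν := ν) 0
  have := nullSingletonClass_map_abs (ν := ν) 0
  have hhalf := real_Iic_med (ν.map fun y => |y - 0|)
  rw [← e] at hhalf
  have mpos : 0 < m₀ := by
    by_contra! hle
    rw [map_measureReal_apply (by fun_prop) measurableSet_Iic] at hhalf
    have : ν.real ((fun y => |y - 0|) ⁻¹' Iic m₀) = 0 := by
      refine measureReal_mono_null (s₂ := {0}) (fun y hy => ?_) (by simp [Measure.real])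
      simp only [sub_zero, mem_preimage, mem_Iic] at hy
      exact abs_nonpos_iff.1 (hy.trans hle)
    linarith
  refine ⟨inferInstance, hna, hs, h_zero.2, h_m₀.2, mpos,
    hasStrictDerivAt_cdf hh_meas hh_nonneg hνh h_zero.1,
    hasStrictDerivAt_cdf hh_meas hh_nonneg hνh h_m₀.1, ?_⟩
  rw [real_map_abs_Iic _ mpos.le, zero_add, zero_sub, real_Iic_neg hs] at hhalf
  linarith

end ProjDepth

end

noncomputable section

namespace ProjDepth

/-! ### Depth regions of nearly spherical profiles -/

/-- Location and scale of the projections of `F` differ by at most `e` from `0` and `m₀`, and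
transform as location and scale under reflection of the direction. -/
structure NearlySpherical {d : ℕ} (μ σ : Measure ℝ → ℝ) (F : Measure (EuclideanSpace ℝ (Fin d)))
    (m₀ e : ℝ) : Prop where
  loc_neg : ∀ v, ‖v‖ = 1 → μ (proj F (-v)) = -μ (proj F v)
  scale_neg : ∀ v, ‖v‖ = 1 → σ (proj F (-v)) = σ (proj F v)
  loc_le : ∀ v, ‖v‖ = 1 → |μ (proj F v)| ≤ e
  scale_le : ∀ v, ‖v‖ = 1 → |σ (proj F v) - m₀| ≤ e
  nonneg : 0 ≤ e
  small : 2 * e ≤ m₀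
  pos : 0 < m₀

/-- The location and scale of projections do not vary with the direction near `u`. -/
def ConstNear {d : ℕ} (μ σ : Measure ℝ → ℝ) (F : Measure (EuclideanSpace ℝ (Fin d)))
    (u : EuclideanSpace ℝ (Fin d)) (ρ : ℝ) : Prop :=
  ∀ v, ‖v‖ = 1 → ‖v - u‖ < ρ → μ (proj F v) = μ (proj F u) ∧ σ (proj F v) = σ (proj F u)

variable {d : ℕ} {μ σ : Measure ℝ → ℝ} {F : Measure (EuclideanSpace ℝ (Fin d))} {m₀ e : ℝ}

theorem NearlySpherical.scale_pos (N : NearlySpherical μ σ F m₀ e) {v : EuclideanSpace ℝ (Fin d)}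
    (hv : ‖v‖ = 1) : m₀ - e ≤ σ (proj F v) ∧ σ (proj F v) ≤ m₀ + e ∧ 0 < σ (proj F v) := by
  have := abs_le.1 (N.scale_le v hv)
  have := N.small
  have := N.pos
  have := N.nonneg
  refine ⟨by linarith, by linarith, by linarith⟩

/-- Scales are positive, so no division in the supremum degenerates and a bound on it becomes a
family of real inequalities, the form used for all regions below. -/
theorem NearlySpherical.outlyingness_le_iff (N : NearlySpherical μ σ F m₀ e)
    (y : EuclideanSpace ℝ (Fin d)) {r : ℝ} (hr : 0 ≤ r) :
    outlyingness μ σ F y ≤ ENNReal.ofReal r ↔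
      ∀ v, ‖v‖ = 1 → |inner ℝ v y - μ (proj F v)| ≤ r * σ (proj F v) := by
  rw [outlyingness, iSup_le_iff]
  have key : ∀ v, ‖v‖ = 1 → (ENNReal.ofReal |inner ℝ v y - μ (proj F v)|
      / ENNReal.ofReal (σ (proj F v)) ≤ ENNReal.ofReal r ↔
      |inner ℝ v y - μ (proj F v)| ≤ r * σ (proj F v)) := by
    intro v hv
    have hs := (N.scale_pos hv).2.2
    rw [ENNReal.div_le_iff_le_mul (Or.inl (by simpa using hs)) (Or.inl ENNReal.ofReal_ne_top),
      ← ENNReal.ofReal_mul hr, ENNReal.ofReal_le_ofReal_iff (by positivity)]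
  constructor
  · intro h v hv
    exact (key v hv).1 (h ⟨v, by simpa using hv⟩)
  · rintro h ⟨v, hv⟩
    have hv : ‖v‖ = 1 := by simpa using hv
    exact (key v hv).2 (h v hv)

theorem abs_inner_le_norm_of_unit {v : EuclideanSpace ℝ (Fin d)} (hv : ‖v‖ = 1)
    (y : EuclideanSpace ℝ (Fin d)) : |inner ℝ v y| ≤ ‖y‖ := by
  have := abs_real_inner_le_norm v y
  rwa [hv, one_mul] at this

theorem NearlySpherical.abs_le (N : NearlySpherical μ σ F m₀ e) (y : EuclideanSpace ℝ (Fin d))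
    {v : EuclideanSpace ℝ (Fin d)} (hv : ‖v‖ = 1) :
    |inner ℝ v y - μ (proj F v)| ≤ ‖y‖ + e := by
  calc _ ≤ |inner ℝ v y| + |μ (proj F v)| := abs_sub _ _
    _ ≤ _ := add_le_add (abs_inner_le_norm_of_unit hv y) (N.loc_le v hv)

theorem NearlySpherical.bound_of_le (N : NearlySpherical μ σ F m₀ e)
    (y : EuclideanSpace ℝ (Fin d)) {r : ℝ} (hr : 0 ≤ r) (h : ‖y‖ + e ≤ r * (m₀ - e))
    (v : EuclideanSpace ℝ (Fin d)) (hv : ‖v‖ = 1) :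
    |inner ℝ v y - μ (proj F v)| ≤ r * σ (proj F v) :=
  (N.abs_le y hv).trans (h.trans (mul_le_mul_of_nonneg_left (N.scale_pos hv).1 hr))

theorem NearlySpherical.outlyingness_ne_top (N : NearlySpherical μ σ F m₀ e)
    (y : EuclideanSpace ℝ (Fin d)) : outlyingness μ σ F y ≠ ⊤ := by
  have hp : 0 < m₀ - e := by linarith [N.small, N.pos, N.nonneg]
  have hn := N.nonneg
  have : outlyingness μ σ F y ≤ ENNReal.ofReal ((‖y‖ + e) / (m₀ - e)) := by
    rw [N.outlyingness_le_iff y (by positivity)]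
    exact N.bound_of_le y (by positivity) (by field_simp; exact le_rfl)
  exact ne_top_of_le_ne_top ENNReal.ofReal_ne_top this

theorem NearlySpherical.toReal_le_iff (N : NearlySpherical μ σ F m₀ e)
    (y : EuclideanSpace ℝ (Fin d)) {r : ℝ} (hr : 0 ≤ r) :
    (outlyingness μ σ F y).toReal ≤ r ↔
      ∀ v, ‖v‖ = 1 → |inner ℝ v y - μ (proj F v)| ≤ r * σ (proj F v) := by
  rw [← N.outlyingness_le_iff y hr, ENNReal.le_ofReal_iff_toReal_le (N.outlyingness_ne_top y) hr]

theorem NearlySpherical.depth_eq (N : NearlySpherical μ σ F m₀ e)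
    (y : EuclideanSpace ℝ (Fin d)) :
    depth μ σ F y = 1 / (1 + (outlyingness μ σ F y).toReal) := by
  rw [depth, ENNReal.toReal_inv, ENNReal.toReal_add ENNReal.one_ne_top (N.outlyingness_ne_top y),
    ENNReal.toReal_one, one_div]

theorem NearlySpherical.mem_region_iff (N : NearlySpherical μ σ F m₀ e) {α : ℝ} (hα : 0 < α)
    (hα1 : α < 1) (y : EuclideanSpace ℝ (Fin d)) :
    y ∈ region μ σ α F ↔
      ∀ v, ‖v‖ = 1 → |inner ℝ v y - μ (proj F v)| ≤ (1 - α) / α * σ (proj F v) := by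
  have hβ : 0 ≤ (1 - α) / α := div_nonneg (by linarith) hα.le
  rw [← N.toReal_le_iff y hβ, region, mem_ofPred_eq, N.depth_eq]
  have : 0 ≤ (outlyingness μ σ F y).toReal := ENNReal.toReal_nonneg
  rw [le_div_iff₀ (by positivity), le_div_iff₀ hα]
  constructor <;> intro h <;> linarith

theorem exists_unit_inner_eq_norm (hd : 0 < d) (y : EuclideanSpace ℝ (Fin d)) :
    ∃ v : EuclideanSpace ℝ (Fin d), ‖v‖ = 1 ∧ inner ℝ v y = ‖y‖ := by
  by_cases hy : y = 0
  · refine ⟨EuclideanSpace.single ⟨0, hd⟩ 1, by simp, by simp [hy]⟩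
  · have : ‖y‖ ≠ 0 := norm_ne_zero_iff.2 hy
    refine ⟨‖y‖⁻¹ • y, by simp [norm_smul, this], ?_⟩
    rw [real_inner_smul_left, real_inner_self_eq_norm_sq]
    field_simp

theorem NearlySpherical.norm_le_of_bound (N : NearlySpherical μ σ F m₀ e) (hd : 0 < d)
    (y : EuclideanSpace ℝ (Fin d)) {r : ℝ} (hr : 0 ≤ r)
    (h : ∀ v, ‖v‖ = 1 → |inner ℝ v y - μ (proj F v)| ≤ r * σ (proj F v)) :
    ‖y‖ ≤ r * (m₀ + e) + e := by
  obtain ⟨v, hv, hvy⟩ := exists_unit_inner_eq_norm hd y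
  have h1 := (_root_.abs_le.1 (h v hv)).2
  have h2 := (_root_.abs_le.1 (N.loc_le v hv)).2
  have h3 := mul_le_mul_of_nonneg_left (N.scale_pos hv).2.1 hr
  rw [hvy] at h1
  linarith

/-- The lower bound tests the direction of `y`; the upper bound holds for every direction by
Cauchy–Schwarz. The condition `2 * e ≤ m₀` absorbs the change in the denominator into the factor
`2`. -/
theorem NearlySpherical.abs_outlyingness_sub_le (N : NearlySpherical μ σ F m₀ e) (hd : 0 < d)
    (y : EuclideanSpace ℝ (Fin d)) :
    |(outlyingness μ σ F y).toReal - ‖y‖ / m₀| ≤ 2 * e * (m₀ + ‖y‖) / m₀ ^ 2 := by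
  have hn := N.nonneg
  have hp := N.pos
  have hs := N.small
  have hy := norm_nonneg y
  have hO : 0 ≤ (outlyingness μ σ F y).toReal := ENNReal.toReal_nonneg
  rw [_root_.abs_le]
  constructor
  · have h := N.norm_le_of_bound hd y hO ((N.toReal_le_iff y hO).1 le_rfl)
    have h1 : (‖y‖ - e) / (m₀ + e) ≤ (outlyingness μ σ F y).toReal := by
      rw [div_le_iff₀ (by positivity)]; linarith
    have h2 : ‖y‖ / m₀ - (‖y‖ - e) / (m₀ + e) ≤ 2 * e * (m₀ + ‖y‖) / m₀ ^ 2 := by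
      have : ‖y‖ / m₀ - (‖y‖ - e) / (m₀ + e) = e * (m₀ + ‖y‖) / (m₀ * (m₀ + e)) := by
        field_simp; ring
      rw [this]
      gcongr
      · linarith
      · nlinarith
    linarith
  · rw [sub_le_iff_le_add', N.toReal_le_iff y (by positivity)]
    refine N.bound_of_le y (by positivity) ?_
    have : (‖y‖ / m₀ + 2 * e * (m₀ + ‖y‖) / m₀ ^ 2) * (m₀ - e) - (‖y‖ + e)
      = e * (m₀ + ‖y‖) * (m₀ - 2 * e) / m₀ ^ 2 := by
      field_simp; ring
    have : 0 ≤ e * (m₀ + ‖y‖) * (m₀ - 2 * e) / m₀ ^ 2 := by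
      apply div_nonneg _ (by positivity)
      apply mul_nonneg (by positivity)
      linarith
    linarith

theorem abs_inner_le_of_far {u v : EuclideanSpace ℝ (Fin d)} (hu : ‖u‖ = 1) (hv : ‖v‖ = 1)
    {ρ : ℝ} (hρ : 0 < ρ) (h1 : ρ ≤ ‖v - u‖) (h2 : ρ ≤ ‖v + u‖) :
    |inner ℝ v u| ≤ 1 - ρ ^ 2 / 2 := by
  have e1 := norm_sub_sq_real v u
  have e2 := norm_add_sq_real v u
  rw [hu, hv] at e1 e2
  have a1 : ρ ^ 2 ≤ ‖v - u‖ ^ 2 := by gcongr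
  have a2 : ρ ^ 2 ≤ ‖v + u‖ ^ 2 := by gcongr
  rw [_root_.abs_le]
  constructor <;> linarith

theorem inner_nonneg_of_near {u v : EuclideanSpace ℝ (Fin d)} (hu : ‖u‖ = 1) (hv : ‖v‖ = 1)
    (h : ‖v - u‖ < 1) : 0 ≤ inner ℝ v u := by
  have e1 := norm_sub_sq_real v u
  rw [hu, hv] at e1
  have a1 : ‖v - u‖ ^ 2 ≤ 1 := by
    have := norm_nonneg (v - u)
    nlinarith
  linarith

/-- It suffices to control directions near `±u`, where the profile is that of `u` up to reflection,
and the rest, where `|v'u| ≤ 1 - ρ²/2` leaves room for the error `e`. `T` and `R` are kept general: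
the region uses `T = β` with `R` its radius, the outlyingness uses `T = (r - M)/S` with `R = r`, for
`M` and `S` the location and scale along `u`. -/
theorem NearlySpherical.ray_bound (N : NearlySpherical μ σ F m₀ e)
    {u : EuclideanSpace ℝ (Fin d)} (hu : ‖u‖ = 1) {ρ : ℝ} (hρ : 0 < ρ) (hρ1 : ρ ≤ 1)
    (hc : ConstNear μ σ F u ρ) {R T r : ℝ} (hT : 0 ≤ T) (h1 : R - μ (proj F u) ≤ T * σ (proj F u))
    (h2 : e ≤ T * σ (proj F u)) (h3 : R * (1 - ρ ^ 2 / 2) + e ≤ T * (m₀ - e))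
    (hr : 0 ≤ r) (hrR : r ≤ R) (v : EuclideanSpace ℝ (Fin d)) (hv : ‖v‖ = 1) :
    |inner ℝ v (r • u) - μ (proj F v)| ≤ T * σ (proj F v) := by
  have near : ∀ v : EuclideanSpace ℝ (Fin d), ‖v‖ = 1 → ‖v - u‖ < ρ →
      |inner ℝ v (r • u) - μ (proj F v)| ≤ T * σ (proj F v) := by
    intro v hv hvu
    obtain ⟨e1, e2⟩ := hc v hv hvu
    have hin := inner_nonneg_of_near hu hv (hvu.trans_le hρ1)
    have hle := (_root_.abs_le.1 (abs_inner_le_norm_of_unit hv u)).2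
    rw [hu] at hle
    have hm := _root_.abs_le.1 (N.loc_le u hu)
    rw [e1, e2, real_inner_smul_right, _root_.abs_le]
    have : r * inner ℝ v u ≤ R := by nlinarith
    have : 0 ≤ r * inner ℝ v u := by positivity
    constructor <;> linarith
  rcases lt_or_ge ‖v - u‖ ρ with h | h
  · exact near v hv h
  rcases lt_or_ge ‖v + u‖ ρ with h' | h'
  · have := near (-v) (by rwa [norm_neg]) (by rwa [← neg_add', norm_neg])
    rw [N.loc_neg v hv, N.scale_neg v hv, inner_neg_left, neg_sub_neg, abs_sub_comm] at this
    exact this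
  · have hf := abs_inner_le_of_far hu hv hρ h h'
    calc _ ≤ |inner ℝ v (r • u)| + |μ (proj F v)| := abs_sub _ _
      _ ≤ r * (1 - ρ ^ 2 / 2) + e := by
        rw [real_inner_smul_right, abs_mul, abs_of_nonneg hr]
        exact add_le_add (mul_le_mul_of_nonneg_left hf hr) (N.loc_le v hv)
      _ ≤ R * (1 - ρ ^ 2 / 2) + e := by
        have : 0 ≤ 1 - ρ ^ 2 / 2 := by nlinarith
        gcongr
      _ ≤ T * (m₀ - e) := h3
      _ ≤ _ := mul_le_mul_of_nonneg_left (N.scale_pos hv).1 hT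

theorem inner_unit_smul {u : EuclideanSpace ℝ (Fin d)} (hu : ‖u‖ = 1) (r : ℝ) :
    inner ℝ u (r • u) = r := by
  rw [real_inner_smul_right, real_inner_self_eq_norm_sq, hu]; ring

/-- On a ray along which the profile is locally constant, the depth region is explicit. -/
theorem NearlySpherical.smul_mem_region_iff (N : NearlySpherical μ σ F m₀ e)
    {u : EuclideanSpace ℝ (Fin d)} (hu : ‖u‖ = 1) {ρ : ℝ} (hρ : 0 < ρ) (hρ1 : ρ ≤ 1)
    (hc : ConstNear μ σ F u ρ) {α β : ℝ} (hα : 0 < α) (hα1 : α < 1) (hβ : β = (1 - α) / α)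
    (h2 : e ≤ β * (m₀ - e))
    (h3 : (β * (m₀ + e) + e) * (1 - ρ ^ 2 / 2) + e ≤ β * (m₀ - e)) {r : ℝ} (hr : 0 ≤ r) :
    r • u ∈ region μ σ α F ↔ r ≤ β * σ (proj F u) + μ (proj F u) := by
  have hβ0 : 0 ≤ β := by rw [hβ]; exact div_nonneg (by linarith) hα.le
  rw [N.mem_region_iff hα hα1, ← hβ]
  constructor
  · intro h
    have := (_root_.abs_le.1 (h u hu)).2
    rw [inner_unit_smul hu] at this
    linarith
  · intro h
    have hs := N.scale_pos hu
    have hm := _root_.abs_le.1 (N.loc_le u hu)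
    refine N.ray_bound hu hρ hρ1 hc (R := β * σ (proj F u) + μ (proj F u)) hβ0 (by linarith)
      (h2.trans (mul_le_mul_of_nonneg_left hs.1 hβ0)) (le_trans ?_ h3) hr h
    have : 0 ≤ 1 - ρ ^ 2 / 2 := by nlinarith
    gcongr
    · exact hs.2.1
    · exact hm.2

/-- On a ray along which the profile is locally constant, the outlyingness is explicit. -/
theorem NearlySpherical.outlyingness_smul (N : NearlySpherical μ σ F m₀ e)
    {u : EuclideanSpace ℝ (Fin d)} (hu : ‖u‖ = 1) {ρ : ℝ} (hρ : 0 < ρ) (hρ1 : ρ ≤ 1)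
    (hc : ConstNear μ σ F u ρ) {r : ℝ} (h2 : 2 * e ≤ r)
    (h3 : r * (1 - ρ ^ 2 / 2) + e ≤ (r - e) / (m₀ + e) * (m₀ - e)) :
    (outlyingness μ σ F (r • u)).toReal = (r - μ (proj F u)) / σ (proj F u) := by
  have hs := N.scale_pos hu
  have hm := _root_.abs_le.1 (N.loc_le u hu)
  have hn := N.nonneg
  have hp := N.pos
  have hsm := N.small
  have hO : 0 ≤ (outlyingness μ σ F (r • u)).toReal := ENNReal.toReal_nonneg
  have hT : 0 ≤ (r - μ (proj F u)) / σ (proj F u) := div_nonneg (by linarith) hs.2.2.le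
  have hTs : (r - μ (proj F u)) / σ (proj F u) * σ (proj F u) = r - μ (proj F u) :=
    div_mul_cancel₀ _ hs.2.2.ne'
  apply le_antisymm
  · rw [N.toReal_le_iff _ hT]
    refine N.ray_bound hu hρ hρ1 hc (R := r) hT hTs.ge (by rw [hTs]; linarith) (h3.trans ?_)
      (by linarith) le_rfl
    gcongr
    · linarith
    · linarith
    · exact hs.2.2
    · exact hm.2
    · exact hs.2.1
  · have := (N.toReal_le_iff _ hO).1 le_rfl u hu
    rw [inner_unit_smul hu] at this
    rw [div_le_iff₀ hs.2.2]
    exact (le_abs_self _).trans this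

theorem NearlySpherical.mem_region_of_norm_le (N : NearlySpherical μ σ F m₀ e) {α β : ℝ}
    (hα : 0 < α) (hα1 : α < 1) (hβ : β = (1 - α) / α) {y : EuclideanSpace ℝ (Fin d)}
    (hy : ‖y‖ ≤ β * m₀ - (β + 1) * e) : y ∈ region μ σ α F := by
  have hβ0 : 0 ≤ β := by rw [hβ]; exact div_nonneg (by linarith) hα.le
  rw [N.mem_region_iff hα hα1, ← hβ]
  exact N.bound_of_le y hβ0 (by linarith)

theorem NearlySpherical.norm_le_of_mem_region (N : NearlySpherical μ σ F m₀ e) (hd : 0 < d)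
    {α β : ℝ} (hα : 0 < α) (hα1 : α < 1) (hβ : β = (1 - α) / α) {y : EuclideanSpace ℝ (Fin d)}
    (hy : y ∈ region μ σ α F) : ‖y‖ ≤ β * m₀ + (β + 1) * e := by
  have hβ0 : 0 ≤ β := by rw [hβ]; exact div_nonneg (by linarith) hα.le
  rw [N.mem_region_iff hα hα1, ← hβ] at hy
  have := N.norm_le_of_bound hd y hβ0 hy
  linarith

end ProjDepth

end

noncomputable section

namespace ProjDepth

variable {d : ℕ} {F : Measure (EuclideanSpace ℝ (Fin d))} {ν : Measure ℝ}
  {h0 hm m₀ : ℝ}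

/-! ### Depth regions of contaminated spherical distributions -/

theorem proj_contaminate (hF : IsSphericallySymmetric F ν) (ε : ℝ)
    (x : EuclideanSpace ℝ (Fin d)) {v : EuclideanSpace ℝ (Fin d)} (hv : ‖v‖ = 1) :
    proj (contaminate F ε x) v = mix ν ε (inner ℝ v x) := by
  have hmeas : Measurable fun y : EuclideanSpace ℝ (Fin d) => (inner ℝ v y : ℝ) := by fun_prop
  rw [proj, contaminate, Measure.map_add _ _ hmeas, Measure.map_smul, Measure.map_smul,
    Measure.map_dirac' hmeas, mix, ← hF.2 v hv, proj]

theorem nearlySpherical_self (hF : IsSphericallySymmetric F ν) (hmad : m₀ = mad ν)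
    (hm₀ : 0 < m₀) : NearlySpherical med mad F m₀ 0 := by
  refine ⟨fun v hv => ?_, fun v hv => ?_, fun v hv => ?_, fun v hv => ?_, le_rfl, by simpa using hm₀.le, hm₀⟩
  · rw [hF.2 v hv, hF.2 (-v) (by rwa [norm_neg]), med_eq_zero_of_symm hF.1, neg_zero]
  · rw [hF.2 v hv, hF.2 (-v) (by rwa [norm_neg])]
  · rw [hF.2 v hv, med_eq_zero_of_symm hF.1, abs_zero]
  · rw [hF.2 v hv, ← hmad, sub_self, abs_zero]

theorem outlyingness_self (hd : 0 < d) (hF : IsSphericallySymmetric F ν) (hmad : m₀ = mad ν)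
    (hm₀ : 0 < m₀) (y : EuclideanSpace ℝ (Fin d)) :
    (outlyingness med mad F y).toReal = ‖y‖ / m₀ := by
  have := (nearlySpherical_self hF hmad hm₀).abs_outlyingness_sub_le hd y
  simp only [mul_zero, zero_mul, zero_div] at this
  linarith [abs_nonpos_iff.1 this]

theorem depth_self (hd : 0 < d) (hF : IsSphericallySymmetric F ν) (hmad : m₀ = mad ν)
    (hm₀ : 0 < m₀) (y : EuclideanSpace ℝ (Fin d)) :
    depth med mad F y = 1 / (1 + ‖y‖ / m₀) := by
  rw [(nearlySpherical_self hF hmad hm₀).depth_eq, outlyingness_self hd hF hmad hm₀]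

theorem region_self (hd : 0 < d) (hF : IsSphericallySymmetric F ν) (hmad : m₀ = mad ν)
    (hm₀ : 0 < m₀) {α β : ℝ} (hα : 0 < α) (hα1 : α < 1) (hβ : β = (1 - α) / α) :
    region med mad α F = {y | ‖y‖ ≤ β * m₀} := by
  have N := nearlySpherical_self hF hmad hm₀
  ext y
  constructor
  · intro h
    have := N.norm_le_of_mem_region hd hα hα1 hβ h
    simpa using this
  · intro h
    exact N.mem_region_of_norm_le hα hα1 hβ (by simpa using h)

theorem exists_nearlySpherical (hF : IsSphericallySymmetric F ν) (R : IsRegular ν h0 hm m₀) :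
    ∃ K > 0, ∀ᶠ ε in 𝓝[>] (0 : ℝ), ∀ x,
      NearlySpherical med mad (contaminate F ε x) m₀ (K * ε) := by
  obtain ⟨K, hK, hb⟩ := R.expansion.bound
  refine ⟨K, hK, ?_⟩
  have small : ∀ᶠ ε in 𝓝[>] (0 : ℝ), K * ε < m₀ / 2 :=
    (tendsto_const_mul_zero K).eventually (gt_mem_nhds (half_pos R.m₀_pos))
  filter_upwards [hb, small, self_mem_nhdsWithin] with ε h hs hε x
  have hε : 0 < ε := hε
  refine ⟨fun v hv => ?_, fun v hv => ?_, fun v hv => ?_, fun v hv => ?_, by positivity,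
    by linarith, R.m₀_pos⟩
  · rw [proj_contaminate hF ε x hv, proj_contaminate hF ε x (by rwa [norm_neg]), inner_neg_left,
      med_mix_neg R.symm]
  · rw [proj_contaminate hF ε x hv, proj_contaminate hF ε x (by rwa [norm_neg]), inner_neg_left,
      mad_mix_neg R.symm]
  · rw [proj_contaminate hF ε x hv]; exact (h _).1
  · rw [proj_contaminate hF ε x hv]; exact (h _).2

/-- For small contamination at `x`, the profile is locally constant near the direction `u`. -/
def StableDirection (F : Measure (EuclideanSpace ℝ (Fin d))) (x u : EuclideanSpace ℝ (Fin d)) :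
    Prop :=
  ∃ ρ, 0 < ρ ∧ ρ ≤ 1 ∧ ∀ᶠ ε in 𝓝[>] (0 : ℝ), ConstNear med mad (contaminate F ε x) u ρ

theorem stableDirection_zero (hF : IsSphericallySymmetric F ν) {u : EuclideanSpace ℝ (Fin d)}
    (hu : ‖u‖ = 1) : StableDirection F 0 u := by
  refine ⟨1, one_pos, le_rfl, Eventually.of_forall fun ε v hv _ => ?_⟩
  rw [proj_contaminate hF ε 0 hv, proj_contaminate hF ε 0 hu, inner_zero_right, inner_zero_right]
  exact ⟨rfl, rfl⟩

theorem stableDirection_of_generic (hF : IsSphericallySymmetric F ν) (R : IsRegular ν h0 hm m₀)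
    {x u : EuclideanSpace ℝ (Fin d)} (hu : ‖u‖ = 1) (h1 : inner ℝ u x ≠ 0)
    (h2 : |inner ℝ u x| ≠ m₀) : StableDirection F x u := by
  obtain ⟨ρ, hρ, H⟩ := R.expansion.locally_const _ h1 h2
  have hx : 0 < ‖x‖ + 1 := by positivity
  refine ⟨min 1 (ρ / (‖x‖ + 1)), by positivity, min_le_left _ _, ?_⟩
  filter_upwards [H] with ε h v hv hvu
  rw [proj_contaminate hF ε x hv, proj_contaminate hF ε x hu]
  refine h _ ?_
  rw [← inner_sub_left]
  calc |inner ℝ (v - u) x| ≤ ‖v - u‖ * ‖x‖ := abs_real_inner_le_norm _ _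
    _ ≤ ‖v - u‖ * (‖x‖ + 1) := by gcongr; linarith
    _ < ρ := by
      rw [← lt_div_iff₀ hx]
      exact hvu.trans_le (min_le_right _ _)

/-- The unit sphere of the line is two points at distance `2`, so a unit vector within distance `1`
of `u` is `u`. -/
theorem stableDirection_of_dim_one {F : Measure (EuclideanSpace ℝ (Fin d))} (hd : d = 1)
    {x u : EuclideanSpace ℝ (Fin d)} (hu : ‖u‖ = 1) : StableDirection F x u := by
  subst hd
  refine ⟨1, one_pos, le_rfl, Eventually.of_forall fun ε v hv hvu => ?_⟩
  have e : v = u := by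
    have hn : ∀ y : EuclideanSpace ℝ (Fin 1), ‖y‖ = |y 0| := fun y => by
      rw [EuclideanSpace.norm_eq]; simp [Real.sqrt_sq_eq_abs]
    rw [hn] at hu hv hvu
    have h0 : v 0 = u 0 := by
      rw [PiLp.sub_apply] at hvu
      rcases eq_or_eq_neg_of_abs_eq hu with h | h <;> rcases eq_or_eq_neg_of_abs_eq hv with h' | h' <;>
        rw [h, h'] at hvu ⊢ <;> norm_num at hvu
    ext i
    rw [Subsingleton.elim i 0, h0]
  rw [e]; exact ⟨rfl, rfl⟩

theorem tendsto_eventually_pos {g : ℝ → ℝ} (hg : ContinuousAt g 0) (h0 : 0 < g 0) (K : ℝ) :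
    ∀ᶠ ε in 𝓝[>] (0 : ℝ), 0 < g (K * ε) := by
  have := hg.tendsto.comp (tendsto_const_mul_zero K)
  exact this.eventually (lt_mem_nhds h0)

/-- At `e = 0` the room left by distant directions is `β m₀ ρ²/2 > 0`; by continuity it survives an
error `e = K ε`. The threshold for `ε` does not depend on `r`. -/
theorem StableDirection.smul_mem_region_iff (hF : IsSphericallySymmetric F ν)
    (R : IsRegular ν h0 hm m₀)
    {x u : EuclideanSpace ℝ (Fin d)} (hu : ‖u‖ = 1) (hs : StableDirection F x u)
    {α β : ℝ} (hα : 0 < α) (hα1 : α < 1) (hβ : β = (1 - α) / α) :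
    ∀ᶠ ε in 𝓝[>] (0 : ℝ), ∀ r, 0 ≤ r → (r • u ∈ region med mad α (contaminate F ε x) ↔
      r ≤ β * mad (mix ν ε (inner ℝ u x)) + med (mix ν ε (inner ℝ u x))) := by
  obtain ⟨K, hK, hN⟩ := exists_nearlySpherical hF R
  obtain ⟨ρ, hρ, hρ1, hc⟩ := hs
  have hm := R.m₀_pos
  have hβ0 : 0 < β := by rw [hβ]; exact div_pos (by linarith) hα
  have c1 := tendsto_eventually_pos (g := fun e => β * (m₀ - e) - e) (by fun_prop)
    (by simp; positivity) K
  have c2 := tendsto_eventually_pos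
    (g := fun e => β * (m₀ - e) - ((β * (m₀ + e) + e) * (1 - ρ ^ 2 / 2) + e)) (by fun_prop)
    (by
      have : 0 < β * m₀ * (ρ ^ 2 / 2) := by positivity
      simp only [sub_zero, add_zero]
      linarith) K
  filter_upwards [hN, hc, c1, c2] with ε hN hc c1 c2 r hr
  rw [← proj_contaminate hF ε x hu]
  exact (hN x).smul_mem_region_iff hu hρ hρ1 hc hα hα1 hβ (by linarith) (by linarith) hr

theorem StableDirection.outlyingness_smul (hF : IsSphericallySymmetric F ν)
    (R : IsRegular ν h0 hm m₀)
    {x u : EuclideanSpace ℝ (Fin d)} (hu : ‖u‖ = 1) (hs : StableDirection F x u)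
    {r : ℝ} (hr : 0 < r) :
    ∀ᶠ ε in 𝓝[>] (0 : ℝ), (outlyingness med mad (contaminate F ε x) (r • u)).toReal
      = (r - med (mix ν ε (inner ℝ u x))) / mad (mix ν ε (inner ℝ u x)) := by
  obtain ⟨K, hK, hN⟩ := exists_nearlySpherical hF R
  obtain ⟨ρ, hρ, hρ1, hc⟩ := hs
  have hm := R.m₀_pos
  have c1 := tendsto_eventually_pos (g := fun e => r - 2 * e) (by fun_prop) (by simpa using hr) K
  have c2 := tendsto_eventually_pos
    (g := fun e => (r - e) / (m₀ + e) * (m₀ - e) - (r * (1 - ρ ^ 2 / 2) + e))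
    (by
      have : m₀ + 0 ≠ 0 := by simpa using hm.ne'
      fun_prop (disch := assumption))
    (by
      have : 0 < r * (ρ ^ 2 / 2) := by positivity
      simp only [sub_zero, add_zero]
      rw [div_mul_cancel₀ _ hm.ne']
      linarith) K
  filter_upwards [hN, hc, c1, c2] with ε hN hc c1 c2
  rw [← proj_contaminate hF ε x hu]
  exact (hN x).outlyingness_smul hu hρ hρ1 hc (by linarith) (by linarith)

/-- The influence function of the directional radius. -/
def radiusInfluence (h0 hm m₀ β s : ℝ) : ℝ :=
  β * madInfluence h0 hm m₀ s + Real.sign s / (2 * h0)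

theorem tendsto_radiusInfluence (R : IsRegular ν h0 hm m₀) (β s : ℝ) :
    Tendsto (fun ε => ε⁻¹ * (β * mad (mix ν ε s) + med (mix ν ε s) - β * m₀)) (𝓝[>] 0)
      (𝓝 (radiusInfluence h0 hm m₀ β s)) := by
  refine (((R.expansion.tendsto_mad s).const_mul β).add (R.expansion.tendsto_med s)).congr
    fun ε => ?_
  ring

/-- For small `ε` the set of admissible radii is exactly the interval from `0` to `β S + M`, so no
optimisation over directions remains. -/
theorem StableDirection.hasInfluence_radius (hd : 0 < d) (hF : IsSphericallySymmetric F ν)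
    (R : IsRegular ν h0 hm m₀) (hmad : m₀ = mad ν)
    {x u : EuclideanSpace ℝ (Fin d)} (hu : ‖u‖ = 1) (hs : StableDirection F x u)
    {α β : ℝ} (hα : 0 < α) (hα1 : α < 1) (hβ : β = (1 - α) / α) :
    HasInfluence (radius med mad α u) F x (radiusInfluence h0 hm m₀ β (inner ℝ u x)) := by
  have hβ0 : 0 < β := by rw [hβ]; exact div_pos (by linarith) hα
  have hself : radius med mad α u F = β * m₀ := by
    have : {r : ℝ | 0 ≤ r ∧ r • u ∈ region med mad α F} = Icc 0 (β * m₀) := by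
      ext r
      rw [region_self hd hF hmad R.m₀_pos hα hα1 hβ]
      simp only [mem_ofPred_eq, mem_Icc]
      refine and_congr_right fun hr => ?_
      rw [norm_smul, hu, mul_one, Real.norm_of_nonneg hr]
    rw [radius, this, csSup_Icc (mul_pos hβ0 R.m₀_pos).le]
  refine (tendsto_radiusInfluence R β (inner ℝ u x)).congr' ?_
  obtain ⟨K, hK, hN⟩ := R.expansion.bound
  have c1 := tendsto_eventually_pos (g := fun e => β * (m₀ - e) - e) (by fun_prop)
    (by have := R.m₀_pos; simp; positivity) K
  filter_upwards [hs.smul_mem_region_iff hF R hu hα hα1 hβ, hN, c1] with ε h hN c1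
  have : {r : ℝ | 0 ≤ r ∧ r • u ∈ region med mad α (contaminate F ε x)}
      = Icc 0 (β * mad (mix ν ε (inner ℝ u x)) + med (mix ν ε (inner ℝ u x))) := by
    ext r
    exact and_congr_right fun hr => h r hr
  have hN1 := abs_le.1 (hN (inner ℝ u x)).1
  have hN2 := abs_le.1 (hN (inner ℝ u x)).2
  have : β * (m₀ - K * ε) ≤ β * mad (mix ν ε (inner ℝ u x)) := by gcongr; linarith
  rw [hself, radius, ‹{r : ℝ | _} = _›, csSup_Icc (by linarith), smul_eq_mul]

/-- The chain rule along a curve with a right derivative at `0`. The version within `S` is needed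
because the weight is smooth only on `[0, 1]`, possibly with one-sided derivatives at the ends. -/
theorem tendsto_slope_within {g b : ℝ → ℝ} {S : Set ℝ} {k p l : ℝ} (hg : HasDerivWithinAt g k S p)
    (hb : ∀ᶠ ε in 𝓝[>] (0 : ℝ), b ε ∈ S)
    (hl : Tendsto (fun ε => ε⁻¹ * (b ε - p)) (𝓝[>] 0) (𝓝 l)) :
    Tendsto (fun ε => ε⁻¹ * (g (b ε) - g p)) (𝓝[>] 0) (𝓝 (k * l)) := by
  have h2 : (fun ε => b ε - p) =O[𝓝[>] (0 : ℝ)] fun ε => ε := by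
    have h1 := (hl.isBigO_one ℝ).mul (Asymptotics.isBigO_refl (fun ε : ℝ => ε) (𝓝[>] 0))
    simp only [one_mul] at h1
    refine h1.congr' ?_ EventuallyEq.rfl
    filter_upwards [self_mem_nhdsWithin] with ε hε
    have : ε ≠ 0 := ne_of_gt hε
    field_simp
  have hid : Tendsto (fun ε : ℝ => ε) (𝓝[>] 0) (𝓝 0) := nhdsWithin_le_nhds
  have hbt : Tendsto b (𝓝[>] 0) (𝓝[S] p) := by
    refine tendsto_nhdsWithin_iff.2 ⟨?_, hb⟩
    have := h2.trans_tendsto hid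
    exact tendsto_sub_nhds_zero_iff.1 this
  have h1 := (hasDerivWithinAt_iff_isLittleO.1 hg).comp_tendsto hbt
  have h3 := (h1.trans_isBigO h2).tendsto_div_nhds_zero
  have h4 := h3.add (hl.const_mul k)
  rw [zero_add] at h4
  refine h4.congr fun ε => ?_
  simp only [Function.comp, smul_eq_mul]
  rw [div_eq_inv_mul]; ring

/-- Differentiates the explicit value `(r - M)/S` at `M = 0`, `S = m₀`. -/
theorem StableDirection.tendsto_outlyingness (hd : 0 < d) (hF : IsSphericallySymmetric F ν)
    (R : IsRegular ν h0 hm m₀) (hmad : m₀ = mad ν)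
    {x u : EuclideanSpace ℝ (Fin d)} (hu : ‖u‖ = 1) (hs : StableDirection F x u)
    {r : ℝ} (hr : 0 < r) :
    Tendsto (fun ε => ε⁻¹ * ((outlyingness med mad (contaminate F ε x) (r • u)).toReal
        - (outlyingness med mad F (r • u)).toReal)) (𝓝[>] 0)
      (𝓝 (-(Real.sign (inner ℝ u x) / (2 * h0 * m₀)
        + r * madInfluence h0 hm m₀ (inner ℝ u x) / m₀ ^ 2))) := by
  obtain ⟨K, hK, hN⟩ := R.expansion.bound
  have mp := R.m₀_pos
  have h0p := R.h0_pos
  have hS : Tendsto (fun ε => mad (mix ν ε (inner ℝ u x))) (𝓝[>] 0) (𝓝 m₀) :=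
    tendsto_of_abs_sub_le (K := K) (hN.mono fun ε h => (h _).2)
  have T := (((R.expansion.tendsto_med (inner ℝ u x)).mul_const m₀).add
    ((R.expansion.tendsto_mad (inner ℝ u x)).const_mul r)).div (hS.mul_const m₀)
    (by positivity)
  have T := T.neg
  have e : (Real.sign (inner ℝ u x) / (2 * h0) * m₀ + r * madInfluence h0 hm m₀ (inner ℝ u x))
      / (m₀ * m₀) = Real.sign (inner ℝ u x) / (2 * h0 * m₀)
        + r * madInfluence h0 hm m₀ (inner ℝ u x) / m₀ ^ 2 := by
    field_simp
  rw [e] at T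
  refine T.congr' ?_
  filter_upwards [hs.outlyingness_smul hF R hu hr, hS.eventually (lt_mem_nhds mp)] with ε h hp
  rw [h, outlyingness_self hd hF hmad mp, norm_smul, hu, mul_one, Real.norm_of_nonneg hr.le]
  simp only [Pi.div_apply]
  field_simp
  ring

theorem depth_mem_Icc {μ σ : Measure ℝ → ℝ} {F : Measure (EuclideanSpace ℝ (Fin d))}
    {y : EuclideanSpace ℝ (Fin d)} : depth μ σ F y ∈ Icc (0 : ℝ) 1 := by
  rw [depth]
  refine ⟨ENNReal.toReal_nonneg, ?_⟩
  refine ENNReal.toReal_le_of_le_ofReal zero_le_one ?_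
  rw [ENNReal.ofReal_one, ENNReal.inv_le_one]
  exact le_self_add

/-- The derivative of the weight of a point under contamination. -/
def weightInfluence (w : ℝ → ℝ) (h0 hm m₀ r s : ℝ) : ℝ :=
  derivWithin w (Icc 0 1) (1 / (1 + r / m₀)) * ((1 + r / m₀) ^ 2)⁻¹ *
    (Real.sign s / (2 * h0 * m₀) + r * madInfluence h0 hm m₀ s / m₀ ^ 2)

theorem StableDirection.tendsto_weight (hd : 0 < d) (hF : IsSphericallySymmetric F ν)
    (R : IsRegular ν h0 hm m₀) (hmad : m₀ = mad ν)
    {x u : EuclideanSpace ℝ (Fin d)} (hu : ‖u‖ = 1) (hs : StableDirection F x u)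
    {r : ℝ} (hr : 0 < r) {w : ℝ → ℝ} (hw : DifferentiableOn ℝ w (Icc 0 1)) :
    Tendsto (fun ε => ε⁻¹ * (w (depth med mad (contaminate F ε x) (r • u))
        - w (depth med mad F (r • u)))) (𝓝[>] 0)
      (𝓝 (weightInfluence w h0 hm m₀ r (inner ℝ u x))) := by
  have mp := R.m₀_pos
  have T := hs.tendsto_outlyingness hd hF R hmad hu hr
  obtain ⟨K, hK, hN⟩ := exists_nearlySpherical hF R
  have hO : (outlyingness med mad F (r • u)).toReal = r / m₀ := by
    rw [outlyingness_self hd hF hmad mp, norm_smul, hu, mul_one, Real.norm_of_nonneg hr.le]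
  have hpos : 0 < 1 + r / m₀ := by positivity
  have hD : HasDerivAt (fun a : ℝ => 1 / (1 + a)) (-((1 + r / m₀) ^ 2)⁻¹)
      (outlyingness med mad F (r • u)).toReal := by
    rw [hO]
    have := ((hasDerivAt_id (r / m₀)).const_add 1).inv hpos.ne'
    refine (this.congr_deriv ?_).congr_of_eventuallyEq ?_
    · simp only [id]; rw [neg_div, one_div]
    · exact Eventually.of_forall fun a => by simp
  have T2 := tendsto_slope_within (hD.hasDerivWithinAt (s := univ))
    (Eventually.of_forall fun _ => mem_univ _) T
  have hdF : depth med mad F (r • u) = 1 / (1 + r / m₀) := by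
    rw [(nearlySpherical_self hF hmad mp).depth_eq, hO]
  have T3 : Tendsto (fun ε => ε⁻¹ * (depth med mad (contaminate F ε x) (r • u)
      - depth med mad F (r • u))) (𝓝[>] 0)
      (𝓝 (-((1 + r / m₀) ^ 2)⁻¹ * -(Real.sign (inner ℝ u x) / (2 * h0 * m₀)
        + r * madInfluence h0 hm m₀ (inner ℝ u x) / m₀ ^ 2))) := by
    refine T2.congr' ?_
    filter_upwards [hN] with ε hN
    rw [(hN x).depth_eq, (nearlySpherical_self hF hmad mp).depth_eq]
  have hwd := (hw _ (depth_mem_Icc (μ := med) (σ := mad) (F := F) (y := r • u))).hasDerivWithinAt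
  have T4 := tendsto_slope_within hwd (Eventually.of_forall fun ε => depth_mem_Icc) T3
  rw [hdF] at T4
  rw [weightInfluence, hdF]
  convert T4 using 2
  ring

theorem tendsto_depth (hd : 0 < d) (hF : IsSphericallySymmetric F ν) (R : IsRegular ν h0 hm m₀)
    (hmad : m₀ = mad ν) (x y : EuclideanSpace ℝ (Fin d)) :
    Tendsto (fun ε => depth med mad (contaminate F ε x) y) (𝓝[>] 0) (𝓝 (depth med mad F y)) := by
  have mp := R.m₀_pos
  obtain ⟨K, hK, hN⟩ := exists_nearlySpherical hF R
  have T : Tendsto (fun ε => (outlyingness med mad (contaminate F ε x) y).toReal) (𝓝[>] 0)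
      (𝓝 (‖y‖ / m₀)) := by
    refine tendsto_of_abs_sub_le (K := 2 * K * (m₀ + ‖y‖) / m₀ ^ 2) ?_
    filter_upwards [hN] with ε hN
    refine ((hN x).abs_outlyingness_sub_le hd y).trans (le_of_eq ?_)
    ring
  rw [depth_self hd hF hmad mp]
  have : 1 + ‖y‖ / m₀ ≠ 0 := by positivity
  refine ((tendsto_const_nhds (x := (1 : ℝ))).div (T.const_add 1) this).congr' ?_
  filter_upwards [hN] with ε hN
  rw [(hN x).depth_eq]
  rfl

theorem tendsto_weight (hd : 0 < d) (hF : IsSphericallySymmetric F ν) (R : IsRegular ν h0 hm m₀)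
    (hmad : m₀ = mad ν) (x y : EuclideanSpace ℝ (Fin d)) {w : ℝ → ℝ}
    (hw : ContinuousOn w (Icc 0 1)) :
    Tendsto (fun ε => w (depth med mad (contaminate F ε x) y)) (𝓝[>] 0)
      (𝓝 (w (depth med mad F y))) :=
  (hw _ depth_mem_Icc).tendsto.comp (tendsto_nhdsWithin_iff.2
    ⟨tendsto_depth hd hF R hmad x y, Eventually.of_forall fun _ => depth_mem_Icc⟩)

theorem eventually_mem_region_iff (hd : 0 < d) (hF : IsSphericallySymmetric F ν)
    (R : IsRegular ν h0 hm m₀) {α β : ℝ} (hα : 0 < α) (hα1 : α < 1) (hβ : β = (1 - α) / α)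
    (x : EuclideanSpace ℝ (Fin d)) {y : EuclideanSpace ℝ (Fin d)} (hy : ‖y‖ ≠ β * m₀) :
    ∀ᶠ ε in 𝓝[>] (0 : ℝ), (y ∈ region med mad α (contaminate F ε x) ↔ ‖y‖ ≤ β * m₀) := by
  obtain ⟨K, hK, hN⟩ := exists_nearlySpherical hF R
  rcases lt_or_gt_of_ne hy with h | h
  · have c1 := tendsto_eventually_pos (g := fun e => β * m₀ - (β + 1) * e - ‖y‖) (by fun_prop)
      (by simpa using h) K
    filter_upwards [hN, c1] with ε hN c1
    exact iff_of_true ((hN x).mem_region_of_norm_le hα hα1 hβ (by linarith)) h.le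
  · have c1 := tendsto_eventually_pos (g := fun e => ‖y‖ - (β * m₀ + (β + 1) * e)) (by fun_prop)
      (by simpa using h) K
    filter_upwards [hN, c1] with ε hN c1
    refine iff_of_false (fun hy => ?_) (not_le.2 h)
    have := (hN x).norm_le_of_mem_region hd hα hα1 hβ hy
    linarith

/-- The delicate case is `‖x‖ = β * m₀`. In each direction the contamination shifts location and
scale according to the projection of `x` itself, and `Expansion.boundary` keeps that projection
admissible uniformly over directions. -/
theorem eventually_self_mem_region (hF : IsSphericallySymmetric F ν)
    (R : IsRegular ν h0 hm m₀) {α β : ℝ} (hα : 0 < α) (hα1 : α < 1) (hβ : β = (1 - α) / α)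
    (hcond : 1 ≤ β ∨ β * h0 < 2 * hm) {x : EuclideanSpace ℝ (Fin d)} (hx : ‖x‖ ≤ β * m₀) :
    ∀ᶠ ε in 𝓝[>] (0 : ℝ), x ∈ region med mad α (contaminate F ε x) := by
  have hβ0 : 0 < β := by rw [hβ]; exact div_pos (by linarith) hα
  obtain ⟨K, hK, hN⟩ := exists_nearlySpherical hF R
  filter_upwards [hN, R.expansion.boundary β hβ0 hcond] with ε hN hB
  rw [(hN x).mem_region_iff hα hα1, ← hβ]
  intro v hv
  rw [proj_contaminate hF ε x hv]
  exact hB _ ((abs_inner_le_norm_of_unit hv x).trans hx)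

end ProjDepth

end

noncomputable section

namespace ProjDepth

variable {d : ℕ} {F : Measure (EuclideanSpace ℝ (Fin d))} {ν : Measure ℝ}
  {h0 hm m₀ : ℝ}

/-! ### Exceptional directions -/

/-- If `‖x‖ ≤ t`, equality in Cauchy–Schwarz confines the set to the line of `x`, which is null
since `d ≥ 2`. Otherwise the set lies in the frontier of a convex cone, which is always null. -/
theorem volume_inner_eq_mul_norm (hd : 2 ≤ d) {t : ℝ} (ht : 0 < t)
    (x : EuclideanSpace ℝ (Fin d)) :
    volume {y : EuclideanSpace ℝ (Fin d) | inner ℝ y x = t * ‖y‖} = 0 := by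
  rcases le_or_gt ‖x‖ t with h | h
  · have hsub : {y : EuclideanSpace ℝ (Fin d) | inner ℝ y x = t * ‖y‖}
        ⊆ Submodule.span ℝ {x} := by
      intro y hy
      simp only [mem_ofPred_eq] at hy
      have h1 := real_inner_le_norm y x
      have h2 : ‖y‖ * ‖x‖ ≤ ‖y‖ * t := by gcongr
      have h3 : inner ℝ y x = ‖y‖ * ‖x‖ := by linarith [mul_comm t ‖y‖]
      have h4 := inner_eq_norm_mul_iff_real.1 h3
      by_cases hx : ‖x‖ = 0
      · have : y = 0 := by
          rw [hx, mul_zero] at h3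
          rw [h3] at hy
          have : ‖y‖ = 0 := by
            rcases mul_eq_zero.1 hy.symm with h | h
            · exact absurd h ht.ne'
            · exact h
          exact norm_eq_zero.1 this
        rw [this]; exact Submodule.zero_mem _
      · refine Submodule.mem_span_singleton.2 ⟨‖x‖⁻¹ * ‖y‖, ?_⟩
        rw [mul_smul, ← h4, smul_smul, inv_mul_cancel₀ hx, one_smul]
    refine measure_mono_null hsub (Measure.addHaar_submodule _ _ fun htop => ?_)
    have h1 := finrank_span_le_card (R := ℝ) ({x} : Set (EuclideanSpace ℝ (Fin d)))
    rw [htop, finrank_top, finrank_euclideanSpace_fin] at h1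
    simp only [toFinset_singleton, Finset.card_singleton] at h1
    omega
  · have hconv : Convex ℝ {y : EuclideanSpace ℝ (Fin d) | t * ‖y‖ ≤ inner ℝ y x} := by
      intro y hy z hz a b ha hb hab
      simp only [mem_ofPred_eq] at hy hz ⊢
      rw [inner_add_left, real_inner_smul_left, real_inner_smul_left]
      calc t * ‖a • y + b • z‖ ≤ t * (a * ‖y‖ + b * ‖z‖) := by
            gcongr
            refine (norm_add_le _ _).trans (le_of_eq ?_)
            rw [norm_smul, norm_smul, Real.norm_of_nonneg ha, Real.norm_of_nonneg hb]
        _ = a * (t * ‖y‖) + b * (t * ‖z‖) := by ring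
        _ ≤ _ := by gcongr
    refine measure_mono_null ?_ (hconv.addHaar_frontier volume)
    intro y hy
    simp only [mem_ofPred_eq] at hy
    -- Were `y` interior, `y - s x` would stay in the cone for small `s > 0`; this move costs `s
    -- ‖x‖²` on the right but at most `t s ‖x‖` on the left, against `t < ‖x‖`.
    refine ⟨subset_closure hy.ge, fun hint => ?_⟩
    have hc : Tendsto (fun s : ℝ => y - s • x) (𝓝[>] 0) (𝓝 y) := by
      have : Tendsto (fun s : ℝ => y - s • x) (𝓝 0) (𝓝 (y - (0 : ℝ) • x)) :=
        (by fun_prop : Continuous fun s : ℝ => y - s • x).tendsto 0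
      rw [zero_smul, sub_zero] at this
      exact this.mono_left nhdsWithin_le_nhds
    obtain ⟨s, hs, hs0⟩ := ((hc.eventually (mem_interior_iff_mem_nhds.1 hint)).and
      self_mem_nhdsWithin).exists
    have hs0 : 0 < s := hs0
    have hs : t * ‖y - s • x‖ ≤ inner ℝ (y - s • x) x := hs
    rw [inner_sub_left, real_inner_smul_left, real_inner_self_eq_norm_sq, hy] at hs
    have h1 : ‖y‖ - s * ‖x‖ ≤ ‖y - s • x‖ := by
      have := norm_sub_norm_le y (s • x)
      rwa [norm_smul, Real.norm_of_nonneg hs0.le] at this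
    have h2 : t * (‖y‖ - s * ‖x‖) ≤ t * ‖y - s • x‖ := by gcongr
    have h3 : s * ‖x‖ ^ 2 ≤ t * (s * ‖x‖) := by linarith
    have hx : 0 < s * ‖x‖ := mul_pos hs0 (ht.trans h)
    nlinarith

theorem volume_inner_eq_zero {x : EuclideanSpace ℝ (Fin d)} (hx : x ≠ 0) :
    volume {y : EuclideanSpace ℝ (Fin d) | inner ℝ y x = (0 : ℝ)} = 0 := by
  have e : {y : EuclideanSpace ℝ (Fin d) | inner ℝ y x = (0 : ℝ)}
      = ((Submodule.span ℝ {x})ᗮ : Submodule ℝ (EuclideanSpace ℝ (Fin d))) := by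
    ext y
    simp only [mem_ofPred_eq, SetLike.mem_coe, Submodule.mem_orthogonal_singleton_iff_inner_left]
  rw [e]
  refine Measure.addHaar_submodule _ _ fun htop => ?_
  rw [Submodule.orthogonal_eq_top_iff, Submodule.span_singleton_eq_bot] at htop
  exact hx htop

/-- The directions along which the profile of the contaminated distribution may be unstable. -/
def exceptional (m₀ : ℝ) (x : EuclideanSpace ℝ (Fin d)) : Set (EuclideanSpace ℝ (Fin d)) :=
  {y | inner ℝ y x = (0 : ℝ)} ∪ {y | |inner ℝ y x| = m₀ * ‖y‖}

theorem measurableSet_exceptional (m₀ : ℝ) (x : EuclideanSpace ℝ (Fin d)) :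
    MeasurableSet (exceptional m₀ x) :=
  ((isClosed_eq (by fun_prop) (by fun_prop)).union
    (isClosed_eq (by fun_prop) (by fun_prop))).measurableSet

theorem volume_exceptional (hd : 2 ≤ d) (hm₀ : 0 < m₀) {x : EuclideanSpace ℝ (Fin d)}
    (hx : x ≠ 0) : volume (exceptional m₀ x) = 0 := by
  refine measure_union_null (volume_inner_eq_zero hx) ?_
  refine measure_mono_null (t := {y | inner ℝ y x = m₀ * ‖y‖} ∪ {y | inner ℝ y (-x) = m₀ * ‖y‖})
    ?_ (measure_union_null (volume_inner_eq_mul_norm hd hm₀ x)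
      (volume_inner_eq_mul_norm hd hm₀ (-x)))
  intro y hy
  simp only [mem_ofPred_eq] at hy
  rcases abs_choice (inner ℝ y x) with h | h
  · left; rw [h] at hy; exact hy
  · right; rw [h] at hy; simpa using hy

theorem smul_mem_exceptional_iff {x y : EuclideanSpace ℝ (Fin d)} {r : ℝ} (hr : 0 < r) :
    r • y ∈ exceptional m₀ x ↔ y ∈ exceptional m₀ x := by
  simp only [exceptional, mem_union, mem_ofPred_eq, real_inner_smul_left, norm_smul,
    Real.norm_of_nonneg hr.le, abs_mul, abs_of_pos hr]
  refine or_congr (by simp [hr.ne']) ?_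
  rw [mul_left_comm]
  exact mul_right_inj' hr.ne'

theorem stableDirection_of_notMem_exceptional (hF : IsSphericallySymmetric F ν)
    (R : IsRegular ν h0 hm m₀) {x u : EuclideanSpace ℝ (Fin d)} (hu : ‖u‖ = 1)
    (h : u ∉ exceptional m₀ x) : StableDirection F x u := by
  simp only [exceptional, mem_union, mem_ofPred_eq, hu, mul_one, not_or] at h
  exact stableDirection_of_generic hF R hu h.1 h.2

theorem ae_stableDirection (hd : 0 < d) (hF : IsSphericallySymmetric F ν)
    (R : IsRegular ν h0 hm m₀) (x : EuclideanSpace ℝ (Fin d)) :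
    ∀ᵐ y : EuclideanSpace ℝ (Fin d), y ≠ 0 → StableDirection F x (‖y‖⁻¹ • y) := by
  have hunit : ∀ y : EuclideanSpace ℝ (Fin d), y ≠ 0 → ‖‖y‖⁻¹ • y‖ = 1 := fun y hy => by
    simp [norm_smul, hy]
  by_cases hd1 : d = 1
  · exact Eventually.of_forall fun y hy => stableDirection_of_dim_one hd1 (hunit y hy)
  by_cases hx : x = 0
  · subst hx
    exact Eventually.of_forall fun y hy => stableDirection_zero hF (hunit y hy)
  have hnull := volume_exceptional (by omega) R.m₀_pos hx
  filter_upwards [measure_eq_zero_iff_ae_notMem.1 hnull] with y hy hy0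
  refine stableDirection_of_notMem_exceptional hF R (hunit y hy0) ?_
  rwa [smul_mem_exceptional_iff (by positivity)]

theorem ae_toSphere_stableDirection (hd : 0 < d) (hF : IsSphericallySymmetric F ν)
    (R : IsRegular ν h0 hm m₀) (x : EuclideanSpace ℝ (Fin d)) :
    ∀ᵐ u : Metric.sphere (0 : EuclideanSpace ℝ (Fin d)) 1
      ∂(volume : Measure (EuclideanSpace ℝ (Fin d))).toSphere, StableDirection F x u := by
  have hunit : ∀ u : Metric.sphere (0 : EuclideanSpace ℝ (Fin d)) 1,
      ‖(u : EuclideanSpace ℝ (Fin d))‖ = 1 := fun u => by simp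
  by_cases hd1 : d = 1
  · exact Eventually.of_forall fun u => stableDirection_of_dim_one hd1 (hunit u)
  by_cases hx : x = 0
  · subst hx
    exact Eventually.of_forall fun u => stableDirection_zero hF (hunit u)
  have hnull := volume_exceptional (by omega) R.m₀_pos hx
  have hmeas : MeasurableSet ((↑) ⁻¹' exceptional m₀ x :
      Set (Metric.sphere (0 : EuclideanSpace ℝ (Fin d)) 1)) :=
    measurable_subtype_coe (measurableSet_exceptional m₀ x)
  have h0 : (volume : Measure (EuclideanSpace ℝ (Fin d))).toSphere ((↑) ⁻¹' exceptional m₀ x) = 0 := by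
    -- The surface measure of a set is a multiple of the volume of the truncated cone over it, and
    -- the exceptional set is a cone.
    rw [Measure.toSphere_apply' _ hmeas]
    refine mul_eq_zero_of_right _ (measure_mono_null ?_ hnull)
    rintro _ ⟨r, hr, _, ⟨u, hu, rfl⟩, rfl⟩
    exact (smul_mem_exceptional_iff hr.1).2 hu
  filter_upwards [measure_eq_zero_iff_ae_notMem.1 h0] with u hu
  exact stableDirection_of_notMem_exceptional hF R (hunit u) hu

/-! ### Rotation invariance -/

/-- The Cramér–Wold device: the characteristic function at `v` is determined by the law of the
projection along `v`, hence depends on `‖v‖` alone. -/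
theorem IsSphericallySymmetric.map_isometry [IsProbabilityMeasure F]
    (hF : IsSphericallySymmetric F ν)
    (L : EuclideanSpace ℝ (Fin d) ≃ₗᵢ[ℝ] EuclideanSpace ℝ (Fin d)) : F.map L = F := by
  have hL : Measurable L := L.continuous.measurable
  have := Measure.isProbabilityMeasure_map (μ := F) hL.aemeasurable
  have key : ∀ v : EuclideanSpace ℝ (Fin d), v ≠ 0 →
      charFun F v = ∫ z, Complex.exp (↑(‖v‖ * z) * Complex.I) ∂ν := by
    intro v hv
    have hu : ‖‖v‖⁻¹ • v‖ = 1 := by simp [norm_smul, hv]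
    rw [← hF.2 _ hu, proj, integral_map (by fun_prop) (by fun_prop), charFun_apply]
    refine integral_congr_ae (Eventually.of_forall fun y => ?_)
    simp only
    congr 3
    rw [real_inner_smul_left, mul_inv_cancel_left₀ (norm_ne_zero_iff.2 hv), real_inner_comm]
  refine Measure.ext_of_charFun (funext fun t => ?_)
  have e : charFun (F.map L) t = charFun F (L.symm t) := by
    rw [charFun_apply, charFun_apply, integral_map hL.aemeasurable (by fun_prop)]
    refine integral_congr_ae (Eventually.of_forall fun y => ?_)
    simp only
    congr 3
    rw [← L.inner_map_map y (L.symm t), L.apply_symm_apply]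
  rw [e]
  by_cases ht : t = 0
  · subst ht; simp
  · rw [key t ht, key _ (by simpa using ht), LinearIsometryEquiv.norm_map]

theorem IsSphericallySymmetric.setIntegral_comp_isometry [IsProbabilityMeasure F]
    (hF : IsSphericallySymmetric F ν)
    (L : EuclideanSpace ℝ (Fin d) ≃ₗᵢ[ℝ] EuclideanSpace ℝ (Fin d)) {V : Type*}
    [NormedAddCommGroup V] [NormedSpace ℝ V] (g : EuclideanSpace ℝ (Fin d) → V) (r : ℝ) :
    ∫ y in {y | ‖y‖ ≤ r}, g (L y) ∂F = ∫ y in {y | ‖y‖ ≤ r}, g y ∂F := by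
  have hp : MeasurePreserving L F F := ⟨L.continuous.measurable, hF.map_isometry L⟩
  have hpre : {y : EuclideanSpace ℝ (Fin d) | ‖y‖ ≤ r} = L ⁻¹' {y | ‖y‖ ≤ r} := by
    ext y; simp
  nth_rw 1 [hpre]
  exact hp.setIntegral_preimage_emb L.toHomeomorph.measurableEmbedding g _

end ProjDepth

end

noncomputable section

namespace ProjDepth

variable {d : ℕ}

/-! ### Measurability, polar coordinates and short integrals -/

/-- The supremum runs over uncountably many directions, so measurability comes from lower
semicontinuity of a supremum of continuous functions. -/
theorem NearlySpherical.measurable_depth {μ σ : Measure ℝ → ℝ}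
    {F : Measure (EuclideanSpace ℝ (Fin d))} {m₀ e : ℝ} (N : NearlySpherical μ σ F m₀ e) :
    Measurable (depth μ σ F) := by
  have hO : Measurable (outlyingness μ σ F) := by
    refine LowerSemicontinuous.measurable ?_
    refine lowerSemicontinuous_iSup fun v => Continuous.lowerSemicontinuous ?_
    have hs := (N.scale_pos (v := v) (by simp)).2.2
    refine (ENNReal.continuous_div_const _ (by simpa using hs)).comp ?_
    exact ENNReal.continuous_ofReal.comp (by fun_prop)
  exact ((hO.const_add 1).inv).ennreal_toReal

theorem NearlySpherical.measurableSet_region {μ σ : Measure ℝ → ℝ}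
    {F : Measure (EuclideanSpace ℝ (Fin d))} {m₀ e : ℝ} (N : NearlySpherical μ σ F m₀ e) (α : ℝ) :
    MeasurableSet (region μ σ α F) :=
  measurableSet_le measurable_const N.measurable_depth

theorem measurable_weight_comp {Ω : Type*} [MeasurableSpace Ω] {w : ℝ → ℝ} {g : Ω → ℝ}
    (hw : ContinuousOn w (Icc 0 1)) (hg : Measurable g) (hg01 : ∀ y, g y ∈ Icc (0 : ℝ) 1) :
    Measurable fun y => w (g y) := by
  have h : Continuous (IccExtend (zero_le_one' ℝ) ((Icc (0 : ℝ) 1).domRestrict w)) :=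
    (continuousOn_iff_continuous_domRestrict.1 hw).Icc_extend'
  have e : (fun y => w (g y)) = fun y => IccExtend (zero_le_one' ℝ) ((Icc (0 : ℝ) 1).domRestrict w) (g y) := by
    ext y
    rw [IccExtend_of_mem _ _ (hg01 y), domRestrict_apply]
  rw [e]
  exact h.measurable.comp hg

theorem exists_weight_bounds {w : ℝ → ℝ} (hw : ContDiffOn ℝ 1 w (Icc 0 1)) :
    ∃ M > 0, (∀ t ∈ Icc (0 : ℝ) 1, |w t| ≤ M) ∧
      (∀ t ∈ Icc (0 : ℝ) 1, |derivWithin w (Icc 0 1) t| ≤ M) ∧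
      ∀ s ∈ Icc (0 : ℝ) 1, ∀ t ∈ Icc (0 : ℝ) 1, |w t - w s| ≤ M * |t - s| := by
  obtain ⟨M1, h1⟩ := isCompact_Icc.exists_bound_of_continuousOn hw.continuousOn
  obtain ⟨M2, h2⟩ := isCompact_Icc.exists_bound_of_continuousOn
    (hw.continuousOn_derivWithin (uniqueDiffOn_Icc zero_lt_one) le_rfl)
  refine ⟨max 1 (max M1 M2), by positivity, fun t ht => (h1 t ht).trans ?_,
    fun t ht => (h2 t ht).trans ?_, fun s hs t ht => ?_⟩
  · exact (le_max_left _ _).trans (le_max_right _ _)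
  · exact (le_max_right _ _).trans (le_max_right _ _)
  · exact (convex_Icc 0 1).norm_image_sub_le_of_norm_derivWithin_le
      (hw.differentiableOn one_ne_zero)
      (fun t ht => (h2 t ht).trans ((le_max_right _ _).trans (le_max_right _ _))) hs ht

/-- Transports the integral along the homeomorphism of the punctured space with sphere times
half-line. Integrability of the radial integrals is recorded too, as dominated convergence on the
sphere needs their measurability. -/
theorem integrable_and_integral_polar {V : Type*} [NormedAddCommGroup V] [NormedSpace ℝ V]
    (hd : 0 < d) {G : EuclideanSpace ℝ (Fin d) → V} (hG : Integrable G) :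
    Integrable (fun u : Metric.sphere (0 : EuclideanSpace ℝ (Fin d)) 1 =>
        ∫ r in Ioi (0 : ℝ), r ^ (d - 1) • G (r • (u : EuclideanSpace ℝ (Fin d))))
        (volume : Measure (EuclideanSpace ℝ (Fin d))).toSphere ∧
      ∫ y, G y = ∫ u : Metric.sphere (0 : EuclideanSpace ℝ (Fin d)) 1,
        (∫ r in Ioi (0 : ℝ), r ^ (d - 1) • G (r • (u : EuclideanSpace ℝ (Fin d))))
        ∂(volume : Measure (EuclideanSpace ℝ (Fin d))).toSphere := by
  have : Nonempty (Fin d) := ⟨⟨0, hd⟩⟩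
  set μ := (volume : Measure (EuclideanSpace ℝ (Fin d))) with hμ
  have hdim : Module.finrank ℝ (EuclideanSpace ℝ (Fin d)) = d := finrank_euclideanSpace_fin
  have hmp := μ.measurePreserving_homeomorphUnitSphereProd
  rw [hdim] at hmp
  have hemb := (homeomorphUnitSphereProd (EuclideanSpace ℝ (Fin d))).measurableEmbedding
  set P : Metric.sphere (0 : EuclideanSpace ℝ (Fin d)) 1 × Ioi (0 : ℝ) → V :=
    fun p => G ((p.2 : ℝ) • (p.1 : EuclideanSpace ℝ (Fin d))) with hP
  have hPG : (fun y : ({0}ᶜ : Set (EuclideanSpace ℝ (Fin d))) =>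
      P (homeomorphUnitSphereProd (EuclideanSpace ℝ (Fin d)) y))
      = fun y : ({0}ᶜ : Set (EuclideanSpace ℝ (Fin d))) => G y := by
    ext y
    have : ‖(y : EuclideanSpace ℝ (Fin d))‖ ≠ 0 := norm_ne_zero_iff.2 y.2
    simp only [hP, homeomorphUnitSphereProd_apply_fst_coe, homeomorphUnitSphereProd_apply_snd_coe]
    rw [smul_smul, mul_inv_cancel₀ this, one_smul]
  have hPi : Integrable P (μ.toSphere.prod (Measure.volumeIoiPow (d - 1))) := by
    rw [← hmp.integrable_comp_emb hemb]
    change Integrable (fun y => P (homeomorphUnitSphereProd (EuclideanSpace ℝ (Fin d)) y)) _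
    rw [hPG]
    have h2 := hG.integrableOn (s := {(0 : EuclideanSpace ℝ (Fin d))}ᶜ)
    rwa [integrableOn_iff_comap_subtypeVal (measurableSet_singleton _).compl] at h2
  have hin : ∀ u : Metric.sphere (0 : EuclideanSpace ℝ (Fin d)) 1,
      ∫ r, P (u, r) ∂(Measure.volumeIoiPow (d - 1))
      = ∫ r in Ioi (0 : ℝ), r ^ (d - 1) • G (r • (u : EuclideanSpace ℝ (Fin d))) := by
    intro u
    simp only [Measure.volumeIoiPow, ENNReal.ofReal]
    rw [integral_withDensity_eq_integral_smul
      ((measurable_subtype_coe.pow_const _).real_toNNReal),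
      integral_subtype_comap measurableSet_Ioi fun a =>
        Real.toNNReal (a ^ (d - 1)) • G (a • (u : EuclideanSpace ℝ (Fin d))),
      setIntegral_congr_fun measurableSet_Ioi fun x hx => ?_]
    rw [NNReal.smul_def, Real.coe_toNNReal _ (pow_nonneg (le_of_lt hx) _)]
  constructor
  · refine hPi.integral_prod_left.congr (Eventually.of_forall fun u => hin u)
  · calc ∫ y, G y = ∫ y : ({0}ᶜ : Set (EuclideanSpace ℝ (Fin d))), G y ∂(μ.comap (↑)) := by
          rw [integral_subtype_comap (measurableSet_singleton _).compl fun x => G x,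
            restrict_compl_singleton]
      _ = ∫ p, P p ∂(μ.toSphere.prod (Measure.volumeIoiPow (d - 1))) := by
          rw [← hmp.integral_comp hemb, ← hPG]
      _ = _ := by
          rw [integral_prod _ hPi]
          exact integral_congr_ae (Eventually.of_forall fun u => hin u)

/-- The difference of the integrals over two initial segments is an interval integral. -/
theorem integral_Ioi_indicator_sub {V : Type*} [NormedAddCommGroup V] [NormedSpace ℝ V]
    {g : ℝ → V} {a b : ℝ} (ha : 0 < a) (hb : 0 < b) :
    ∫ r in Ioi (0 : ℝ), ((Iic b).indicator (1 : ℝ → ℝ) r - (Iic a).indicator 1 r) • g r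
      = ∫ r in a..b, g r := by
  rcases le_total a b with h | h
  · have e : ∀ r, ((Iic b).indicator (1 : ℝ → ℝ) r - (Iic a).indicator 1 r) • g r
        = (Ioc a b).indicator g r := by
      intro r
      by_cases h1 : r ≤ a
      · simp [h1, h1.trans h]
      · by_cases h2 : r ≤ b <;> simp [h1, h2, not_le.1 h1]
    simp only [e]
    rw [setIntegral_indicator measurableSet_Ioc, intervalIntegral.integral_of_le h,
      inter_eq_self_of_subset_right (show Ioc a b ⊆ Ioi 0 from fun r hr => lt_trans ha hr.1)]
  · have e : ∀ r, ((Iic b).indicator (1 : ℝ → ℝ) r - (Iic a).indicator 1 r) • g r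
        = -(Ioc b a).indicator g r := by
      intro r
      by_cases h1 : r ≤ b
      · simp [h1, h1.trans h]
      · by_cases h2 : r ≤ a <;> simp [h1, h2, not_le.1 h1]
    simp only [e]
    rw [integral_neg, setIntegral_indicator measurableSet_Ioc, intervalIntegral.integral_of_ge h,
      inter_eq_self_of_subset_right (show Ioc b a ⊆ Ioi 0 from fun r hr => lt_trans hb hr.1)]

/-- A derivative of integrals over shrinking intervals with varying integrands. -/
theorem tendsto_shrinking_integral {V : Type*} [NormedAddCommGroup V] [NormedSpace ℝ V]
    [CompleteSpace V] {g : ℝ → ℝ → V} {b : ℝ → ℝ} {a k : ℝ} {L : V}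
    (hb : Tendsto (fun ε => ε⁻¹ * (b ε - a)) (𝓝[>] 0) (𝓝 k))
    (hg : Tendsto (fun p : ℝ × ℝ => g p.1 p.2) (𝓝[>] 0 ×ˢ 𝓝 a) (𝓝 L))
    (hint : ∀ᶠ ε in 𝓝[>] (0 : ℝ), IntervalIntegrable (g ε) volume a (b ε)) :
    Tendsto (fun ε => ε⁻¹ • ∫ r in a..b ε, g ε r) (𝓝[>] 0) (𝓝 (k • L)) := by
  have hid : Tendsto (fun ε : ℝ => ε) (𝓝[>] 0) (𝓝 0) := nhdsWithin_le_nhds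
  have hba : Tendsto b (𝓝[>] 0) (𝓝 a) := by
    have h := (hid.mul hb).add_const a
    rw [zero_mul, zero_add] at h
    refine h.congr' ?_
    filter_upwards [self_mem_nhdsWithin] with ε hε
    have : ε ≠ 0 := ne_of_gt hε
    field_simp
    ring
  -- On the interval the integrand is uniformly close to `L`, while its length divided by `ε` stays
  -- bounded by `|k| + 1`.
  have key : Tendsto (fun ε => ε⁻¹ • ∫ r in a..b ε, (g ε r - L)) (𝓝[>] 0) (𝓝 0) := by
    rw [Metric.tendsto_nhds]
    intro η hη
    have hη' : 0 < η / (|k| + 1) / 2 := by positivity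
    obtain ⟨A, hA, B, hB, hAB⟩ := Filter.eventually_prod_iff.1 (Metric.tendsto_nhds.1 hg _ hη')
    obtain ⟨ρ, hρ, hBρ⟩ := Metric.eventually_nhds_iff.1 hB
    filter_upwards [hA, Metric.tendsto_nhds.1 hba ρ hρ, self_mem_nhdsWithin,
      hb.abs.eventually (gt_mem_nhds (lt_add_one |k|))] with ε h1 h2 hε h3
    have hε : 0 < ε := hε
    have hle : ‖∫ r in a..b ε, (g ε r - L)‖ ≤ η / (|k| + 1) / 2 * |b ε - a| := by
      refine intervalIntegral.norm_integral_le_of_norm_le_const fun r hr => ?_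
      have hr' : dist r a < ρ := by
        refine lt_of_le_of_lt ?_ h2
        rw [Real.dist_eq, Real.dist_eq]
        exact abs_sub_left_of_mem_uIcc (uIoc_subset_uIcc hr)
      have := hAB h1 (hBρ hr')
      rw [dist_eq_norm] at this
      exact this.le
    rw [abs_mul, abs_of_pos (inv_pos.2 hε)] at h3
    rw [dist_zero_right, norm_smul, Real.norm_of_nonneg (inv_pos.2 hε).le]
    calc ε⁻¹ * ‖∫ r in a..b ε, (g ε r - L)‖ ≤ ε⁻¹ * (η / (|k| + 1) / 2 * |b ε - a|) := by gcongr
      _ = η / (|k| + 1) / 2 * (ε⁻¹ * |b ε - a|) := by ring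
      _ ≤ η / (|k| + 1) / 2 * (|k| + 1) := by gcongr
      _ = η / 2 := by field_simp
      _ < η := by linarith
  have h := key.add (hb.smul_const L)
  rw [zero_add] at h
  refine h.congr' ?_
  filter_upwards [hint] with ε hi
  rw [intervalIntegral.integral_sub hi intervalIntegrable_const, intervalIntegral.integral_const,
    smul_sub, smul_smul, sub_add_cancel]

end ProjDepth

end

noncomputable section

namespace ProjDepth

variable {d : ℕ}

/-! ### The trimmed mean -/

/-- A spherically symmetric law with density `f`, regular projections, and a smooth weight. -/
structure TrimmedSetting (F : Measure (EuclideanSpace ℝ (Fin d))) (ν : Measure ℝ)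
    (f : EuclideanSpace ℝ (Fin d) → ℝ) (w : ℝ → ℝ) (h0 hm m₀ α β c : ℝ) : Prop where
  dim_pos : 0 < d
  prob : IsProbabilityMeasure F
  measurable_f : Measurable f
  f_nonneg : ∀ y, 0 ≤ f y
  density : F = volume.withDensity fun y => ENNReal.ofReal (f y)
  symm : IsSphericallySymmetric F ν
  regular : IsRegular ν h0 hm m₀
  mad_eq : m₀ = mad ν
  α_pos : 0 < α
  α_lt : α < 1
  β_eq : β = (1 - α) / α
  c_eq : c = β * m₀
  f_cont : ∃ δ > 0, ContinuousOn f {y | |‖y‖ - c| < δ}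
  w_smooth : ContDiffOn ℝ 1 w (Icc 0 1)

variable {F : Measure (EuclideanSpace ℝ (Fin d))} {ν : Measure ℝ}
    {f : EuclideanSpace ℝ (Fin d) → ℝ} {w : ℝ → ℝ} {h0 hm m₀ α β c : ℝ}

namespace TrimmedSetting

theorem β_pos (S : TrimmedSetting F ν f w h0 hm m₀ α β c) : 0 < β := by
  rw [S.β_eq]; exact div_pos (by linarith [S.α_lt]) S.α_pos

theorem c_pos (S : TrimmedSetting F ν f w h0 hm m₀ α β c) : 0 < c := by
  rw [S.c_eq]; exact mul_pos S.β_pos S.regular.m₀_pos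

theorem nearlySpherical (S : TrimmedSetting F ν f w h0 hm m₀ α β c) :
    NearlySpherical med mad F m₀ 0 :=
  nearlySpherical_self S.symm S.mad_eq S.regular.m₀_pos

theorem depth_eq (S : TrimmedSetting F ν f w h0 hm m₀ α β c) (y : EuclideanSpace ℝ (Fin d)) :
    depth med mad F y = 1 / (1 + ‖y‖ / m₀) :=
  depth_self S.dim_pos S.symm S.mad_eq S.regular.m₀_pos y

theorem region_eq (S : TrimmedSetting F ν f w h0 hm m₀ α β c) :
    region med mad α F = {y | ‖y‖ ≤ c} := by
  rw [region_self S.dim_pos S.symm S.mad_eq S.regular.m₀_pos S.α_pos S.α_lt S.β_eq, S.c_eq]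

theorem measurable_weight_of_nearlySpherical (S : TrimmedSetting F ν f w h0 hm m₀ α β c)
    {F' : Measure (EuclideanSpace ℝ (Fin d))} {e : ℝ} (N : NearlySpherical med mad F' m₀ e) :
    Measurable fun y => w (depth med mad F' y) :=
  measurable_weight_comp S.w_smooth.continuousOn N.measurable_depth fun _ => depth_mem_Icc

theorem measurableSet_ball : MeasurableSet {y : EuclideanSpace ℝ (Fin d) | ‖y‖ ≤ c} :=
  measurableSet_le measurable_norm measurable_const

theorem ae_ne_zero (S : TrimmedSetting F ν f w h0 hm m₀ α β c) : ∀ᵐ y ∂F, y ≠ 0 := by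
  have : Nonempty (Fin d) := ⟨⟨0, S.dim_pos⟩⟩
  have h : ∀ᵐ y : EuclideanSpace ℝ (Fin d), y ≠ 0 :=
    measure_eq_zero_iff_ae_notMem.1 (measure_singleton (0 : EuclideanSpace ℝ (Fin d)))
  rw [S.density]
  exact (withDensity_absolutelyContinuous _ _).ae_le h

theorem ae_norm_ne (S : TrimmedSetting F ν f w h0 hm m₀ α β c) : ∀ᵐ y ∂F, ‖y‖ ≠ c := by
  have : Nonempty (Fin d) := ⟨⟨0, S.dim_pos⟩⟩
  have h : ∀ᵐ y : EuclideanSpace ℝ (Fin d), ‖y‖ ≠ c := by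
    filter_upwards [measure_eq_zero_iff_ae_notMem.1
      (Measure.addHaar_sphere volume (0 : EuclideanSpace ℝ (Fin d)) c)] with y hy
    simpa using hy
  rw [S.density]
  exact (withDensity_absolutelyContinuous _ _).ae_le h

theorem ae_stable (S : TrimmedSetting F ν f w h0 hm m₀ α β c) (x : EuclideanSpace ℝ (Fin d)) :
    ∀ᵐ y ∂F, y ≠ 0 → StableDirection F x (‖y‖⁻¹ • y) := by
  have h := ae_stableDirection S.dim_pos S.symm S.regular x
  have h2 : F ≪ volume := by
    conv_lhs => rw [S.density]
    exact withDensity_absolutelyContinuous _ _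
  exact h2.ae_le h

theorem abs_inv_one_add_sub_le {a b : ℝ} (ha : 0 ≤ a) (hb : 0 ≤ b) :
    |1 / (1 + a) - 1 / (1 + b)| ≤ |a - b| := by
  have e : 1 / (1 + a) - 1 / (1 + b) = (b - a) / ((1 + a) * (1 + b)) := by
    field_simp; ring
  rw [e, abs_div, abs_sub_comm, abs_of_pos (show 0 < (1 + a) * (1 + b) by positivity)]
  exact div_le_self (abs_nonneg _) (by nlinarith)

/-- The depth changes by `O(ε)`, uniformly in the contamination and locally uniformly in the
point. -/
theorem exists_depth_bound (S : TrimmedSetting F ν f w h0 hm m₀ α β c) :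
    ∃ K > 0, ∀ᶠ ε in 𝓝[>] (0 : ℝ), ∀ x y : EuclideanSpace ℝ (Fin d),
      |depth med mad (contaminate F ε x) y - depth med mad F y| ≤ K * ε * (m₀ + ‖y‖) := by
  have mp := S.regular.m₀_pos
  obtain ⟨K, hK, hN⟩ := exists_nearlySpherical S.symm S.regular
  refine ⟨2 * K / m₀ ^ 2, by positivity, ?_⟩
  filter_upwards [hN] with ε hN x y
  rw [(hN x).depth_eq, S.depth_eq]
  refine (abs_inv_one_add_sub_le ENNReal.toReal_nonneg (by positivity)).trans
    (((hN x).abs_outlyingness_sub_le S.dim_pos y).trans (le_of_eq ?_))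
  field_simp

/-- The difference quotients of the weights are bounded on the ball, by the Lipschitz property of
`w` and the uniform `O(ε)` change of depth, and they converge along almost every ray. -/
theorem tendsto_integral_weight_sub (S : TrimmedSetting F ν f w h0 hm m₀ α β c)
    (x : EuclideanSpace ℝ (Fin d)) :
    Tendsto (fun ε => ε⁻¹ • ∫ y in {y | ‖y‖ ≤ c},
        (w (depth med mad (contaminate F ε x) y) - w (depth med mad F y)) • y ∂F) (𝓝[>] 0)
      (𝓝 (∫ y in {y | ‖y‖ ≤ c},
        weightInfluence w h0 hm m₀ ‖y‖ (inner ℝ (‖y‖⁻¹ • y) x) • y ∂F)) := by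
  have := S.prob
  have mp := S.regular.m₀_pos
  have cp := S.c_pos
  obtain ⟨M, hM, -, -, hLip⟩ := exists_weight_bounds S.w_smooth
  obtain ⟨K, hK, hD⟩ := S.exists_depth_bound
  obtain ⟨K', hK', hN⟩ := exists_nearlySpherical S.symm S.regular
  simp only [← integral_smul]
  refine tendsto_integral_filter_of_dominated_convergence (fun _ => M * (K * (m₀ + c)) * c)
    ?_ ?_ (integrable_const _) ?_
  · filter_upwards [hN] with ε hN
    have h1 := S.measurable_weight_of_nearlySpherical (hN x)
    have h2 := S.measurable_weight_of_nearlySpherical S.nearlySpherical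
    exact (((h1.sub h2).smul measurable_id).const_smul ε⁻¹).aestronglyMeasurable
  · filter_upwards [hD, self_mem_nhdsWithin] with ε hD hε
    have hε : 0 < ε := hε
    filter_upwards [ae_restrict_mem measurableSet_ball] with y hy
    have hy : ‖y‖ ≤ c := hy
    rw [norm_smul, norm_smul, Real.norm_of_nonneg (inv_pos.2 hε).le, Real.norm_eq_abs]
    calc ε⁻¹ * (|w (depth med mad (contaminate F ε x) y) - w (depth med mad F y)| * ‖y‖)
        ≤ ε⁻¹ * (M * (K * ε * (m₀ + c)) * c) := by
          gcongr
          refine (hLip _ depth_mem_Icc _ depth_mem_Icc).trans ?_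
          gcongr
          refine (hD x y).trans ?_
          gcongr
      _ = M * (K * (m₀ + c)) * c := by field_simp
  · filter_upwards [ae_restrict_of_ae S.ae_ne_zero, ae_restrict_of_ae (S.ae_stable x)] with y h1 h2
    have hn : 0 < ‖y‖ := norm_pos_iff.2 h1
    have T := (h2 h1).tendsto_weight S.dim_pos S.symm S.regular S.mad_eq
      (by simp [norm_smul, hn.ne']) hn (S.w_smooth.differentiableOn one_ne_zero)
    rw [smul_inv_smul₀ hn.ne'] at T
    refine (T.smul_const y).congr fun ε => ?_
    rw [mul_smul]

theorem tendsto_integral_weight (S : TrimmedSetting F ν f w h0 hm m₀ α β c)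
    (x : EuclideanSpace ℝ (Fin d)) :
    Tendsto (fun ε => ∫ y in region med mad α (contaminate F ε x),
        w (depth med mad (contaminate F ε x) y) ∂F) (𝓝[>] 0)
      (𝓝 (∫ y in {y | ‖y‖ ≤ c}, w (depth med mad F y) ∂F)) := by
  have := S.prob
  obtain ⟨M, hM, hMb, -, -⟩ := exists_weight_bounds S.w_smooth
  obtain ⟨K', hK', hN⟩ := exists_nearlySpherical S.symm S.regular
  rw [← integral_indicator measurableSet_ball]
  have T : Tendsto (fun ε => ∫ y, (region med mad α (contaminate F ε x)).indicator
      (fun y => w (depth med mad (contaminate F ε x) y)) y ∂F) (𝓝[>] 0)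
      (𝓝 (∫ y, {y | ‖y‖ ≤ c}.indicator (fun y => w (depth med mad F y)) y ∂F)) := by
    refine tendsto_integral_filter_of_dominated_convergence (fun _ => M) ?_ ?_
      (integrable_const _) ?_
    · filter_upwards [hN] with ε hN
      exact ((S.measurable_weight_of_nearlySpherical (hN x)).indicator
        ((hN x).measurableSet_region α)).aestronglyMeasurable
    · refine Eventually.of_forall fun ε => Eventually.of_forall fun y => ?_
      exact (norm_indicator_le_norm_self _ _).trans (hMb _ depth_mem_Icc)
    · filter_upwards [S.ae_norm_ne] with y hy
      have h := eventually_mem_region_iff S.dim_pos S.symm S.regular S.α_pos S.α_lt S.β_eq x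
        (y := y) (by rwa [← S.c_eq])
      have Tw := ProjDepth.tendsto_weight S.dim_pos S.symm S.regular S.mad_eq x y
        S.w_smooth.continuousOn
      rw [← S.c_eq] at h
      by_cases hc : ‖y‖ ≤ c
      · rw [indicator_of_mem (by exact hc)]
        refine Tw.congr' ?_
        filter_upwards [h] with ε h
        rw [indicator_of_mem (h.2 hc)]
      · rw [indicator_of_notMem (by exact hc)]
        refine tendsto_const_nhds.congr' ?_
        filter_upwards [h] with ε h
        rw [indicator_of_notMem (fun h' => hc (h.1 h'))]
  refine T.congr' ?_
  filter_upwards [hN] with ε hN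
  rw [integral_indicator ((hN x).measurableSet_region α)]

/-- The signed indicator of the change of the depth region. -/
def regionChange (F : Measure (EuclideanSpace ℝ (Fin d))) (α c ε : ℝ)
    (x y : EuclideanSpace ℝ (Fin d)) : ℝ :=
  (region med mad α (contaminate F ε x)).indicator 1 y - {y | ‖y‖ ≤ c}.indicator 1 y

theorem abs_regionChange_le (F : Measure (EuclideanSpace ℝ (Fin d))) (α c ε : ℝ)
    (x y : EuclideanSpace ℝ (Fin d)) : |regionChange F α c ε x y| ≤ 1 := by
  rw [regionChange]
  by_cases h1 : y ∈ region med mad α (contaminate F ε x) <;>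
    by_cases h2 : y ∈ {y : EuclideanSpace ℝ (Fin d) | ‖y‖ ≤ c} <;> simp [h1, h2]

/-- Both regions contain, and are contained in, balls of radius `c ± O(ε)`, so they differ only in a
thin shell around the sphere of radius `c`. -/
theorem exists_regionChange_eq_zero (S : TrimmedSetting F ν f w h0 hm m₀ α β c) :
    ∃ K > 0, ∀ᶠ ε in 𝓝[>] (0 : ℝ), ∀ x y : EuclideanSpace ℝ (Fin d),
      K * ε < |‖y‖ - c| → regionChange F α c ε x y = 0 := by
  obtain ⟨K, hK, hN⟩ := exists_nearlySpherical S.symm S.regular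
  have hβ := S.β_pos
  refine ⟨(β + 1) * K, by positivity, ?_⟩
  filter_upwards [hN, self_mem_nhdsWithin] with ε hN hε x y hy
  have hε : 0 < ε := hε
  have hp : 0 < (β + 1) * K * ε := by positivity
  have hce := S.c_eq
  rcases lt_abs.1 hy with h | h
  · have h1 : y ∉ region med mad α (contaminate F ε x) := fun h' => by
      have := (hN x).norm_le_of_mem_region S.dim_pos S.α_pos S.α_lt S.β_eq h'
      linarith
    have h2 : y ∉ {y : EuclideanSpace ℝ (Fin d) | ‖y‖ ≤ c} := fun h' => by
      have h' : ‖y‖ ≤ c := h'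
      linarith
    rw [regionChange, indicator_of_notMem h1, indicator_of_notMem h2, sub_zero]
  · have h1 : y ∈ region med mad α (contaminate F ε x) :=
      (hN x).mem_region_of_norm_le S.α_pos S.α_lt S.β_eq (by linarith)
    have h2 : y ∈ {y : EuclideanSpace ℝ (Fin d) | ‖y‖ ≤ c} := show ‖y‖ ≤ c by linarith
    rw [regionChange, indicator_of_mem h1, indicator_of_mem h2]
    simp

theorem exists_density_bound (S : TrimmedSetting F ν f w h0 hm m₀ α β c) :
    ∃ δ > 0, ∃ Mf > 0, ContinuousOn f {y | |‖y‖ - c| < δ} ∧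
      ∀ y : EuclideanSpace ℝ (Fin d), |‖y‖ - c| < δ → f y ≤ Mf := by
  obtain ⟨δ, hδ, hc⟩ := S.f_cont
  have hcomp : IsCompact {y : EuclideanSpace ℝ (Fin d) | |‖y‖ - c| ≤ δ / 2} := by
    refine Metric.isCompact_of_isClosed_isBounded
      (isClosed_le (by fun_prop) continuous_const) ?_
    refine (Metric.isBounded_closedBall (x := (0 : EuclideanSpace ℝ (Fin d)))
      (r := c + δ / 2)).subset fun y hy => ?_
    rw [mem_closedBall_zero_iff]
    have := (abs_le.1 (show |‖y‖ - c| ≤ δ / 2 from hy)).2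
    linarith
  obtain ⟨Mf, hMf⟩ := hcomp.exists_bound_of_continuousOn (hc.mono fun y hy => by
    have hy : |‖y‖ - c| ≤ δ / 2 := hy
    show |‖y‖ - c| < δ
    linarith)
  refine ⟨δ / 2, by positivity, max 1 Mf, by positivity, hc.mono fun y hy => ?_, fun y hy => ?_⟩
  · have hy : |‖y‖ - c| < δ / 2 := hy
    show |‖y‖ - c| < δ
    linarith
  · exact (le_abs_self _).trans ((hMf y hy.le).trans (le_max_right _ _))

end TrimmedSetting

end ProjDepth

end

/-! ### The contribution of the moving boundary of the region -/

noncomputable section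

namespace ProjDepth

variable {d : ℕ} {F : Measure (EuclideanSpace ℝ (Fin d))} {ν : Measure ℝ}
    {f : EuclideanSpace ℝ (Fin d) → ℝ} {w : ℝ → ℝ} {h0 hm m₀ α β c : ℝ}

namespace TrimmedSetting

theorem depth_boundary (S : TrimmedSetting F ν f w h0 hm m₀ α β c)
    {y : EuclideanSpace ℝ (Fin d)} (hy : ‖y‖ = c) : depth med mad F y = α := by
  have mp := S.regular.m₀_pos
  have ap := S.α_pos
  rw [S.depth_eq, hy, S.c_eq, mul_div_assoc, div_self mp.ne', mul_one, S.β_eq]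
  field_simp
  ring

theorem tendsto_depth_boundary (S : TrimmedSetting F ν f w h0 hm m₀ α β c)
    (x : EuclideanSpace ℝ (Fin d)) {u : EuclideanSpace ℝ (Fin d)} (hu : ‖u‖ = 1) :
    Tendsto (fun p : ℝ × ℝ => depth med mad (contaminate F p.1 x) (p.2 • u)) (𝓝[>] 0 ×ˢ 𝓝 c)
      (𝓝 α) := by
  have mp := S.regular.m₀_pos
  have cp := S.c_pos
  obtain ⟨K, hK, hD⟩ := S.exists_depth_bound
  have hcu : ‖c • u‖ = c := by rw [norm_smul, hu, mul_one, Real.norm_of_nonneg cp.le]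
  have h1 : Tendsto (fun p : ℝ × ℝ => depth med mad F (p.2 • u)) (𝓝[>] 0 ×ˢ 𝓝 c) (𝓝 α) := by
    have hc : Continuous (depth med mad F) := by
      have e : depth med mad F = fun y => 1 / (1 + ‖y‖ / m₀) := funext S.depth_eq
      rw [e]
      refine continuous_const.div (by fun_prop) fun y => ?_
      positivity
    have h2 : Tendsto (fun r : ℝ => depth med mad F (r • u)) (𝓝 c) (𝓝 (depth med mad F (c • u))) :=
      (hc.comp (by fun_prop : Continuous fun r : ℝ => r • u)).tendsto c
    rw [S.depth_boundary hcu] at h2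
    exact h2.comp tendsto_snd
  have h2 : Tendsto (fun p : ℝ × ℝ => K * p.1 * (m₀ + ‖p.2 • u‖)) (𝓝[>] 0 ×ˢ 𝓝 c) (𝓝 0) := by
    have ha : Tendsto (fun p : ℝ × ℝ => K * p.1) (𝓝[>] 0 ×ˢ 𝓝 c) (𝓝 0) :=
      (tendsto_const_mul_zero K).comp tendsto_fst
    have hb : Tendsto (fun p : ℝ × ℝ => m₀ + ‖p.2 • u‖) (𝓝[>] 0 ×ˢ 𝓝 c) (𝓝 (m₀ + ‖c • u‖)) :=
      ((by fun_prop : Continuous fun r : ℝ => m₀ + ‖r • u‖).tendsto c).comp tendsto_snd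
    simpa using ha.mul hb
  have h3 : Tendsto (fun p : ℝ × ℝ => depth med mad (contaminate F p.1 x) (p.2 • u)
      - depth med mad F (p.2 • u)) (𝓝[>] 0 ×ˢ 𝓝 c) (𝓝 0) := by
    refine squeeze_zero_norm' ?_ h2
    filter_upwards [tendsto_fst.eventually hD] with p hp
    exact hp x _
  have := h3.add h1
  simpa using this

/-- The radial part of the integrand of the trimmed mean. -/
def radialIntegrand (F : Measure (EuclideanSpace ℝ (Fin d))) (f : EuclideanSpace ℝ (Fin d) → ℝ)
    (w : ℝ → ℝ) (x u : EuclideanSpace ℝ (Fin d)) (ε r : ℝ) : EuclideanSpace ℝ (Fin d) :=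
  (r ^ (d - 1) * f (r • u) * w (depth med mad (contaminate F ε x) (r • u)) * r) • u

theorem measurable_radialIntegrand (S : TrimmedSetting F ν f w h0 hm m₀ α β c)
    {x : EuclideanSpace ℝ (Fin d)} {ε e : ℝ}
    (N : NearlySpherical med mad (contaminate F ε x) m₀ e) (u : EuclideanSpace ℝ (Fin d)) :
    Measurable (radialIntegrand F f w x u ε) := by
  have hr : Measurable fun r : ℝ => r • u := by fun_prop
  have h1 := S.measurable_f.comp hr
  have h2 := (S.measurable_weight_of_nearlySpherical N).comp hr
  exact ((((measurable_id.pow_const _).mul h1).mul h2).mul measurable_id).smul_const u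

theorem tendsto_radialIntegrand (S : TrimmedSetting F ν f w h0 hm m₀ α β c)
    (x : EuclideanSpace ℝ (Fin d)) {u : EuclideanSpace ℝ (Fin d)} (hu : ‖u‖ = 1) :
    Tendsto (fun p : ℝ × ℝ => radialIntegrand F f w x u p.1 p.2) (𝓝[>] 0 ×ˢ 𝓝 c)
      (𝓝 ((c ^ (d - 1) * f (c • u) * w α * c) • u)) := by
  have cp := S.c_pos
  obtain ⟨δ, hδ, Mf, hMf, hfc, -⟩ := S.exists_density_bound
  have hcu : ‖c • u‖ = c := by rw [norm_smul, hu, mul_one, Real.norm_of_nonneg cp.le]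
  have hf : ContinuousAt f (c • u) := by
    refine hfc.continuousAt ((isOpen_lt (by fun_prop) continuous_const).mem_nhds ?_)
    show |‖c • u‖ - c| < δ
    rwa [hcu, sub_self, abs_zero]
  have h1 : Tendsto (fun p : ℝ × ℝ => f (p.2 • u)) (𝓝[>] 0 ×ˢ 𝓝 c) (𝓝 (f (c • u))) :=
    (hf.tendsto.comp ((by fun_prop : Continuous fun r : ℝ => r • u).tendsto c)).comp tendsto_snd
  have hαI : α ∈ Icc (0 : ℝ) 1 := ⟨S.α_pos.le, S.α_lt.le⟩
  have h2 : Tendsto (fun p : ℝ × ℝ => w (depth med mad (contaminate F p.1 x) (p.2 • u)))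
      (𝓝[>] 0 ×ˢ 𝓝 c) (𝓝 (w α)) :=
    (S.w_smooth.continuousOn _ hαI).tendsto.comp (tendsto_nhdsWithin_iff.2
      ⟨S.tendsto_depth_boundary x hu, Eventually.of_forall fun _ => depth_mem_Icc⟩)
  have h3 : Tendsto (fun p : ℝ × ℝ => p.2) (𝓝[>] (0 : ℝ) ×ˢ 𝓝 c) (𝓝 c) := tendsto_snd
  exact ((((h3.pow (d - 1)).mul h1).mul h2).mul h3).smul_const u

theorem norm_radialIntegrand_le (S : TrimmedSetting F ν f w h0 hm m₀ α β c) :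
    ∃ δ > 0, δ ≤ 1 ∧ δ < c ∧ ∃ C > 0, ∀ x u : EuclideanSpace ℝ (Fin d), ‖u‖ = 1 → ∀ ε r : ℝ, |r - c| < δ →
      ‖radialIntegrand F f w x u ε r‖ ≤ C := by
  have cp := S.c_pos
  obtain ⟨δ, hδ, Mf, hMf, -, hfb⟩ := S.exists_density_bound
  obtain ⟨M, hM, hMb, -, -⟩ := exists_weight_bounds S.w_smooth
  refine ⟨min δ (min 1 (c / 2)), by positivity, (min_le_right _ _).trans (min_le_left _ _),
    ((min_le_right _ _).trans (min_le_right _ _)).trans_lt (by linarith),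
    (c + 1) ^ (d - 1) * Mf * M * (c + 1), by positivity, fun x u hu ε r hr => ?_⟩
  have r1 : |r - c| < 1 := hr.trans_le ((min_le_right _ _).trans (min_le_left _ _))
  have r2 : |r - c| < c / 2 := hr.trans_le ((min_le_right _ _).trans (min_le_right _ _))
  have r1 := abs_lt.1 r1
  have r2 := abs_lt.1 r2
  have rp : 0 < r := by linarith
  have hru : ‖r • u‖ = r := by rw [norm_smul, hu, mul_one, Real.norm_of_nonneg rp.le]
  rw [radialIntegrand, norm_smul, hu, mul_one, norm_mul, norm_mul, norm_mul, norm_pow,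
    Real.norm_of_nonneg rp.le, Real.norm_of_nonneg (S.f_nonneg _)]
  have := S.f_nonneg (r • u)
  gcongr
  · linarith
  · exact hfb _ (by rw [hru]; exact hr.trans_le (min_le_left _ _))
  · exact hMb _ depth_mem_Icc
  · linarith

theorem indicator_one_congr {X Y : Type*} {A : Set X} {B : Set Y} {x : X} {y : Y}
    (h : x ∈ A ↔ y ∈ B) : B.indicator (1 : Y → ℝ) y = A.indicator (1 : X → ℝ) x := by
  by_cases hx : x ∈ A
  · rw [indicator_of_mem hx, indicator_of_mem (h.1 hx), Pi.one_apply, Pi.one_apply]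
  · rw [indicator_of_notMem hx, indicator_of_notMem (fun hy => hx (h.2 hy))]

/-- On a stable ray the change of region is the signed indicator of the interval between `c` and the
new radius, whose length has derivative `radiusInfluence`; the integrand converges jointly in `ε`
and `r` at `(0, c)`. -/
theorem tendsto_radial_integral (S : TrimmedSetting F ν f w h0 hm m₀ α β c)
    {x u : EuclideanSpace ℝ (Fin d)} (hu : ‖u‖ = 1) (hs : StableDirection F x u) :
    Tendsto (fun ε => ε⁻¹ • ∫ r in Ioi (0 : ℝ),
        regionChange F α c ε x (r • u) • radialIntegrand F f w x u ε r) (𝓝[>] 0)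
      (𝓝 ((c * w α * f (c • u) * c ^ (d - 1) *
        radiusInfluence h0 hm m₀ β (inner ℝ u x)) • u)) := by
  have cp := S.c_pos
  have mp := S.regular.m₀_pos
  have bp := S.β_pos
  set Rr : ℝ → ℝ := fun ε => β * mad (mix ν ε (inner ℝ u x)) + med (mix ν ε (inner ℝ u x)) with hRr
  have hR : Tendsto (fun ε => ε⁻¹ * (Rr ε - c)) (𝓝[>] 0)
      (𝓝 (radiusInfluence h0 hm m₀ β (inner ℝ u x))) := by
    rw [S.c_eq]; exact tendsto_radiusInfluence S.regular β _
  obtain ⟨δ, hδ, -, hδc, C, hC, hCb⟩ := S.norm_radialIntegrand_le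
  obtain ⟨K, hK, hb⟩ := S.regular.expansion.bound
  obtain ⟨K', hK', hN⟩ := exists_nearlySpherical S.symm S.regular
  have hRc : ∀ᶠ ε in 𝓝[>] (0 : ℝ), |Rr ε - c| < δ := by
    have small := (tendsto_const_mul_zero ((β + 1) * K)).eventually (gt_mem_nhds hδ)
    filter_upwards [hb, small] with ε hb hsm
    obtain ⟨b1, b2⟩ := hb (inner ℝ u x)
    have e : Rr ε - c = β * (mad (mix ν ε (inner ℝ u x)) - m₀) + med (mix ν ε (inner ℝ u x)) := by
      rw [hRr, S.c_eq]; ring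
    rw [e]
    refine (abs_add_le _ _).trans_lt ?_
    rw [abs_mul, abs_of_pos bp]
    have : β * |mad (mix ν ε (inner ℝ u x)) - m₀| ≤ β * (K * ε) := by gcongr
    linarith
  have T := tendsto_shrinking_integral (g := radialIntegrand F f w x u) hR
    (S.tendsto_radialIntegrand x hu) (by
      filter_upwards [hRc, hN] with ε h1 hN
      rw [intervalIntegrable_iff]
      refine Measure.integrableOn_of_bounded (M := C) (by rw [uIoc]; exact measure_Ioc_lt_top.ne)
        (S.measurable_radialIntegrand (hN x) u).aestronglyMeasurable ?_
      filter_upwards [ae_restrict_mem measurableSet_uIoc] with r hr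
      exact hCb x u hu ε r
        ((abs_sub_left_of_mem_uIcc (uIoc_subset_uIcc hr)).trans_lt h1))
  rw [smul_smul] at T
  have e : radiusInfluence h0 hm m₀ β (inner ℝ u x) * (c ^ (d - 1) * f (c • u) * w α * c)
      = c * w α * f (c • u) * c ^ (d - 1) * radiusInfluence h0 hm m₀ β (inner ℝ u x) := by ring
  rw [e] at T
  refine T.congr' ?_
  filter_upwards [hRc, hs.smul_mem_region_iff S.symm S.regular hu S.α_pos S.α_lt S.β_eq]
    with ε h1 h2
  have h1 := abs_lt.1 h1
  rw [← integral_Ioi_indicator_sub cp (show 0 < Rr ε by linarith)]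
  congr 1
  refine setIntegral_congr_fun measurableSet_Ioi fun r hr => ?_
  have hr : 0 < r := hr
  refine congrArg (fun t : ℝ => t • radialIntegrand F f w x u ε r) ?_
  rw [regionChange]
  have e1 : r • u ∈ region med mad α (contaminate F ε x) ↔ r ∈ Iic (Rr ε) := h2 r hr.le
  have e2 : r • u ∈ {y : EuclideanSpace ℝ (Fin d) | ‖y‖ ≤ c} ↔ r ∈ Iic c := by
    show ‖r • u‖ ≤ c ↔ r ≤ c
    rw [norm_smul, hu, mul_one, Real.norm_of_nonneg hr.le]
  rw [indicator_one_congr e1, indicator_one_congr e2]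

theorem integral_regionChange (S : TrimmedSetting F ν f w h0 hm m₀ α β c)
    (x : EuclideanSpace ℝ (Fin d)) : ∀ᶠ ε in 𝓝[>] (0 : ℝ),
    Integrable (fun y => regionChange F α c ε x y •
        (w (depth med mad (contaminate F ε x) y) • y)) F ∧
      Integrable (fun u : Metric.sphere (0 : EuclideanSpace ℝ (Fin d)) 1 =>
        ∫ r in Ioi (0 : ℝ), regionChange F α c ε x (r • (u : EuclideanSpace ℝ (Fin d))) •
          radialIntegrand F f w x u ε r) (volume : Measure (EuclideanSpace ℝ (Fin d))).toSphere ∧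
      ∫ y, regionChange F α c ε x y • (w (depth med mad (contaminate F ε x) y) • y) ∂F
        = ∫ u : Metric.sphere (0 : EuclideanSpace ℝ (Fin d)) 1,
          (∫ r in Ioi (0 : ℝ), regionChange F α c ε x (r • (u : EuclideanSpace ℝ (Fin d))) •
          radialIntegrand F f w x u ε r) ∂(volume : Measure (EuclideanSpace ℝ (Fin d))).toSphere := by
  have := S.prob
  have cp := S.c_pos
  obtain ⟨K', hK', hN⟩ := exists_nearlySpherical S.symm S.regular
  obtain ⟨K, hK, hZ⟩ := S.exists_regionChange_eq_zero
  obtain ⟨M, hM, hMb, -, -⟩ := exists_weight_bounds S.w_smooth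
  filter_upwards [hN, hZ, (tendsto_const_mul_zero K).eventually (gt_mem_nhds one_pos)]
    with ε hN hZ hsm
  set H : EuclideanSpace ℝ (Fin d) → EuclideanSpace ℝ (Fin d) := fun y =>
    regionChange F α c ε x y • (w (depth med mad (contaminate F ε x) y) • y) with hH
  have hHm : Measurable H := by
    have h1 : Measurable (regionChange F α c ε x) :=
      (measurable_one.indicator ((hN x).measurableSet_region α)).sub
        (measurable_one.indicator measurableSet_ball)
    exact h1.smul ((S.measurable_weight_of_nearlySpherical (hN x)).smul measurable_id)
  have hHi : Integrable H F := by
    refine Integrable.of_bound hHm.aestronglyMeasurable (M * (c + 1))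
      (Eventually.of_forall fun y => ?_)
    rcases lt_or_ge (K * ε) |‖y‖ - c| with h | h
    · rw [hH]
      simp only [hZ x y h, zero_smul, norm_zero]
      positivity
    · have hy := (abs_le.1 h).2
      rw [hH]
      simp only [norm_smul, Real.norm_eq_abs]
      calc _ ≤ 1 * (M * (c + 1)) := by
            gcongr
            · exact abs_regionChange_le F α c ε x y
            · exact hMb _ depth_mem_Icc
            · linarith
        _ = _ := one_mul _
  have hfm : Measurable fun y => ENNReal.ofReal (f y) := S.measurable_f.ennreal_ofReal
  have hint : Integrable (fun y => f y • H y) := by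
    have h := hHi
    rw [S.density, integrable_withDensity_iff_integrable_smul' hfm
      (Eventually.of_forall fun _ => ENNReal.ofReal_lt_top)] at h
    refine h.congr (Eventually.of_forall fun y => ?_)
    simp only [ENNReal.toReal_ofReal (S.f_nonneg y)]
  have heq : ∫ y, H y ∂F = ∫ y, f y • H y := by
    conv_lhs => rw [S.density]
    rw [integral_withDensity_eq_integral_toReal_smul hfm
      (Eventually.of_forall fun _ => ENNReal.ofReal_lt_top)]
    refine integral_congr_ae (Eventually.of_forall fun y => ?_)
    simp only [ENNReal.toReal_ofReal (S.f_nonneg y)]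
  obtain ⟨P1, P2⟩ := integrable_and_integral_polar S.dim_pos hint
  have hpt : ∀ u : Metric.sphere (0 : EuclideanSpace ℝ (Fin d)) 1, ∀ r : ℝ,
      r ^ (d - 1) • (f (r • (u : EuclideanSpace ℝ (Fin d))) • H (r • (u : EuclideanSpace ℝ (Fin d))))
      = regionChange F α c ε x (r • (u : EuclideanSpace ℝ (Fin d))) •
          radialIntegrand F f w x u ε r := by
    intro u r
    rw [hH, radialIntegrand]
    simp only [smul_smul]
    congr 1
    ring
  simp only [hpt] at P1 P2
  exact ⟨hHi, P1, heq.trans P2⟩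

theorem tendsto_integral_regionChange (S : TrimmedSetting F ν f w h0 hm m₀ α β c)
    (x : EuclideanSpace ℝ (Fin d)) :
    Tendsto (fun ε => ε⁻¹ • ∫ y, regionChange F α c ε x y •
        (w (depth med mad (contaminate F ε x) y) • y) ∂F) (𝓝[>] 0)
      (𝓝 (∫ u : Metric.sphere (0 : EuclideanSpace ℝ (Fin d)) 1,
        (c * w α * f (c • (u : EuclideanSpace ℝ (Fin d))) * c ^ (d - 1) *
        radiusInfluence h0 hm m₀ β (inner ℝ (u : EuclideanSpace ℝ (Fin d)) x)) •
          (u : EuclideanSpace ℝ (Fin d)) ∂(volume : Measure (EuclideanSpace ℝ (Fin d))).toSphere)) := by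
  have cp := S.c_pos
  have hI := S.integral_regionChange x
  obtain ⟨K, hK, hZ⟩ := S.exists_regionChange_eq_zero
  obtain ⟨δ, hδ, -, hδc, C, hC, hCb⟩ := S.norm_radialIntegrand_le
  have hunit : ∀ u : Metric.sphere (0 : EuclideanSpace ℝ (Fin d)) 1,
      ‖(u : EuclideanSpace ℝ (Fin d))‖ = 1 := fun u => by simp
  have T : Tendsto (fun ε => ∫ u : Metric.sphere (0 : EuclideanSpace ℝ (Fin d)) 1,
      (ε⁻¹ • ∫ r in Ioi (0 : ℝ), regionChange F α c ε x (r • (u : EuclideanSpace ℝ (Fin d))) •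
          radialIntegrand F f w x u ε r) ∂(volume : Measure (EuclideanSpace ℝ (Fin d))).toSphere)
      (𝓝[>] 0) (𝓝 (∫ u : Metric.sphere (0 : EuclideanSpace ℝ (Fin d)) 1,
        (c * w α * f (c • (u : EuclideanSpace ℝ (Fin d))) * c ^ (d - 1) *
        radiusInfluence h0 hm m₀ β (inner ℝ (u : EuclideanSpace ℝ (Fin d)) x)) •
          (u : EuclideanSpace ℝ (Fin d)) ∂(volume : Measure (EuclideanSpace ℝ (Fin d))).toSphere)) := by
    -- Along each ray the integrand is at most `C` and lives on an interval of length `2 * K * ε`;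
    -- this dominates in every direction, stable or not.
    refine tendsto_integral_filter_of_dominated_convergence (fun _ => 2 * K * C) ?_ ?_
      (integrable_const _) ?_
    · filter_upwards [hI] with ε hI
      exact (hI.2.1.smul ε⁻¹).aestronglyMeasurable
    · filter_upwards [hZ, self_mem_nhdsWithin,
        (tendsto_const_mul_zero K).eventually (gt_mem_nhds hδ)] with ε hZ hε hsm
      have hε : 0 < ε := hε
      refine Eventually.of_forall fun u => ?_
      have hle : ‖∫ r in Ioi (0 : ℝ), regionChange F α c ε x (r • (u : EuclideanSpace ℝ (Fin d))) •
          radialIntegrand F f w x u ε r‖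
          ≤ ∫ r in Ioi (0 : ℝ), (Icc (c - K * ε) (c + K * ε)).indicator (fun _ => C) r := by
        refine norm_integral_le_of_norm_le ?_ ?_
        · refine Integrable.integrableOn ?_
          exact (integrable_indicator_iff measurableSet_Icc).2
            (integrableOn_const (by exact measure_Icc_lt_top.ne))
        · filter_upwards [ae_restrict_mem measurableSet_Ioi] with r hr
          have hr : 0 < r := hr
          have hru : ‖r • (u : EuclideanSpace ℝ (Fin d))‖ = r := by
            rw [norm_smul, hunit u, mul_one, Real.norm_of_nonneg hr.le]
          by_cases hrI : r ∈ Icc (c - K * ε) (c + K * ε)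
          · rw [indicator_of_mem hrI, norm_smul]
            have hrc : |r - c| < δ := by
              rw [abs_lt]; constructor <;> linarith [hrI.1, hrI.2]
            calc _ ≤ 1 * C := by
                  gcongr
                  · exact abs_regionChange_le F α c ε x _
                  · exact hCb x u (hunit u) ε r hrc
              _ = C := one_mul _
          · rw [indicator_of_notMem hrI, hZ x _ (by
              rw [hru]
              by_contra! h
              have := abs_le.1 h
              exact hrI ⟨by linarith, by linarith⟩), zero_smul, norm_zero]
      have hval : ∫ r in Ioi (0 : ℝ), (Icc (c - K * ε) (c + K * ε)).indicator (fun _ => C) r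
          = 2 * K * ε * C := by
        rw [setIntegral_indicator measurableSet_Icc, inter_eq_self_of_subset_right
          (show Icc (c - K * ε) (c + K * ε) ⊆ Ioi 0 from fun r hr => by
            have := hr.1
            show 0 < r
            linarith), setIntegral_const, Real.volume_real_Icc_of_le (by
              have : 0 < K * ε := by positivity
              linarith), smul_eq_mul]
        ring
      rw [hval] at hle
      rw [norm_smul, Real.norm_of_nonneg (inv_pos.2 hε).le]
      calc _ ≤ ε⁻¹ * (2 * K * ε * C) := by gcongr
        _ = 2 * K * C := by field_simp
    · filter_upwards [ae_toSphere_stableDirection S.dim_pos S.symm S.regular x] with u hu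
      exact S.tendsto_radial_integral (hunit u) hu
  refine T.congr' ?_
  filter_upwards [hI] with ε hI
  rw [hI.2.2, integral_smul]

end TrimmedSetting

end ProjDepth

end

/-! ### Symmetry reductions, the influence function of the trimmed mean, and its bound -/

noncomputable section

namespace ProjDepth

variable {d : ℕ} {F : Measure (EuclideanSpace ℝ (Fin d))} {ν : Measure ℝ}
    {f : EuclideanSpace ℝ (Fin d) → ℝ} {w : ℝ → ℝ} {h0 hm m₀ α β c : ℝ}

theorem abs_sign_le (s : ℝ) : |Real.sign s| ≤ 1 := by
  rcases Real.sign_apply_eq s with h | h | h <;> rw [h] <;> norm_num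

theorem sign_mul_self_eq_abs (s : ℝ) : Real.sign s * s = |s| := by
  rcases lt_trichotomy s 0 with h | h | h
  · rw [Real.sign_of_neg h, abs_of_neg h]; ring
  · simp [h]
  · rw [Real.sign_of_pos h, abs_of_pos h]; ring

theorem sign_mul_of_pos {r : ℝ} (hr : 0 < r) (s : ℝ) : Real.sign (r * s) = Real.sign s := by
  rcases lt_trichotomy s 0 with h | h | h
  · rw [Real.sign_of_neg h, Real.sign_of_neg (mul_neg_of_pos_of_neg hr h)]
  · simp [h]
  · rw [Real.sign_of_pos h, Real.sign_of_pos (mul_pos hr h)]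

namespace TrimmedSetting

/-- The integral of an odd function over a ball vanishes. -/
theorem setIntegral_odd (S : TrimmedSetting F ν f w h0 hm m₀ α β c) {V : Type*}
    [NormedAddCommGroup V] [NormedSpace ℝ V] {g : EuclideanSpace ℝ (Fin d) → V}
    (hg : ∀ y, g (-y) = -g y) (r : ℝ) : ∫ y in {y | ‖y‖ ≤ r}, g y ∂F = 0 := by
  have := S.prob
  have h := S.symm.setIntegral_comp_isometry (LinearIsometryEquiv.neg ℝ) g r
  simp only [LinearIsometryEquiv.coe_neg, hg, integral_neg] at h
  have h2 : (2 : ℝ) • ∫ y in {y | ‖y‖ ≤ r}, g y ∂F = 0 := by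
    rw [two_smul]
    nth_rw 1 [← h]
    exact neg_add_cancel _
  exact (smul_eq_zero.1 h2).resolve_left two_ne_zero

theorem map_setIntegral_of_equivariant (S : TrimmedSetting F ν f w h0 hm m₀ α β c)
    (L : EuclideanSpace ℝ (Fin d) ≃ₗᵢ[ℝ] EuclideanSpace ℝ (Fin d))
    {g : EuclideanSpace ℝ (Fin d) → EuclideanSpace ℝ (Fin d)} (hg : ∀ y, g (L y) = L (g y))
    (r : ℝ) : L (∫ y in {y | ‖y‖ ≤ r}, g y ∂F) = ∫ y in {y | ‖y‖ ≤ r}, g y ∂F := by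
  have := S.prob
  have h := S.symm.setIntegral_comp_isometry L g r
  simp only [hg] at h
  rw [← h]
  nth_rw 1 [h]
  exact (L.toContinuousLinearEquiv.integral_comp_comm g).symm

/-- The radial derivative of the weight. -/
def radialDeriv (w : ℝ → ℝ) (m₀ r : ℝ) : ℝ :=
  derivWithin w (Icc 0 1) (1 / (1 + r / m₀)) * ((1 + r / m₀) ^ 2)⁻¹

theorem inv_mem_Icc {a : ℝ} (ha : 0 ≤ a) : 1 / (1 + a) ∈ Icc (0 : ℝ) 1 := by
  refine ⟨by positivity, ?_⟩
  rw [div_le_one (by positivity)]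
  linarith

theorem measurable_radialDeriv (S : TrimmedSetting F ν f w h0 hm m₀ α β c) :
    Measurable fun y : EuclideanSpace ℝ (Fin d) => radialDeriv w m₀ ‖y‖ := by
  have mp := S.regular.m₀_pos
  refine Measurable.mul ?_ (by fun_prop)
  exact measurable_weight_comp
    (S.w_smooth.continuousOn_derivWithin (uniqueDiffOn_Icc zero_lt_one) le_rfl) (by fun_prop)
    fun y => inv_mem_Icc (by positivity)

theorem exists_radialDeriv_bound (S : TrimmedSetting F ν f w h0 hm m₀ α β c) :
    ∃ M > 0, ∀ y : EuclideanSpace ℝ (Fin d), |radialDeriv w m₀ ‖y‖| ≤ M := by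
  have mp := S.regular.m₀_pos
  obtain ⟨M, hM, -, hMb, -⟩ := exists_weight_bounds S.w_smooth
  refine ⟨M, hM, fun y => ?_⟩
  rw [radialDeriv, abs_mul]
  calc _ ≤ M * 1 := by
        gcongr
        · exact hMb _ (inv_mem_Icc (by positivity))
        · rw [abs_of_nonneg (by positivity)]
          refine inv_le_one_of_one_le₀ ?_
          have : 0 ≤ ‖y‖ / m₀ := by positivity
          nlinarith
    _ = M := mul_one M

theorem integrableOn_smul_id (S : TrimmedSetting F ν f w h0 hm m₀ α β c)
    {g : EuclideanSpace ℝ (Fin d) → ℝ} (hg : Measurable g) {M : ℝ}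
    (hb : ∀ y, ‖y‖ ≤ c → |g y| ≤ M) : IntegrableOn (fun y => g y • y) {y | ‖y‖ ≤ c} F := by
  have := S.prob
  refine Measure.integrableOn_of_bounded (M := M * c) (measure_ne_top _ _)
    (hg.smul measurable_id).aestronglyMeasurable ?_
  filter_upwards [ae_restrict_mem measurableSet_ball] with y hy
  have hy : ‖y‖ ≤ c := hy
  rw [norm_smul]
  exact mul_le_mul (hb y hy) hy (norm_nonneg _) ((abs_nonneg _).trans (hb y hy))

/-- The integrand is equivariant under isometries fixing `x`. The reflection in the line of `x`
therefore fixes the integral, which must lie on that line; its component along `x` does not depend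
on the direction of `x` and may be computed along the first axis. -/
theorem integral_radialDeriv_sign (S : TrimmedSetting F ν f w h0 hm m₀ α β c)
    (x : EuclideanSpace ℝ (Fin d)) :
    ∫ y in {y | ‖y‖ ≤ c}, (radialDeriv w m₀ ‖y‖ * Real.sign (inner ℝ y x)) • y ∂F
      = ((∫ y in {y | ‖y‖ ≤ c}, radialDeriv w m₀ ‖y‖ * |y ⟨0, S.dim_pos⟩| ∂F) / ‖x‖) • x := by
  have := S.prob
  obtain ⟨M, hM, hMb⟩ := S.exists_radialDeriv_bound
  by_cases hx : x = 0
  · subst hx; simp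
  have hn : 0 < ‖x‖ := norm_pos_iff.2 hx
  set V := ∫ y in {y | ‖y‖ ≤ c}, (radialDeriv w m₀ ‖y‖ * Real.sign (inner ℝ y x)) • y ∂F with hV
  have hint : IntegrableOn (fun y => (radialDeriv w m₀ ‖y‖ * Real.sign (inner ℝ y x)) • y)
      {y | ‖y‖ ≤ c} F := by
    refine S.integrableOn_smul_id (M := M * 1)
      (S.measurable_radialDeriv.mul (measurable_sign.comp (by fun_prop))) fun y _ => ?_
    rw [abs_mul]
    exact mul_le_mul (hMb y) (abs_sign_le _) (abs_nonneg _) hM.le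
  set e : EuclideanSpace ℝ (Fin d) := ‖x‖⁻¹ • x with he
  have hen : ‖e‖ = 1 := by simp [he, norm_smul, hn.ne']
  -- the reflection in the line of `x` fixes `V`
  have hfix : (Submodule.span ℝ {x}).reflection V = V := by
    have hrx : (Submodule.span ℝ {x}).reflection x = x :=
      Submodule.reflection_mem_subspace_eq_self (Submodule.mem_span_singleton_self x)
    rw [hV]
    generalize (Submodule.span ℝ {x}).reflection = L at hrx ⊢
    refine S.map_setIntegral_of_equivariant L (fun y => ?_) c
    have h2 : inner ℝ (L y) x = (inner ℝ y x : ℝ) := by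
      conv_lhs => rw [← hrx]
      exact L.inner_map_map _ _
    rw [map_smul, L.norm_map, h2]
  have hmem : V ∈ Submodule.span ℝ {x} := Submodule.reflection_eq_self_iff V |>.1 hfix
  obtain ⟨a, ha⟩ := Submodule.mem_span_singleton.1 hmem
  -- the component of `V` along `x`
  have hcomp : inner ℝ e V = ∫ y in {y | ‖y‖ ≤ c}, radialDeriv w m₀ ‖y‖ * |inner ℝ y e| ∂F := by
    rw [hV, ← integral_inner hint]
    refine integral_congr_ae (Eventually.of_forall fun y => ?_)
    simp only
    have hs : Real.sign (inner ℝ y x) = Real.sign (inner ℝ y e) := by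
      rw [he, real_inner_smul_right, sign_mul_of_pos (inv_pos.2 hn)]
    rw [real_inner_smul_right, real_inner_comm y e, mul_assoc, hs, sign_mul_self_eq_abs]
  set e0 : EuclideanSpace ℝ (Fin d) := EuclideanSpace.single ⟨0, S.dim_pos⟩ 1 with he0
  have he0n : ‖e0‖ = 1 := by simp [he0]
  have hrot : ∫ y in {y | ‖y‖ ≤ c}, radialDeriv w m₀ ‖y‖ * |inner ℝ y e| ∂F
      = ∫ y in {y | ‖y‖ ≤ c}, radialDeriv w m₀ ‖y‖ * |y ⟨0, S.dim_pos⟩| ∂F := by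
    -- The reflection in the hyperplane orthogonal to `e - e0` exchanges two vectors of equal norm.
    have hL : (Submodule.span ℝ {e - e0})ᗮ.reflection e = e0 :=
      Submodule.reflection_sub (by rw [hen, he0n])
    generalize (Submodule.span ℝ {e - e0})ᗮ.reflection = L at hL
    have h1 := S.symm.setIntegral_comp_isometry L
      (fun y => radialDeriv w m₀ ‖y‖ * |inner ℝ y e0|) c
    have h2 : ∀ y, inner ℝ (L y) e0 = (inner ℝ y e : ℝ) := fun y => by
      rw [← hL]
      exact L.inner_map_map _ _
    simp only [L.norm_map, h2] at h1
    rw [h1]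
    refine integral_congr_ae (Eventually.of_forall fun y => ?_)
    simp [he0, EuclideanSpace.inner_single_right]
  rw [← hrot, ← hcomp, ← ha, inner_smul_right, he, real_inner_smul_left,
    real_inner_self_eq_norm_sq]
  congr 1
  field_simp

/-- The influence of the MAD is even in the direction, so its part of the integrand is odd in `y`
and integrates to zero; only the sign term from the median survives. -/
theorem integral_weightInfluence (S : TrimmedSetting F ν f w h0 hm m₀ α β c)
    (x : EuclideanSpace ℝ (Fin d)) :
    ∫ y in {y | ‖y‖ ≤ c}, weightInfluence w h0 hm m₀ ‖y‖ (inner ℝ (‖y‖⁻¹ • y) x) • y ∂F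
      = ((∫ y in {y | ‖y‖ ≤ c}, radialDeriv w m₀ ‖y‖ * |y ⟨0, S.dim_pos⟩| ∂F)
        / (2 * h0 * m₀) / ‖x‖) • x := by
  have := S.prob
  have mp := S.regular.m₀_pos
  have h0p := S.regular.h0_pos
  have hmp := S.regular.hm_pos
  obtain ⟨M, hM, hMb⟩ := S.exists_radialDeriv_bound
  have hsplit : ∀ y : EuclideanSpace ℝ (Fin d), y ≠ 0 →
      weightInfluence w h0 hm m₀ ‖y‖ (inner ℝ (‖y‖⁻¹ • y) x) • y
      = (2 * h0 * m₀)⁻¹ • ((radialDeriv w m₀ ‖y‖ * Real.sign (inner ℝ y x)) • y)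
        + (radialDeriv w m₀ ‖y‖ * (‖y‖ * madInfluence h0 hm m₀ (inner ℝ (‖y‖⁻¹ • y) x) / m₀ ^ 2))
          • y := by
    intro y hy
    rw [weightInfluence, real_inner_smul_left, sign_mul_of_pos (inv_pos.2 (norm_pos_iff.2 hy)),
      smul_smul, ← add_smul]
    congr 1
    rw [radialDeriv]
    field_simp
  have i1 : IntegrableOn (fun y => (radialDeriv w m₀ ‖y‖ * Real.sign (inner ℝ y x)) • y)
      {y | ‖y‖ ≤ c} F := by
    refine S.integrableOn_smul_id (M := M * 1)
      (S.measurable_radialDeriv.mul (measurable_sign.comp (by fun_prop))) fun y _ => ?_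
    rw [abs_mul]
    exact mul_le_mul (hMb y) (abs_sign_le _) (abs_nonneg _) hM.le
  have i2 : IntegrableOn (fun y => (radialDeriv w m₀ ‖y‖ *
      (‖y‖ * madInfluence h0 hm m₀ (inner ℝ (‖y‖⁻¹ • y) x) / m₀ ^ 2)) • y) {y | ‖y‖ ≤ c} F := by
    refine S.integrableOn_smul_id (M := M * (c * (1 / (4 * hm)) / m₀ ^ 2))
      (S.measurable_radialDeriv.mul ((measurable_norm.mul ((measurable_madInfluence h0 hm m₀).comp
        (Measurable.inner (by fun_prop) measurable_const))).div_const _)) fun y hy => ?_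
    rw [abs_mul, abs_div, abs_mul, abs_norm, abs_of_pos (show 0 < m₀ ^ 2 by positivity)]
    have := abs_madInfluence_le (h0 := h0) hmp m₀ (inner ℝ (‖y‖⁻¹ • y) x)
    have := hMb y
    have := S.c_pos
    gcongr
  have hodd : ∫ y in {y | ‖y‖ ≤ c}, (radialDeriv w m₀ ‖y‖ *
      (‖y‖ * madInfluence h0 hm m₀ (inner ℝ (‖y‖⁻¹ • y) x) / m₀ ^ 2)) • y ∂F = 0 := by
    refine S.setIntegral_odd (fun y => ?_) c
    rw [norm_neg, smul_neg, smul_neg, inner_neg_left, madInfluence_neg]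
  have hae : ∫ y in {y | ‖y‖ ≤ c}, weightInfluence w h0 hm m₀ ‖y‖ (inner ℝ (‖y‖⁻¹ • y) x) • y ∂F
      = ∫ y in {y | ‖y‖ ≤ c}, ((2 * h0 * m₀)⁻¹ •
          ((radialDeriv w m₀ ‖y‖ * Real.sign (inner ℝ y x)) • y)
        + (radialDeriv w m₀ ‖y‖ * (‖y‖ * madInfluence h0 hm m₀ (inner ℝ (‖y‖⁻¹ • y) x) / m₀ ^ 2))
          • y) ∂F := by
    refine integral_congr_ae ?_
    filter_upwards [ae_restrict_of_ae S.ae_ne_zero] with y hy using hsplit y hy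
  have i1' : IntegrableOn (fun y => (2 * h0 * m₀)⁻¹ •
      ((radialDeriv w m₀ ‖y‖ * Real.sign (inner ℝ y x)) • y)) {y | ‖y‖ ≤ c} F :=
    i1.fun_smul _
  rw [hae, integral_add i1' i2, hodd, add_zero, integral_smul,
    S.integral_radialDeriv_sign x, smul_smul]
  congr 1
  field_simp

theorem integrableOn_weight_smul (S : TrimmedSetting F ν f w h0 hm m₀ α β c)
    {F' : Measure (EuclideanSpace ℝ (Fin d))} {e : ℝ} (N : NearlySpherical med mad F' m₀ e) :
    IntegrableOn (fun y => w (depth med mad F' y) • y) {y | ‖y‖ ≤ c} F := by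
  obtain ⟨M, hM, hMb, -, -⟩ := exists_weight_bounds S.w_smooth
  exact S.integrableOn_smul_id (S.measurable_weight_of_nearlySpherical N)
    fun y _ => hMb _ depth_mem_Icc

theorem setIntegral_weight_smul (S : TrimmedSetting F ν f w h0 hm m₀ α β c) :
    ∫ y in {y | ‖y‖ ≤ c}, w (depth med mad F y) • y ∂F = 0 := by
  refine S.setIntegral_odd (fun y => ?_) c
  rw [S.depth_eq, S.depth_eq, norm_neg, smul_neg]

theorem trimmedMean_self (S : TrimmedSetting F ν f w h0 hm m₀ α β c) :
    trimmedMean med mad w α F = 0 := by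
  rw [trimmedMean, S.region_eq, S.setIntegral_weight_smul, smul_zero]

/-- The part of the influence function of the trimmed mean due to the change of depths. -/
def depthInfluence (f : EuclideanSpace ℝ (Fin d) → ℝ)
    (w : ℝ → ℝ) (h0 hm m₀ α β c c₁ : ℝ) (x : EuclideanSpace ℝ (Fin d)) :
    EuclideanSpace ℝ (Fin d) :=
  (∫ u : Metric.sphere (0 : EuclideanSpace ℝ (Fin d)) 1,
    (c * w α * f (c • (u : EuclideanSpace ℝ (Fin d))) * c ^ (d - 1) *
    radiusInfluence h0 hm m₀ β (inner ℝ (u : EuclideanSpace ℝ (Fin d)) x)) •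
      (u : EuclideanSpace ℝ (Fin d)) ∂(volume : Measure (EuclideanSpace ℝ (Fin d))).toSphere)
    + (c₁ / ‖x‖) • x

/-- Separates the motion of the boundary from the change of weights. The uncontaminated integral
over the ball, being zero by symmetry, is subtracted at no cost. -/
theorem integral_region_eq (S : TrimmedSetting F ν f w h0 hm m₀ α β c)
    (x : EuclideanSpace ℝ (Fin d)) : ∀ᶠ ε in 𝓝[>] (0 : ℝ),
    IntegrableOn (fun y => w (depth med mad (contaminate F ε x) y) • y)
      (region med mad α (contaminate F ε x)) F ∧
    ∫ y in region med mad α (contaminate F ε x), w (depth med mad (contaminate F ε x) y) • y ∂F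
      = (∫ y, regionChange F α c ε x y • (w (depth med mad (contaminate F ε x) y) • y) ∂F)
        + ∫ y in {y | ‖y‖ ≤ c},
          (w (depth med mad (contaminate F ε x) y) - w (depth med mad F y)) • y ∂F := by
  obtain ⟨K', hK', hN⟩ := exists_nearlySpherical S.symm S.regular
  filter_upwards [hN, S.integral_regionChange x] with ε hN hI
  have i0 := S.integrableOn_weight_smul S.nearlySpherical
  have i1 := S.integrableOn_weight_smul (hN x)
  have e : (region med mad α (contaminate F ε x)).indicator
      (fun y => w (depth med mad (contaminate F ε x) y) • y)
      = fun y => regionChange F α c ε x y • (w (depth med mad (contaminate F ε x) y) • y)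
        + {y : EuclideanSpace ℝ (Fin d) | ‖y‖ ≤ c}.indicator
          (fun y => w (depth med mad (contaminate F ε x) y) • y) y := by
    ext1 y
    rw [regionChange, sub_smul]
    by_cases h1 : y ∈ region med mad α (contaminate F ε x) <;>
      by_cases h2 : y ∈ {y : EuclideanSpace ℝ (Fin d) | ‖y‖ ≤ c} <;>
      simp only [h1, h2, indicator_of_mem, indicator_of_notMem, not_false_eq_true, Pi.one_apply,
        one_smul, zero_smul, sub_zero, sub_self, zero_sub, add_zero, zero_add,
        neg_add_cancel]
  have i1' := (integrable_indicator_iff measurableSet_ball).2 i1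
  constructor
  · rw [← integrable_indicator_iff ((hN x).measurableSet_region α), e]
    exact hI.1.add i1'
  · rw [← integral_indicator ((hN x).measurableSet_region α), e, integral_add hI.1 i1',
      integral_indicator measurableSet_ball]
    congr 1
    simp only [sub_smul]
    rw [integral_sub i1 i0, S.setIntegral_weight_smul, sub_zero]

theorem tendsto_numerator (S : TrimmedSetting F ν f w h0 hm m₀ α β c) {c₁ : ℝ}
    (hc₁ : c₁ = (∫ y in {y | ‖y‖ ≤ c}, radialDeriv w m₀ ‖y‖ * |y ⟨0, S.dim_pos⟩| ∂F)
        / (2 * h0 * m₀)) (x : EuclideanSpace ℝ (Fin d)) :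
    Tendsto (fun ε => (1 - ε) • (ε⁻¹ • ∫ y in region med mad α (contaminate F ε x),
        w (depth med mad (contaminate F ε x) y) • y ∂F)) (𝓝[>] 0)
      (𝓝 (depthInfluence f w h0 hm m₀ α β c c₁ x)) := by
  have T1 := (S.tendsto_integral_regionChange x).add (S.tendsto_integral_weight_sub x)
  rw [S.integral_weightInfluence x, ← hc₁] at T1
  have T2 : Tendsto (fun ε : ℝ => 1 - ε) (𝓝[>] 0) (𝓝 1) := by
    have : Tendsto (fun ε : ℝ => 1 - ε) (𝓝 0) (𝓝 (1 - 0)) :=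
      (by fun_prop : Continuous fun ε : ℝ => 1 - ε).tendsto 0
    rw [sub_zero] at this
    exact this.mono_left nhdsWithin_le_nhds
  have T := T2.smul T1
  rw [one_smul] at T
  refine T.congr' ?_
  filter_upwards [S.integral_region_eq x] with ε h
  rw [h.2, smul_add ε⁻¹]

theorem integral_contaminate {V : Type*} [NormedAddCommGroup V] [NormedSpace ℝ V]
    [CompleteSpace V] {g : EuclideanSpace ℝ (Fin d) → V} (hg : Integrable g F) {ε : ℝ}
    (hε0 : 0 ≤ ε) (hε1 : ε ≤ 1) (x : EuclideanSpace ℝ (Fin d)) :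
    ∫ y, g y ∂(contaminate F ε x) = (1 - ε) • ∫ y, g y ∂F + ε • g x := by
  have hd : Integrable g (Measure.dirac x) := integrable_dirac (by simp)
  rw [contaminate, integral_add_measure (hg.smul_measure ENNReal.ofReal_ne_top)
    (hd.smul_measure ENNReal.ofReal_ne_top), integral_smul_measure, integral_smul_measure,
    integral_dirac, ENNReal.toReal_ofReal (by linarith), ENNReal.toReal_ofReal hε0]

/-- Since the functional is zero at `F`, the difference quotient is the contaminated mean over `ε`.
The factor `ε⁻¹` cancels against the mass of the atom, leaving the value at `x` undivided. -/
theorem slope_trimmedMean_eq (S : TrimmedSetting F ν f w h0 hm m₀ α β c)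
    (x : EuclideanSpace ℝ (Fin d)) : ∀ᶠ ε in 𝓝[>] (0 : ℝ),
    ε⁻¹ • (trimmedMean med mad w α (contaminate F ε x) - trimmedMean med mad w α F)
      = (∫ y in region med mad α (contaminate F ε x),
          w (depth med mad (contaminate F ε x) y) ∂(contaminate F ε x))⁻¹ •
        ((1 - ε) • (ε⁻¹ • ∫ y in region med mad α (contaminate F ε x),
          w (depth med mad (contaminate F ε x) y) • y ∂F) +
        (region med mad α (contaminate F ε x)).indicator
          (fun y => w (depth med mad (contaminate F ε x) y) • y) x) := by
  obtain ⟨K', hK', hN⟩ := exists_nearlySpherical S.symm S.regular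
  have hlt : ∀ᶠ ε in 𝓝[>] (0 : ℝ), ε < 1 := nhdsWithin_le_nhds (gt_mem_nhds one_pos)
  filter_upwards [hN, S.integral_region_eq x, self_mem_nhdsWithin, hlt] with ε hN hI hε hε1
  have hε : 0 < ε := hε
  have hmeas := (hN x).measurableSet_region α
  rw [S.trimmedMean_self, sub_zero, trimmedMean, ← integral_indicator (f := fun y =>
    w (depth med mad (contaminate F ε x) y) • y) hmeas, integral_contaminate
    ((integrable_indicator_iff hmeas).2 hI.1) hε.le hε1.le, integral_indicator hmeas,
    smul_comm, smul_add ε⁻¹, inv_smul_smul₀ hε.ne', smul_comm ε⁻¹ (1 - ε)]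

theorem tendsto_denominator (S : TrimmedSetting F ν f w h0 hm m₀ α β c)
    (x : EuclideanSpace ℝ (Fin d)) :
    Tendsto (fun ε => ∫ y in region med mad α (contaminate F ε x),
          w (depth med mad (contaminate F ε x) y) ∂(contaminate F ε x)) (𝓝[>] 0)
      (𝓝 (∫ y in {y | ‖y‖ ≤ c}, w (depth med mad F y) ∂F)) := by
  have := S.prob
  obtain ⟨M, hM, hMb, -, -⟩ := exists_weight_bounds S.w_smooth
  obtain ⟨K', hK', hN⟩ := exists_nearlySpherical S.symm S.regular
  have hlt : ∀ᶠ ε in 𝓝[>] (0 : ℝ), ε < 1 := nhdsWithin_le_nhds (gt_mem_nhds one_pos)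
  have hid : Tendsto (fun ε : ℝ => ε) (𝓝[>] 0) (𝓝 0) := nhdsWithin_le_nhds
  have T2 : Tendsto (fun ε : ℝ => ε • (region med mad α (contaminate F ε x)).indicator
      (fun y => w (depth med mad (contaminate F ε x) y)) x) (𝓝[>] 0) (𝓝 0) := by
    refine squeeze_zero_norm' (a := fun ε => M * ε) ?_ (tendsto_const_mul_zero M)
    filter_upwards [self_mem_nhdsWithin] with ε hε
    have hε : 0 < ε := hε
    rw [norm_smul, Real.norm_of_nonneg hε.le, mul_comm]
    gcongr
    exact (norm_indicator_le_norm_self _ _).trans (hMb _ depth_mem_Icc)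
  have T := (((hid.const_sub 1).smul (S.tendsto_integral_weight x))).add T2
  rw [sub_zero, one_smul, add_zero] at T
  refine T.congr' ?_
  filter_upwards [hN, self_mem_nhdsWithin, hlt] with ε hN hε hε1
  have hε : 0 < ε := hε
  have hmeas := (hN x).measurableSet_region α
  have hint : Integrable ((region med mad α (contaminate F ε x)).indicator
      (fun y => w (depth med mad (contaminate F ε x) y))) F := by
    refine Integrable.of_bound ((S.measurable_weight_of_nearlySpherical (hN x)).indicator
        hmeas).aestronglyMeasurable M (Eventually.of_forall fun y => ?_)
    exact (norm_indicator_le_norm_self _ _).trans (hMb _ depth_mem_Icc)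
  rw [← integral_indicator hmeas (μ := contaminate F ε x),
    integral_contaminate hint hε.le hε1.le, integral_indicator hmeas]

/-- The only question is whether `x` eventually belongs to its own contaminated region; the
alternatives in `hx` are exactly what settles it on the sphere. -/
theorem tendsto_point_contribution (S : TrimmedSetting F ν f w h0 hm m₀ α β c)
    {x : EuclideanSpace ℝ (Fin d)} (hx : ‖x‖ ≠ c ∨ 1 ≤ β ∨ β * h0 < 2 * hm) :
    Tendsto (fun ε => (region med mad α (contaminate F ε x)).indicator
          (fun y => w (depth med mad (contaminate F ε x) y) • y) x) (𝓝[>] 0)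
      (𝓝 ({y : EuclideanSpace ℝ (Fin d) | ‖y‖ ≤ c}.indicator
                (fun y => w (1 / (1 + ‖y‖ / m₀)) • y) x)) := by
  have hmem : ∀ᶠ ε in 𝓝[>] (0 : ℝ), (x ∈ region med mad α (contaminate F ε x) ↔ ‖x‖ ≤ c) := by
    by_cases hxc : ‖x‖ = c
    · have hcond := hx.resolve_left (not_not.2 hxc)
      filter_upwards [eventually_self_mem_region S.symm S.regular S.α_pos S.α_lt S.β_eq hcond
        (x := x) (by rw [← S.c_eq, hxc])] with ε h
      exact iff_of_true h hxc.le
    · have h := eventually_mem_region_iff S.dim_pos S.symm S.regular S.α_pos S.α_lt S.β_eq x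
        (y := x) (by rwa [← S.c_eq])
      rwa [← S.c_eq] at h
  have Tw := ProjDepth.tendsto_weight S.dim_pos S.symm S.regular S.mad_eq x x
    S.w_smooth.continuousOn
  rw [S.depth_eq] at Tw
  by_cases hc : ‖x‖ ≤ c
  · rw [indicator_of_mem (by exact hc)]
    refine (Tw.smul_const x).congr' ?_
    filter_upwards [hmem] with ε h
    rw [indicator_of_mem (h.2 hc)]
  · rw [indicator_of_notMem (by exact hc)]
    refine tendsto_const_nhds.congr' ?_
    filter_upwards [hmem] with ε h
    rw [indicator_of_notMem (fun h' => hc (h.1 h'))]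

theorem hasInfluence_trimmedMean (S : TrimmedSetting F ν f w h0 hm m₀ α β c) {c₀ c₁ : ℝ}
    (hc₀ : c₀ = ∫ y in {y | ‖y‖ ≤ c}, w (depth med mad F y) ∂F) (hc₀' : c₀ ≠ 0)
    (hc₁ : c₁ = (∫ y in {y | ‖y‖ ≤ c}, radialDeriv w m₀ ‖y‖ * |y ⟨0, S.dim_pos⟩| ∂F)
        / (2 * h0 * m₀)) {x : EuclideanSpace ℝ (Fin d)}
    (hx : ‖x‖ ≠ c ∨ 1 ≤ β ∨ β * h0 < 2 * hm) :
    HasInfluence (trimmedMean med mad w α) F x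
      (c₀⁻¹ • (depthInfluence f w h0 hm m₀ α β c c₁ x +
        {y : EuclideanSpace ℝ (Fin d) | ‖y‖ ≤ c}.indicator
                (fun y => w (1 / (1 + ‖y‖ / m₀)) • y) x)) := by
  have TD := S.tendsto_denominator x
  rw [← hc₀] at TD
  refine ((TD.inv₀ hc₀').smul ((S.tendsto_numerator hc₁ x).add
    (S.tendsto_point_contribution hx))).congr' ?_
  filter_upwards [S.slope_trimmedMean_eq x] with ε h
  rw [h]

theorem abs_radiusInfluence_le (S : TrimmedSetting F ν f w h0 hm m₀ α β c) (s : ℝ) :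
    |radiusInfluence h0 hm m₀ β s| ≤ β * (1 / (4 * hm)) + 1 / (2 * h0) := by
  have h0p := S.regular.h0_pos
  have bp := S.β_pos
  rw [radiusInfluence]
  refine (abs_add_le _ _).trans (add_le_add ?_ ?_)
  · rw [abs_mul, abs_of_pos bp]
    exact mul_le_mul_of_nonneg_left (abs_madInfluence_le S.regular.hm_pos _ _) bp.le
  · rw [abs_div, abs_of_pos (show 0 < 2 * h0 by positivity)]
    gcongr
    exact abs_sign_le s

theorem measurable_radiusInfluence (h0 hm m₀ β : ℝ) :
    Measurable (radiusInfluence h0 hm m₀ β) :=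
  ((measurable_madInfluence h0 hm m₀).const_mul β).add (measurable_sign.div_const _)

theorem exists_boundary_density_bound (S : TrimmedSetting F ν f w h0 hm m₀ α β c) :
    ∃ C, ∀ x u : EuclideanSpace ℝ (Fin d), ‖u‖ = 1 →
      ‖(c * w α * f (c • u) * c ^ (d - 1) * radiusInfluence h0 hm m₀ β (inner ℝ u x)) • u‖ ≤ C := by
  have cp := S.c_pos
  obtain ⟨δ, hδ, Mf, hMf, -, hfb⟩ := S.exists_density_bound
  refine ⟨c * |w α| * Mf * c ^ (d - 1) * (β * (1 / (4 * hm)) + 1 / (2 * h0)), fun x u hu => ?_⟩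
  have h1 := S.abs_radiusInfluence_le (inner ℝ u x)
  have h2 : f (c • u) ≤ Mf := hfb _ (by
    rw [norm_smul, hu, mul_one, Real.norm_of_nonneg cp.le, sub_self, abs_zero]; exact hδ)
  have h3 := S.f_nonneg (c • u)
  rw [norm_smul, hu, mul_one, norm_mul, norm_mul, norm_mul, norm_mul, norm_pow,
    Real.norm_of_nonneg cp.le, Real.norm_of_nonneg h3, Real.norm_eq_abs, Real.norm_eq_abs]
  gcongr

theorem integrable_boundary (S : TrimmedSetting F ν f w h0 hm m₀ α β c)
    (x : EuclideanSpace ℝ (Fin d)) :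
    Integrable (fun u : Metric.sphere (0 : EuclideanSpace ℝ (Fin d)) 1 =>
      (c * w α * f (c • (u : EuclideanSpace ℝ (Fin d))) * c ^ (d - 1) *
        radiusInfluence h0 hm m₀ β (inner ℝ (u : EuclideanSpace ℝ (Fin d)) x)) •
          (u : EuclideanSpace ℝ (Fin d)))
      (volume : Measure (EuclideanSpace ℝ (Fin d))).toSphere := by
  obtain ⟨C, hC⟩ := S.exists_boundary_density_bound
  refine Integrable.of_bound (Measurable.aestronglyMeasurable ?_) C
    (Eventually.of_forall fun u => hC x u (by simp))
  have hf := S.measurable_f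
  have hr := measurable_radiusInfluence h0 hm m₀ β
  have hin : Measurable fun u : Metric.sphere (0 : EuclideanSpace ℝ (Fin d)) 1 =>
      radiusInfluence h0 hm m₀ β (inner ℝ (u : EuclideanSpace ℝ (Fin d)) x) :=
    hr.comp (by fun_prop)
  have hfu : Measurable fun u : Metric.sphere (0 : EuclideanSpace ℝ (Fin d)) 1 =>
      f (c • (u : EuclideanSpace ℝ (Fin d))) := hf.comp (by fun_prop)
  fun_prop

/-- The bound is obtained on the difference quotients and passed to the limit, so it covers points
of the sphere where membership of `x` is undecided but the limit exists. -/
theorem exists_influence_bound (S : TrimmedSetting F ν f w h0 hm m₀ α β c) {c₀ c₁ : ℝ}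
    (hc₀ : c₀ = ∫ y in {y | ‖y‖ ≤ c}, w (depth med mad F y) ∂F) (hc₀' : c₀ ≠ 0)
    (hc₁ : c₁ = (∫ y in {y | ‖y‖ ≤ c}, radialDeriv w m₀ ‖y‖ * |y ⟨0, S.dim_pos⟩| ∂F)
        / (2 * h0 * m₀)) :
    ∃ C : ℝ, ∀ x L : EuclideanSpace ℝ (Fin d),
      HasInfluence (trimmedMean med mad w α) F x L → ‖L‖ ≤ C := by
  have cp := S.c_pos
  obtain ⟨C, hC⟩ := S.exists_boundary_density_bound
  obtain ⟨M, hM, hMb, -, -⟩ := exists_weight_bounds S.w_smooth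
  obtain ⟨K, hK, hN⟩ := exists_nearlySpherical S.symm S.regular
  set A : ℝ := C * (volume : Measure (EuclideanSpace ℝ (Fin d))).toSphere.real univ + |c₁| with hA
  refine ⟨|c₀|⁻¹ * (A + M * (c + 1)), fun x L hL => ?_⟩
  have hdI : ‖depthInfluence f w h0 hm m₀ α β c c₁ x‖ ≤ A := by
    rw [depthInfluence]
    refine (norm_add_le _ _).trans (add_le_add ?_ ?_)
    · exact norm_integral_le_of_norm_le_const (Eventually.of_forall fun u => hC x u (by simp))
    · rw [norm_smul, norm_div, norm_norm, Real.norm_eq_abs]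
      rcases eq_or_ne ‖x‖ 0 with h | h
      · rw [h, mul_zero]; exact abs_nonneg _
      · rw [div_mul_cancel₀ _ h]
  have TD := S.tendsto_denominator x
  rw [← hc₀] at TD
  have TU := ((TD.inv₀ hc₀').norm).mul (((S.tendsto_numerator hc₁ x).norm).add_const (M * (c + 1)))
  -- For small `ε` the region lies in the ball of radius `c + 1`, so the atom contributes at most `M
  -- * (c + 1)` if it is inside and nothing otherwise.
  have hle : ‖L‖ ≤ ‖c₀⁻¹‖ * (‖depthInfluence f w h0 hm m₀ α β c c₁ x‖ + M * (c + 1)) := by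
    refine le_of_tendsto_of_tendsto hL.norm TU ?_
    have small := (tendsto_const_mul_zero ((β + 1) * K)).eventually (gt_mem_nhds one_pos)
    filter_upwards [S.slope_trimmedMean_eq x, hN, small] with ε h hN hsm
    rw [h, norm_smul]
    gcongr
    refine (norm_add_le _ _).trans (add_le_add_right ?_ _)
    by_cases hx : x ∈ region med mad α (contaminate F ε x)
    · rw [indicator_of_mem hx, norm_smul]
      have := (hN x).norm_le_of_mem_region S.dim_pos S.α_pos S.α_lt S.β_eq hx
      rw [← S.c_eq] at this
      gcongr
      · exact hMb _ depth_mem_Icc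
      · linarith
    · rw [indicator_of_notMem hx, norm_zero]
      positivity
  refine hle.trans ?_
  rw [norm_inv, Real.norm_eq_abs]
  gcongr

end TrimmedSetting

end ProjDepth

end

/-! ### Translation to the stated constants, and the conclusion -/

noncomputable section

namespace ProjDepth

variable {d : ℕ}

theorem HasInfluence.influence_eq {V : Type*} [NormedAddCommGroup V] [NormedSpace ℝ V]
    {T : Measure (EuclideanSpace ℝ (Fin d)) → V} {F : Measure (EuclideanSpace ℝ (Fin d))}
    {x : EuclideanSpace ℝ (Fin d)} {L : V} (h : HasInfluence T F x L) : influence T F x = L :=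
  Tendsto.limUnder_eq h

theorem radiusInfluence_eq {m₀ s : ℝ} (hs : |s| ≠ m₀) (h0 hm β : ℝ) :
    radiusInfluence h0 hm m₀ β s
      = β * Real.sign (|s| - m₀) / (4 * hm) + Real.sign s / (2 * h0) := by
  rw [radiusInfluence, madInfluence, if_neg hs, mul_div_assoc]

/-- Integration of a function of `X / m₀` over a ball. -/
theorem setIntegral_map_inv_smul {m₀ β : ℝ} (hm₀ : 0 < m₀)
    (F : Measure (EuclideanSpace ℝ (Fin d))) (g : EuclideanSpace ℝ (Fin d) → ℝ) :
    ∫ y in {y | ‖y‖ ≤ β}, g y ∂(F.map fun y => m₀⁻¹ • y)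
      = ∫ y in {y | ‖y‖ ≤ β * m₀}, g (m₀⁻¹ • y) ∂F := by
  have emb : MeasurableEmbedding fun y : EuclideanSpace ℝ (Fin d) => m₀⁻¹ • y :=
    (Homeomorph.smulOfNeZero m₀⁻¹ (inv_ne_zero hm₀.ne')).measurableEmbedding
  rw [emb.setIntegral_map]
  congr 2
  ext y
  rw [mem_preimage, mem_ofPred_eq, mem_ofPred_eq, norm_smul,
    Real.norm_of_nonneg (inv_nonneg.2 hm₀.le), inv_mul_le_iff₀ hm₀, mul_comm]

end ProjDepth

end

theorem corollary2 {d : ℕ} (hd : 0 < d)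
    -- the spherically symmetric distribution `F`, with density `f`
    (F : Measure (EuclideanSpace ℝ (Fin d))) [IsProbabilityMeasure F]
    (f : EuclideanSpace ℝ (Fin d) → ℝ) (hf_meas : Measurable f) (hf_nonneg : ∀ y, 0 ≤ f y)
    (hFf : F = volume.withDensity fun y => ENNReal.ofReal (f y))
    -- the law `ν` of `Z`, with density `h` and MAD `m₀`
    (ν : Measure ℝ) (hFν : ProjDepth.IsSphericallySymmetric F ν)
    (h : ℝ → ℝ) (hh_meas : Measurable h) (hh_nonneg : ∀ z, 0 ≤ h z)
    (hνh : ν = volume.withDensity fun z => ENNReal.ofReal (h z))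
    (m₀ : ℝ) (hm₀ : m₀ = ProjDepth.mad ν)
    (h_zero : ∀ᶠ z in 𝓝 (0 : ℝ), ContinuousAt h z ∧ 0 < h z)
    (h_m₀ : ∀ᶠ z in 𝓝 m₀, ContinuousAt h z ∧ 0 < h z)
    -- the level `α`, with `β = β(α)` and `c = c(α)`
    (α : ℝ) (hα_pos : 0 < α) (hα_lt : α < 1)
    (β : ℝ) (hβ : β = (1 - α) / α) (c : ℝ) (hc : c = β * m₀)
    (hf_cont : ∃ δ > 0, ContinuousOn f {y | |‖y‖ - c| < δ})
    -- the weight function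
    (w : ℝ → ℝ) (hw : ContDiffOn ℝ 1 w (Icc 0 1))
    (hw_ne : ∫ y in ProjDepth.region ProjDepth.med ProjDepth.mad α F,
      w (ProjDepth.depth ProjDepth.med ProjDepth.mad F y) ∂F ≠ 0)
    -- the constants of the formula; `F₀` is the law of `X / m₀`
    (F₀ : Measure (EuclideanSpace ℝ (Fin d))) (hF₀ : F₀ = F.map fun y => m₀⁻¹ • y)
    (c₀ : ℝ) (hc₀ : c₀ = ∫ y in {y | ‖y‖ ≤ β}, w (1 / (1 + ‖y‖)) ∂F₀)
    (c₁ : ℝ) (hc₁ : c₁ = ∫ y in {y | ‖y‖ ≤ β},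
      |y ⟨0, hd⟩| * derivWithin w (Icc 0 1) (1 / (1 + ‖y‖)) / (2 * h 0 * (1 + ‖y‖) ^ 2) ∂F₀) :
    -- the influence function of the radius: its explicit value, existence for almost all
    -- directions, integrability
    (∀ x u : EuclideanSpace ℝ (Fin d), ‖u‖ = 1 →
      (x = 0 ∨ (inner ℝ u x ≠ 0 ∧ |inner ℝ u x| ≠ m₀)) →
      ProjDepth.HasInfluence (ProjDepth.radius ProjDepth.med ProjDepth.mad α u) F x
        (β * Real.sign (|inner ℝ u x| - m₀) / (4 * h m₀)
          + Real.sign (inner ℝ u x) / (2 * h 0))) ∧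
    (∀ x : EuclideanSpace ℝ (Fin d),
      (∀ᵐ u : Metric.sphere (0 : EuclideanSpace ℝ (Fin d)) 1
          ∂(volume : Measure (EuclideanSpace ℝ (Fin d))).toSphere,
        ProjDepth.HasInfluence (ProjDepth.radius ProjDepth.med ProjDepth.mad α u) F x
          (ProjDepth.influence (ProjDepth.radius ProjDepth.med ProjDepth.mad α u) F x)) ∧
      Integrable (fun u : Metric.sphere (0 : EuclideanSpace ℝ (Fin d)) 1 =>
        (c * w α * f (c • (u : EuclideanSpace ℝ (Fin d))) * c ^ (d - 1) *
          ProjDepth.influence (ProjDepth.radius ProjDepth.med ProjDepth.mad α u) F x) •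
            (u : EuclideanSpace ℝ (Fin d)))
        (volume : Measure (EuclideanSpace ℝ (Fin d))).toSphere) ∧
    -- the influence function of the trimmed mean
    (∀ x : EuclideanSpace ℝ (Fin d),
      (‖x‖ ≠ c ∨ α ≤ 1 / 2 ∨ β * h 0 < 2 * h m₀) →
      ProjDepth.HasInfluence (ProjDepth.trimmedMean ProjDepth.med ProjDepth.mad w α) F x
        (c₀⁻¹ •
          ((∫ u : Metric.sphere (0 : EuclideanSpace ℝ (Fin d)) 1,
              (c * w α * f (c • (u : EuclideanSpace ℝ (Fin d))) * c ^ (d - 1) *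
                ProjDepth.influence (ProjDepth.radius ProjDepth.med ProjDepth.mad α u) F x) •
                  (u : EuclideanSpace ℝ (Fin d))
              ∂(volume : Measure (EuclideanSpace ℝ (Fin d))).toSphere)
            + (c₁ / ‖x‖) • x
            + {y : EuclideanSpace ℝ (Fin d) | ‖y‖ ≤ c}.indicator
                (fun y => w (1 / (1 + ‖y‖ / m₀)) • y) x))) ∧
    -- its boundedness
    (∃ C : ℝ, ∀ x L : EuclideanSpace ℝ (Fin d),
      ProjDepth.HasInfluence (ProjDepth.trimmedMean ProjDepth.med ProjDepth.mad w α) F x L →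
        ‖L‖ ≤ C) := by
  obtain ⟨u₀, hu₀⟩ : ∃ u : EuclideanSpace ℝ (Fin d), ‖u‖ = 1 :=
    ⟨EuclideanSpace.single ⟨0, hd⟩ 1, by simp⟩
  have hν : IsProbabilityMeasure ν := by
    rw [← hFν.2 u₀ hu₀, ProjDepth.proj]
    exact Measure.isProbabilityMeasure_map (by fun_prop)
  have R := ProjDepth.isRegular_of_density hFν.1 hh_meas hh_nonneg hνh hm₀ h_zero.self_of_nhds
    h_m₀.self_of_nhds
  have S : ProjDepth.TrimmedSetting F ν f w (h 0) (h m₀) m₀ α β c :=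
    ⟨hd, ‹_›, hf_meas, hf_nonneg, hFf, hFν, R, hm₀, hα_pos, hα_lt, hβ, hc, hf_cont, hw⟩
  have mp := R.m₀_pos
  have h0p := R.h0_pos
  have hmp := R.hm_pos
  have hnorm : ∀ y : EuclideanSpace ℝ (Fin d), ‖m₀⁻¹ • y‖ = ‖y‖ / m₀ := fun y => by
    rw [norm_smul, Real.norm_of_nonneg (inv_nonneg.2 mp.le), inv_mul_eq_div]
  have hc₀' : c₀ = ∫ y in {y | ‖y‖ ≤ c},
      w (ProjDepth.depth ProjDepth.med ProjDepth.mad F y) ∂F := by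
    rw [hc₀, hF₀, ProjDepth.setIntegral_map_inv_smul mp, ← hc]
    simp only [hnorm, S.depth_eq]
  have hc₀_ne : c₀ ≠ 0 := by
    rwa [hc₀', ← S.region_eq]
  -- Passing from `X / m₀` back to `X` rescales the coordinate `|y₁|`, which accounts for the extra
  -- `m₀` in the denominator.
  have hc₁' : c₁ = (∫ y in {y | ‖y‖ ≤ c},
      ProjDepth.TrimmedSetting.radialDeriv w m₀ ‖y‖ * |y ⟨0, S.dim_pos⟩| ∂F) / (2 * h 0 * m₀) := by
    rw [hc₁, hF₀, ProjDepth.setIntegral_map_inv_smul mp, ← hc, ← integral_div]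
    refine integral_congr_ae (Eventually.of_forall fun y => ?_)
    simp only [hnorm, ProjDepth.TrimmedSetting.radialDeriv, PiLp.smul_apply, smul_eq_mul, abs_mul,
      abs_of_pos (inv_pos.2 mp)]
    field_simp
  have hrad : ∀ x : EuclideanSpace ℝ (Fin d),
      ∀ᵐ u : Metric.sphere (0 : EuclideanSpace ℝ (Fin d)) 1
        ∂(volume : Measure (EuclideanSpace ℝ (Fin d))).toSphere,
        ProjDepth.HasInfluence (ProjDepth.radius ProjDepth.med ProjDepth.mad α u) F x
          (ProjDepth.radiusInfluence (h 0) (h m₀) m₀ β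
            (inner ℝ (u : EuclideanSpace ℝ (Fin d)) x)) := fun x => by
    filter_upwards [ProjDepth.ae_toSphere_stableDirection hd hFν R x] with u hu
    exact hu.hasInfluence_radius hd hFν R hm₀ (by simp) hα_pos hα_lt hβ
  -- The limit defining `influence` is known to exist only off a null set of directions, so it is
  -- replaced by the explicit formula almost everywhere under the integral.
  have hsphere : ∀ x : EuclideanSpace ℝ (Fin d),
      (fun u : Metric.sphere (0 : EuclideanSpace ℝ (Fin d)) 1 =>
        (c * w α * f (c • (u : EuclideanSpace ℝ (Fin d))) * c ^ (d - 1) *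
          ProjDepth.radiusInfluence (h 0) (h m₀) m₀ β
            (inner ℝ (u : EuclideanSpace ℝ (Fin d)) x)) • (u : EuclideanSpace ℝ (Fin d)))
      =ᵐ[(volume : Measure (EuclideanSpace ℝ (Fin d))).toSphere] fun u =>
        (c * w α * f (c • (u : EuclideanSpace ℝ (Fin d))) * c ^ (d - 1) *
          ProjDepth.influence (ProjDepth.radius ProjDepth.med ProjDepth.mad α u) F x) •
            (u : EuclideanSpace ℝ (Fin d)) := fun x => by
    filter_upwards [hrad x] with u hu
    rw [hu.influence_eq]
  refine ⟨fun x u hu hxu => ?_, fun x => ⟨?_, (S.integrable_boundary x).congr (hsphere x)⟩,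
    fun x hx => ?_, S.exists_influence_bound hc₀' hc₀_ne hc₁'⟩
  · have hs : ProjDepth.StableDirection F x u := by
      rcases hxu with rfl | hxu
      · exact ProjDepth.stableDirection_zero hFν hu
      · exact ProjDepth.stableDirection_of_generic hFν R hu hxu.1 hxu.2
    have hne : |inner ℝ u x| ≠ m₀ := by
      rcases hxu with rfl | hxu
      · simpa using mp.ne
      · exact hxu.2
    rw [← ProjDepth.radiusInfluence_eq hne]
    exact hs.hasInfluence_radius hd hFν R hm₀ hu hα_pos hα_lt hβ
  · filter_upwards [hrad x] with u hu
    rwa [hu.influence_eq]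
  · rw [← integral_congr_ae (hsphere x)]
    refine S.hasInfluence_trimmedMean hc₀' hc₀_ne hc₁' (hx.imp_right (Or.imp_left fun hα => ?_))
    -- The condition `α ≤ 1/2` is the condition `1 ≤ β`.
    rw [hβ, le_div_iff₀ hα_pos]
    linarith
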